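/- Let $K\ge 2$, $m_0\ge 0$ be integers and $\lambda>0$. Let $\mathcal B$ be the infinite tree with root $0$ in which every vertex has $K+1$ neighbours, and write $y\prec x$ if $\mathrm{dist}(0,x)=\mathrm{dist}(0,y)+\mathrm{dist}(y,x)$. Let $J$ be the set of vertices of $\mathcal B$ whose distance to $0$ is a multiple of $m_0+1$, and for $y\in J$ let $P_y$ be the projection of $\ell^2(\mathcal B)$ onto the functions supported on $\{x: y\prec x,\ \mathrm{dist}(y,x)\le m_0\}$. Let $(\omega_y)_{y\in J}$ be i.i.d. real random variables with law $\rho(t)\,dt$, where $\rho\in L^\infty(\mathbb R)$ has compact support. Put $H^\omega_\lambda=\Delta+\lambda\sum_{y\in J}\omega_yP_y$ with $(\Delta\psi)(x)=\sum_{\mathrm{dist}(x,y)=1}\psi(y)$, let $\Lambda_L=\{x:\mathrm{dist}(0,x)\le L\}$, and let $H^\omega_{\lambda,L}=\chi_{\Lambda_L}H^\omega_\lambda\chi_{\Lambda_L}$ on $\ell^2(\Lambda_L)$. Let $\mathcal C$ be the canopy tree: its vertices form countable layers $\mathcal C_0=\partial\mathcal C,\mathcal C_1,\mathcal C_2,\dots$,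 each layer $\mathcal C_n$ is partitioned into sets of $K$ vertices, each of which is joined to a single vertex of $\mathcal C_{n+1}$ (a different one for each set, every vertex of $\mathcal C_{n+1}$ occurring), and the resulting graph is connected. Let $J_{\mathcal C}=\{y:\mathrm{dist}(\partial\mathcal C,y)=m_0+(m_0+1)k \text{ for some integer } k\ge 0\}$, and for $y\in J_{\mathcal C}$ let $P_y$ be the projection onto the functions supported on $\{x:\mathrm{dist}(y,x)\le m_0,\ \mathrm{dist}(\partial\mathcal C,y)=\mathrm{dist}(\partial\mathcal C,x)+\mathrm{dist}(x,y)\}$. Put $H^\omega_{\mathcal C,\lambda}=\Delta_{\mathcal C}+\lambda\sum_{y\in J_{\mathcal C}}\omega_yP_y$ on $\ell^2(\mathcal C)$, with $\Delta_{\mathcal C}$ the adjacency operator and $(\omega_y)_{y\in J_{\mathcal C}}$ i.i.d. with law $\rho(t)\,dt$. Let $E_H$ denote the spectral projections of a self-adjoint operator $H$. Then for any interval $I\subset\mathbb R$, almost surely, $$\frac1{|\Lambda_L|}\,\mathrm{tr}\bigl(E_{H^\omega_{\lambda,L}}(I)\bigr)\longrightarrow n_{\mathcal C,\lambda}(I)$$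 as $L\to\infty$ through the integers $L$ of the form $m_0+(m_0+1)k$, $k\ge 0$ (those for which every set $\{x: y\prec x,\ \mathrm{dist}(y,x)\le m_0\}$ with $y\in J\cap\Lambda_L$ lies in $\Lambda_L$; for $m_0=0$ these are all $L$), where $$n_{\mathcal C,\lambda}(I)=\frac{K-1}{K}\sum_{n=0}^\infty K^{-n}\,\mathbb E\bigl[\langle\delta_{x_n},E_{H^\omega_{\mathcal C,\lambda}}(I)\,\delta_{x_n}\rangle\bigr]$$ and $(x_n)_{n\ge 0}$ is any sequence of vertices of $\mathcal C$ with $\mathrm{dist}(\partial\mathcal C,x_n)=n$. The same formula, for Borel sets in place of $I$, defines a finite measure $n_{\mathcal C,\lambda}$ on $\mathbb R$, and this measure is absolutely continuous with respect to the Lebesgue measure. -/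

import Mathlib

open MeasureTheory ProbabilityTheory Filter Topology
open scoped InnerProductSpace CompactlySupported ENNReal

namespace TreeAnderson

noncomputable section

section Spectral

variable {E : Type*} [NormedAddCommGroup E] [InnerProductSpace ℂ E] [CompleteSpace E]

/-- The positive functional `f ↦ ⟨ψ, f(T) ψ⟩` on `C_c(ℝ)`, where `f(T)` is the continuous functional
calculus of the bounded self-adjoint operator `T`. -/
def spectralFunctional (T : E →L[ℂ] E) (ψ : E) : C_c(ℝ, ℝ) →ₚ[ℝ] ℝ :=
  PositiveLinearMap.mk₀
    { toFun := fun f => (⟪ψ, cfc (fun t => f t) T ψ⟫_ℂ).re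
      map_add' := fun f g => by
        have h := cfc_add (R := ℝ) (a := T) (fun t => f t) (fun t => g t)
          (map_continuous f).continuousOn (map_continuous g).continuousOn
        simp only [CompactlySupportedContinuousMap.coe_add, Pi.add_apply]
        rw [h]
        simp
      map_smul' := fun c f => by
        have h := cfc_smul (R := ℝ) c (fun t => f t) T (map_continuous f).continuousOn
        simp only [CompactlySupportedContinuousMap.coe_smul, Pi.smul_apply]
        rw [h]
        simp [inner_smul_right_eq_smul] }
    (fun f hf => by
      have h : (0 : E →L[ℂ] E) ≤ cfc (fun t => f t) T := cfc_nonneg (fun x _ => hf x)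
      have h2 := ((ContinuousLinearMap.nonneg_iff_isPositive _).1 h).inner_nonneg_right ψ
      exact (Complex.le_def.1 h2).1)

/-- The spectral measure of the bounded self-adjoint operator `T` at the vector `ψ`: the regular Borel
measure on `ℝ` with `∫ f dμ = ⟨ψ, f(T) ψ⟩` for all `f ∈ C_c(ℝ)`. -/
def spectralMeasure (T : E →L[ℂ] E) (ψ : E) : Measure ℝ :=
  RealRMK.rieszMeasure (spectralFunctional T ψ)

theorem integral_spectralMeasure (T : E →L[ℂ] E) (ψ : E) (f : C_c(ℝ, ℝ)) :
    ∫ t, f t ∂(spectralMeasure T ψ) = (⟪ψ, cfc (fun t => f t) T ψ⟫_ℂ).re :=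
  RealRMK.integral_rieszMeasure (Λ := spectralFunctional T ψ) f

instance (T : E →L[ℂ] E) (ψ : E) : (spectralMeasure T ψ).Regular := by
  unfold spectralMeasure; infer_instance

theorem spectralMeasure_univ_le (T : E →L[ℂ] E) (ψ : E) :
    spectralMeasure T ψ Set.univ ≤ ENNReal.ofReal (‖ψ‖ ^ 2) := by
  rw [isOpen_univ.measure_eq_iSup_isCompact]
  refine iSup₂_le fun K _ => iSup_le fun hK => ?_
  obtain ⟨f, hf1, hf2, hf3⟩ :=
    exists_continuousMap_one_of_isCompact_subset_isOpen hK isOpen_univ (Set.subset_univ K)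
  have h1 := RealRMK.rieszMeasure_le_of_eq_one (Λ := spectralFunctional T ψ)
    (f := ⟨f, hasCompactSupport_def.mpr hf2⟩) (fun x => (hf3.2 x).1) hK (fun x hx => hf1 hx)
  refine h1.trans (ENNReal.ofReal_le_ofReal ?_)
  change (⟪ψ, cfc (fun t => f t) T ψ⟫_ℂ).re ≤ _
  have h2 : ‖cfc (fun t => f t) T‖ ≤ 1 := norm_cfc_le zero_le_one fun x _ => by
    rw [Real.norm_eq_abs, abs_of_nonneg (hf3.2 x).1]; exact (hf3.2 x).2
  calc (⟪ψ, cfc (fun t => f t) T ψ⟫_ℂ).re ≤ ‖⟪ψ, cfc (fun t => f t) T ψ⟫_ℂ‖ := Complex.re_le_norm _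
    _ ≤ ‖ψ‖ * ‖cfc (fun t => f t) T ψ‖ := norm_inner_le_norm _ _
    _ ≤ ‖ψ‖ * (1 * ‖ψ‖) := by
        gcongr
        exact (ContinuousLinearMap.le_opNorm _ _).trans (by gcongr)
    _ = ‖ψ‖ ^ 2 := by ring

instance (T : E →L[ℂ] E) (ψ : E) : IsFiniteMeasure (spectralMeasure T ψ) :=
  ⟨(spectralMeasure_univ_le T ψ).trans_lt ENNReal.ofReal_lt_top⟩

/-- Linear relations between quadratic forms pass to the spectral measures. -/
theorem spectralMeasure_relation (T : E →L[ℂ] E) {n : ℕ} (c : Fin n → ℝ) (v : Fin n → E)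
    (h : ∀ A : E →L[ℂ] E, ∑ i, c i * (⟪v i, A (v i)⟫_ℂ).re = 0) (B : Set ℝ) :
    ∑ i, c i * (spectralMeasure T (v i)).real B = 0 := by
  have hμ : ∑ i, ENNReal.ofReal (c i) • spectralMeasure T (v i)
      = ∑ i, ENNReal.ofReal (-c i) • spectralMeasure T (v i) := by
    have hfin : ∀ d : Fin n → ℝ,
        IsFiniteMeasure (∑ i, ENNReal.ofReal (d i) • spectralMeasure T (v i)) := fun d => by
      have : ∀ i, IsFiniteMeasure (ENNReal.ofReal (d i) • spectralMeasure T (v i)) := fun i =>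
        Measure.smul_finite _ ENNReal.ofReal_ne_top
      infer_instance
    have := hfin c
    have := hfin (fun i => -c i)
    refine Measure.ext_of_integral_eq_on_compactlySupported fun f => ?_
    have hi : ∀ i, Integrable (fun t => f t) (spectralMeasure T (v i)) := fun i =>
      (map_continuous f).integrable_of_hasCompactSupport f.hasCompactSupport
    have hs : ∀ d : Fin n → ℝ,
        ∫ t, f t ∂(∑ i, ENNReal.ofReal (d i) • spectralMeasure T (v i))
          = ∑ i, (ENNReal.ofReal (d i)).toReal * (⟪v i, cfc (fun t => f t) T (v i)⟫_ℂ).re := by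
      intro d
      rw [integral_finsetSum_measure fun i _ => (hi i).smul_measure ENNReal.ofReal_ne_top]
      refine Finset.sum_congr rfl fun i _ => ?_
      rw [integral_smul_measure, integral_spectralMeasure, smul_eq_mul]
    rw [hs, hs, ← sub_eq_zero, ← Finset.sum_sub_distrib, ← h (cfc (fun t => f t) T)]
    refine Finset.sum_congr rfl fun i _ => ?_
    rw [← sub_mul, ENNReal.toReal_ofReal', ENNReal.toReal_ofReal']
    congr 1
    rcases le_total (c i) 0 with hc | hc
    · rw [max_eq_right hc, max_eq_left (by linarith)]; ring
    · rw [max_eq_left hc, max_eq_right (by linarith)]; ring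
  have hB := congrArg (fun μ : Measure ℝ => (μ B).toReal) hμ
  simp only [Measure.coe_finsetSum, Finset.sum_apply, Measure.smul_apply, smul_eq_mul] at hB
  rw [ENNReal.toReal_sum fun i _ => by finiteness, ENNReal.toReal_sum fun i _ => by finiteness,
    ← sub_eq_zero, ← Finset.sum_sub_distrib] at hB
  rw [← hB]
  refine Finset.sum_congr rfl fun i _ => ?_
  rw [ENNReal.toReal_mul, ENNReal.toReal_mul, ← sub_mul, ENNReal.toReal_ofReal',
    ENNReal.toReal_ofReal', Measure.real]
  congr 1
  rcases le_total (c i) 0 with hc | hc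
  · rw [max_eq_right hc, max_eq_left (by linarith)]; ring
  · rw [max_eq_left hc, max_eq_right (by linarith)]; ring

theorem exists_spectralProjection (T : E →L[ℂ] E) (B : Set ℝ) :
    ∃ Q : E →L[ℂ] E, ∀ ψ : E, ⟪ψ, Q ψ⟫_ℂ = ((spectralMeasure T ψ).real B : ℂ) := by
  set q : E → ℝ := fun ψ => (spectralMeasure T ψ).real B with hq
  have qle : ∀ ψ, q ψ ≤ ‖ψ‖ ^ 2 := fun ψ => by
    refine ENNReal.toReal_le_of_le_ofReal (by positivity) ?_
    exact (measure_mono (Set.subset_univ B)).trans (spectralMeasure_univ_le T ψ)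
  have q0 : ∀ ψ, 0 ≤ q ψ := fun ψ => measureReal_nonneg
  have qsmul : ∀ (a : ℂ) (x : E), q (a • x) = Complex.normSq a * q x := fun a x => by
    have := spectralMeasure_relation T ![1, -Complex.normSq a] ![a • x, x] (fun A => by
      simp [Fin.sum_univ_succ, Complex.normSq_apply]; ring) B
    simp [Fin.sum_univ_succ] at this
    simp only [hq]; linarith
  set r : E → E → ℝ := fun x y => (q (x + y) - q (x - y)) / 4 with hr
  have rsymm : ∀ x y, r x y = r y x := fun x y => by
    have := qsmul (-1) (x - y)
    simp at this
    simp only [hr, add_comm y x, this]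
  have radd : ∀ x y z, r x (y + z) = r x y + r x z := fun x y z => by
    have := spectralMeasure_relation T ![1, -1, -1, 1, -1, 1]
      ![x + (y + z), x - (y + z), x + y, x - y, x + z, x - z] (fun A => by
      simp [Fin.sum_univ_succ]
      ring) B
    simp [Fin.sum_univ_succ] at this
    simp only [hr, hq]; linarith
  have rsmul : ∀ (a : ℝ) x y, r x ((a : ℂ) • y) = a * r x y := fun a x y => by
    have := spectralMeasure_relation T ![1, -1, -a, a]
      ![x + (a : ℂ) • y, x - (a : ℂ) • y, x + y, x - y] (fun A => by
      simp [Fin.sum_univ_succ]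
      ring) B
    simp [Fin.sum_univ_succ, -Complex.coe_smul] at this
    simp only [hr, hq]; linarith
  have rI : ∀ x y, r (Complex.I • x) (Complex.I • y) = r x y := fun x y => by
    simp only [hr, ← smul_add, ← smul_sub, qsmul]; simp
  have rneg : ∀ x y, r x (-y) = - r x y := fun x y => by
    have := rsmul (-1) x y
    simpa using this
  have rI' : ∀ x y, r (Complex.I • x) y = - r x (Complex.I • y) := fun x y => by
    rw [← rI x (Complex.I • y), smul_smul, Complex.I_mul_I, neg_one_smul, rneg, neg_neg]
  have rle : ∀ x y, |r x y| ≤ ‖x‖ * ‖y‖ := by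
    have key : ∀ x y : E, ‖x‖ = 1 → ‖y‖ = 1 → |r x y| ≤ 1 := fun x y hx hy => by
      have h1 := qle (x + y)
      have h2 := qle (x - y)
      have h3 : ‖x + y‖ ≤ 2 := (norm_add_le _ _).trans (by rw [hx, hy]; norm_num)
      have h4 : ‖x - y‖ ≤ 2 := (norm_sub_le _ _).trans (by rw [hx, hy]; norm_num)
      have h5 := q0 (x + y)
      have h6 := q0 (x - y)
      have h7 : ‖x + y‖ ^ 2 ≤ 4 := by nlinarith [norm_nonneg (x + y)]
      have h8 : ‖x - y‖ ^ 2 ≤ 4 := by nlinarith [norm_nonneg (x - y)]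
      simp only [hr]
      rw [abs_le]; constructor <;> linarith
    intro x y
    rcases eq_or_ne x 0 with rfl | hx
    · have := qsmul (-1) y
      simp at this
      simp [hr, this]
    rcases eq_or_ne y 0 with rfl | hy
    · simp [hr]
    have h1 := key (((‖x‖⁻¹ : ℝ) : ℂ) • x) (((‖y‖⁻¹ : ℝ) : ℂ) • y)
      (by rw [norm_smul]; simp [hx]) (by rw [norm_smul]; simp [hy])
    rw [rsmul, rsymm, rsmul, rsymm, abs_mul, abs_mul, abs_of_pos (by positivity),
      abs_of_pos (by positivity)] at h1
    have hx' : 0 < ‖x‖ := norm_pos_iff.2 hx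
    have hy' : 0 < ‖y‖ := norm_pos_iff.2 hy
    calc |r x y| = ‖x‖ * ‖y‖ * (‖y‖⁻¹ * (‖x‖⁻¹ * |r x y|)) := by field_simp
      _ ≤ ‖x‖ * ‖y‖ * 1 := by gcongr
      _ = _ := mul_one _
  have radd' : ∀ x y z, r (x + y) z = r x z + r y z := fun x y z => by
    rw [rsymm, radd, rsymm z, rsymm z]
  have csmul : ∀ (c : ℂ) (x : E), c • x = (c.re : ℂ) • x + (c.im : ℂ) • (Complex.I • x) :=
    fun c x => by rw [smul_smul, ← add_smul, Complex.re_add_im]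
  have rc : ∀ (c : ℂ) x y, r x (c • y) = c.re * r x y + c.im * r x (Complex.I • y) :=
    fun c x y => by rw [csmul, radd, rsmul, rsmul]
  have rc' : ∀ (c : ℂ) x y, r (c • x) y = c.re * r x y - c.im * r x (Complex.I • y) :=
    fun c x y => by rw [rsymm, rc, rsymm y, rsymm y, rI']; ring
  let s : E →ₗ⋆[ℂ] E →ₗ[ℂ] ℂ := LinearMap.mk₂'ₛₗ (starRingEnd ℂ) (RingHom.id ℂ)
    (fun x y => (r x y : ℂ) - Complex.I * (r x (Complex.I • y) : ℂ))
    (fun x y z => by simp only [radd']; push_cast; ring)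
    (fun c x y => by
      simp only [rc', smul_smul, Complex.I_mul_I, neg_one_smul, rneg]
      apply Complex.ext <;> simp <;> ring)
    (fun x y z => by simp only [smul_add, radd]; push_cast; ring)
    (fun c x y => by
      rw [smul_comm Complex.I c y, rc c x y, rc c x (Complex.I • y)]
      simp only [ smul_smul, Complex.I_mul_I, neg_one_smul, rneg]
      apply Complex.ext <;> simp <;> ring)
  have sbound : ∀ x y, ‖s x y‖ ≤ 2 * ‖x‖ * ‖y‖ := fun x y => by
    change ‖(r x y : ℂ) - Complex.I * (r x (Complex.I • y) : ℂ)‖ ≤ _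
    refine (norm_sub_le _ _).trans ?_
    have h1 := rle x y
    have h2 := rle x (Complex.I • y)
    rw [norm_smul, Complex.norm_I, one_mul] at h2
    rw [norm_mul, Complex.norm_I, one_mul, Complex.norm_real, Complex.norm_real,
      Real.norm_eq_abs, Real.norm_eq_abs]
    linarith
  refine ⟨InnerProductSpace.continuousLinearMapOfBilin (s.mkContinuous₂ 2 sbound), fun ψ => ?_⟩
  have h1 : r ψ ψ = q ψ := by
    have h2 := qsmul 2 ψ
    have h3 := qsmul 0 ψ
    simp [Complex.normSq_apply] at h2 h3
    simp only [hr, sub_self, ← two_smul ℂ ψ]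
    rw [h2, h3]; ring
  have h2 : r ψ (Complex.I • ψ) = 0 := by
    have := rI' ψ ψ
    rw [rsymm] at this
    linarith
  rw [← inner_conj_symm, InnerProductSpace.continuousLinearMapOfBilin_apply]
  change starRingEnd ℂ ((r ψ ψ : ℂ) - Complex.I * (r ψ (Complex.I • ψ) : ℂ)) = _
  rw [h1, h2]; simp [hq]

/-- The spectral projection `E_T(B)` of the bounded self-adjoint operator `T` for the Borel set `B`:
the unique bounded operator with `⟨ψ, E_T(B) ψ⟩ = μ_ψ(B)` for all `ψ`, where `μ_ψ` is the spectral
measure of `T` at `ψ`. -/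
def spectralProjection (T : E →L[ℂ] E) (B : Set ℝ) : E →L[ℂ] E :=
  (exists_spectralProjection T B).choose

theorem inner_spectralProjection (T : E →L[ℂ] E) (B : Set ℝ) (ψ : E) :
    ⟪ψ, spectralProjection T B ψ⟫_ℂ = ((spectralMeasure T ψ).real B : ℂ) :=
  (exists_spectralProjection T B).choose_spec ψ

end Spectral

section Operators

variable {V : Type*}

/-- The complex Hilbert space `ℓ²(V)`. -/
abbrev Ell2 (V : Type*) := lp (fun _ : V => ℂ) 2

open Classical in
/-- The unit vector `δ_x`. -/
def delta (x : V) : Ell2 V := lp.single 2 x (1 : ℂ)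

/-- The expression `∑_{y ∼ x} ψ(y) + lam * ∑_{y ∈ J} w_y (P_y ψ)(x)`, where `P_y` is multiplication by
the indicator function of `block y`. -/
def andersonAction (G : SimpleGraph V) (J : Set V) (block : V → Set V) (lam : ℝ) (w : J → ℝ)
    (ψ : V → ℂ) (x : V) : ℂ :=
  (∑' y : G.neighborSet x, ψ y) + lam * ∑' y : J, (w y : ℂ) * (block y).indicator ψ x

open Classical in
/-- The operator `Δ + lam * ∑_{y ∈ J} w_y P_y` on `ℓ²(V)`: the bounded operator acting by
`andersonAction`. By `exists_andersonOperator` it exists as soon as the degrees and the potential are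
bounded; the value `0` is used only if there is no such bounded operator. -/
def andersonOperator (G : SimpleGraph V) (J : Set V) (block : V → Set V) (lam : ℝ) (w : J → ℝ) :
    Ell2 V →L[ℂ] Ell2 V :=
  if h : ∃ T : Ell2 V →L[ℂ] Ell2 V, ∀ ψ x, T ψ x = andersonAction G J block lam w ψ x
  then h.choose else 0

theorem ell2_norm_sq (ψ : Ell2 V) : ‖ψ‖ ^ 2 = ∑' x, ‖ψ x‖ ^ 2 := by
  have := lp.norm_rpow_eq_tsum (p := 2) (by norm_num) ψ
  simpa using this

theorem ell2_summable (ψ : Ell2 V) : Summable fun x => ‖ψ x‖ ^ 2 := by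
  have := (lp.memℓp ψ).summable (by norm_num)
  simpa using this

theorem exists_andersonOperator (G : SimpleGraph V) (J : Set V) (block : V → Set V) (lam : ℝ)
    (w : J → ℝ) (d : ℕ) (hfin : ∀ x, (G.neighborSet x).Finite)
    (hd : ∀ x, (G.neighborSet x).ncard ≤ d) (C : ℝ)
    (hC : ∀ x, ‖∑' y : J, (w y : ℂ) * (block y).indicator 1 x‖ ≤ C) :
    ∃ T : Ell2 V →L[ℂ] Ell2 V, ∀ ψ x, T ψ x = andersonAction G J block lam w ψ x := by
  have hact : ∀ (ψ : V → ℂ) x, andersonAction G J block lam w ψ x =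
      ∑ y ∈ (hfin x).toFinset, ψ y
        + lam * (∑' y : J, (w y : ℂ) * (block y).indicator 1 x) * ψ x := fun ψ x => by
    have h1 : ∑' y : G.neighborSet x, ψ y = ∑ y ∈ (hfin x).toFinset, ψ y := by
      rw [← Finset.tsum_subtype]
      exact (Equiv.setCongr (by simp)).tsum_eq (fun y : ((hfin x).toFinset : Set V) => ψ y)
    rw [andersonAction, h1, mul_assoc, ← tsum_mul_right]
    congr 3
    funext y
    by_cases hx : x ∈ block y <;> simp [hx]
  have hC0 : ∀ x : V, 0 ≤ C := fun x => (norm_nonneg _).trans (hC x)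
  let D : ℝ := |lam| * C
  have hpt : ∀ (ψ : V → ℂ) x, ‖andersonAction G J block lam w ψ x‖ ^ 2 ≤
      2 * d * ∑ y ∈ (hfin x).toFinset, ‖ψ y‖ ^ 2 + 2 * D ^ 2 * ‖ψ x‖ ^ 2 := fun ψ x => by
    rw [hact]
    have h1 : ‖∑ y ∈ (hfin x).toFinset, ψ y‖ ^ 2 ≤ d * ∑ y ∈ (hfin x).toFinset, ‖ψ y‖ ^ 2 := by
      calc ‖∑ y ∈ (hfin x).toFinset, ψ y‖ ^ 2 ≤ (∑ y ∈ (hfin x).toFinset, ‖ψ y‖) ^ 2 := by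
            gcongr; exact norm_sum_le _ _
        _ ≤ (hfin x).toFinset.card * ∑ y ∈ (hfin x).toFinset, ‖ψ y‖ ^ 2 := sq_sum_le_card_mul_sum_sq
        _ ≤ _ := by
            gcongr
            rw [← Set.ncard_eq_toFinset_card _ (hfin x)]
            exact hd x
    have h2 : ‖lam * (∑' y : J, (w y : ℂ) * (block y).indicator 1 x) * ψ x‖ ≤ D * ‖ψ x‖ := by
      rw [norm_mul, norm_mul, Complex.norm_real, Real.norm_eq_abs]
      change _ ≤ |lam| * C * _
      gcongr
      exact hC x
    set a := ∑ y ∈ (hfin x).toFinset, ψ y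
    set b := lam * (∑' y : J, (w y : ℂ) * (block y).indicator 1 x) * ψ x
    have h3 : ‖a + b‖ ≤ ‖a‖ + ‖b‖ := norm_add_le _ _
    have h4 : ‖b‖ ^ 2 ≤ (D * ‖ψ x‖) ^ 2 := by gcongr
    have h5 : ‖a + b‖ ^ 2 ≤ (‖a‖ + ‖b‖) ^ 2 := by gcongr
    nlinarith [sq_nonneg (‖a‖ - ‖b‖)]
  have hswap : ∀ (s : Finset V) (ψ : Ell2 V),
      ∑ x ∈ s, ∑ y ∈ (hfin x).toFinset, ‖ψ y‖ ^ 2 ≤ d * ‖ψ‖ ^ 2 := fun s ψ => by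
    classical
    calc ∑ x ∈ s, ∑ y ∈ (hfin x).toFinset, ‖ψ y‖ ^ 2
        = ∑ y ∈ s.biUnion (fun x => (hfin x).toFinset),
            ∑ x ∈ s.filter (fun x => G.Adj x y), ‖ψ y‖ ^ 2 := by
          refine Finset.sum_comm' fun x y => ?_
          simp only [Set.Finite.mem_toFinset, SimpleGraph.mem_neighborSet, Finset.mem_filter,
            Finset.mem_biUnion]
          exact ⟨fun h => ⟨h, x, h⟩, fun h => h.1⟩
      _ ≤ ∑ y ∈ s.biUnion (fun x => (hfin x).toFinset), d * ‖ψ y‖ ^ 2 := by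
          refine Finset.sum_le_sum fun y _ => ?_
          rw [Finset.sum_const, nsmul_eq_mul]
          gcongr
          refine le_trans ?_ (hd y)
          rw [Set.ncard_eq_toFinset_card _ (hfin y)]
          refine Finset.card_le_card fun x hx => ?_
          simpa [SimpleGraph.adj_comm] using (Finset.mem_filter.1 hx).2
      _ ≤ d * ‖ψ‖ ^ 2 := by
          rw [← Finset.mul_sum, ell2_norm_sq]
          gcongr
          exact (ell2_summable ψ).sum_le_tsum _ fun _ _ => by positivity
  let M : ℝ := 2 * d * d + 2 * D ^ 2
  have hM : 0 ≤ M := by positivity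
  have hbd : ∀ (s : Finset V) (ψ : Ell2 V),
      ∑ x ∈ s, ‖andersonAction G J block lam w ψ x‖ ^ 2 ≤ M * ‖ψ‖ ^ 2 := fun s ψ => by
    calc ∑ x ∈ s, ‖andersonAction G J block lam w ψ x‖ ^ 2
        ≤ ∑ x ∈ s, (2 * d * ∑ y ∈ (hfin x).toFinset, ‖ψ y‖ ^ 2 + 2 * D ^ 2 * ‖ψ x‖ ^ 2) :=
          Finset.sum_le_sum fun x _ => hpt ψ x
      _ = 2 * d * ∑ x ∈ s, ∑ y ∈ (hfin x).toFinset, ‖ψ y‖ ^ 2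
            + 2 * D ^ 2 * ∑ x ∈ s, ‖ψ x‖ ^ 2 := by
          rw [Finset.sum_add_distrib, Finset.mul_sum, Finset.mul_sum]
      _ ≤ 2 * d * (d * ‖ψ‖ ^ 2) + 2 * D ^ 2 * ‖ψ‖ ^ 2 := by
          gcongr
          · exact hswap s ψ
          · rw [ell2_norm_sq]
            exact (ell2_summable ψ).sum_le_tsum _ fun _ _ => by positivity
      _ = M * ‖ψ‖ ^ 2 := by ring
  have hmem : ∀ ψ : Ell2 V, Memℓp (andersonAction G J block lam w ψ) 2 := fun ψ =>
    memℓp_gen' (C := M * ‖ψ‖ ^ 2) fun s => by simpa using hbd s ψ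
  let T : Ell2 V →ₗ[ℂ] Ell2 V :=
    { toFun := fun ψ => ⟨andersonAction G J block lam w ψ, hmem ψ⟩
      map_add' := fun φ ψ => by
        refine Subtype.ext (funext fun x => ?_)
        change andersonAction G J block lam w (⇑φ + ⇑ψ) x =
          andersonAction G J block lam w φ x + andersonAction G J block lam w ψ x
        simp only [hact, Pi.add_apply, Finset.sum_add_distrib]
        ring
      map_smul' := fun c ψ => by
        refine Subtype.ext (funext fun x => ?_)
        change andersonAction G J block lam w (c • ⇑ψ) x =
          c * andersonAction G J block lam w ψ x
        simp only [hact, Pi.smul_apply, smul_eq_mul, ← Finset.mul_sum]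
        ring }
  refine ⟨T.mkContinuous (Real.sqrt M) fun ψ => ?_, fun ψ x => rfl⟩
  refine abs_le_of_sq_le_sq' ?_ (by positivity) |>.2
  rw [mul_pow, Real.sq_sqrt hM, ell2_norm_sq]
  exact Real.tsum_le_of_sum_le (fun x => by positivity) fun s => hbd s ψ

theorem andersonOperator_apply (G : SimpleGraph V) (J : Set V) (block : V → Set V) (lam : ℝ)
    (w : J → ℝ)
    (h : ∃ T : Ell2 V →L[ℂ] Ell2 V, ∀ ψ x, T ψ x = andersonAction G J block lam w ψ x)
    (ψ : Ell2 V) (x : V) :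
    andersonOperator G J block lam w ψ x = andersonAction G J block lam w ψ x := by
  rw [andersonOperator, dif_pos h]
  exact h.choose_spec ψ x

open Classical in
/-- Extension by zero of a function on `U`. -/
def zeroExtension (U : Set V) (ψ : U → ℂ) (x : V) : ℂ := if h : x ∈ U then ψ ⟨x, h⟩ else 0

theorem zeroExtension_coe (U : Set V) (ψ : U → ℂ) (x : U) : zeroExtension U ψ x = ψ x := by
  simp [zeroExtension]

theorem zeroExtension_of_notMem (U : Set V) (ψ : U → ℂ) {x : V} (hx : x ∉ U) :
    zeroExtension U ψ x = 0 := by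
  simp [zeroExtension, hx]

/-- Extension by zero, as an isometry `ℓ²(U) → ℓ²(V)`. -/
def extendZero (U : Set V) : Ell2 U →ₗᵢ[ℂ] Ell2 V where
  toFun ψ := ⟨zeroExtension U ψ, memℓp_gen (by
    have h := (Subtype.val_injective.summable_iff (f := fun x => ‖zeroExtension U ψ x‖ ^ 2)
      fun x hx => by rw [zeroExtension_of_notMem U ψ (by simpa using hx)]; simp).1
      (by simpa [Function.comp_def, zeroExtension_coe] using ell2_summable ψ)
    simpa using h)⟩
  map_add' φ ψ := Subtype.ext <| funext fun x => by
    change zeroExtension U (⇑φ + ⇑ψ) x = zeroExtension U φ x + zeroExtension U ψ x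
    by_cases h : x ∈ U <;> simp [zeroExtension, h]
  map_smul' c ψ := Subtype.ext <| funext fun x => by
    change zeroExtension U (c • ⇑ψ) x = c * zeroExtension U ψ x
    by_cases h : x ∈ U <;> simp [zeroExtension, h]
  norm_map' ψ := by
    refine (sq_eq_sq₀ (norm_nonneg _) (norm_nonneg _)).1 ?_
    rw [ell2_norm_sq, ell2_norm_sq]
    change ∑' x, ‖zeroExtension U ψ x‖ ^ 2 = _
    have hsupp : Function.support (fun x => ‖zeroExtension U ψ x‖ ^ 2)
        ⊆ Set.range ((↑) : U → V) := fun x hx => by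
      by_contra hx'
      exact hx (by simp [zeroExtension_of_notMem U ψ (show x ∉ U by simpa using hx')])
    rw [← Subtype.val_injective.tsum_eq hsupp]
    simp [zeroExtension_coe]

/-- The cut-off `χ_U T χ_U`, regarded as an operator on `ℓ²(U)`. -/
def compress (U : Set V) (T : Ell2 V →L[ℂ] Ell2 V) : Ell2 U →L[ℂ] Ell2 U :=
  ContinuousLinearMap.adjoint (extendZero U).toContinuousLinearMap ∘L T ∘L
    (extendZero U).toContinuousLinearMap

end Operators

section Models

/-- Vertices of the rooted tree in which every vertex has `K + 1` neighbours: the root, and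
for every nonempty path from the root its end point, encoded by the first step `i` and the list `w`
of the later steps (the latest one at the head). -/
inductive BetheVertex (K : ℕ) : Type
  | root : BetheVertex K
  | node (i : Fin (K + 1)) (w : List (Fin K)) : BetheVertex K

/-- `BetheChild x y`: the vertex `y` is a child of the vertex `x`. -/
inductive BetheChild {K : ℕ} : BetheVertex K → BetheVertex K → Prop
  | first (i : Fin (K + 1)) : BetheChild BetheVertex.root (BetheVertex.node i [])
  | next (i : Fin (K + 1)) (w : List (Fin K)) (j : Fin K) :
      BetheChild (BetheVertex.node i w) (BetheVertex.node i (j :: w))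

/-- The Bethe lattice. -/
def betheGraph (K : ℕ) : SimpleGraph (BetheVertex K) := SimpleGraph.fromRel BetheChild

/-- The ball `Λ_L` around the root. -/
def betheBall (K L : ℕ) : Set (BetheVertex K) :=
  {x | (betheGraph K).dist BetheVertex.root x ≤ L}

/-- The index set `J`: the vertices whose distance to the root is a multiple of `m₀ + 1`. -/
def betheSites (K m₀ : ℕ) : Set (BetheVertex K) :=
  {y | ∃ k : ℕ, (betheGraph K).dist BetheVertex.root y = (m₀ + 1) * k}

/-- The support of `P_y`: the vertices `x` forward to `y` with `dist(y, x) ≤ m₀`. -/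
def betheBlock (K m₀ : ℕ) (y : BetheVertex K) : Set (BetheVertex K) :=
  {x | (betheGraph K).dist y x ≤ m₀ ∧
    (betheGraph K).dist BetheVertex.root x =
      (betheGraph K).dist BetheVertex.root y + (betheGraph K).dist y x}

/-- The operator `H_lam` on the Bethe lattice for the values `w` of the random variables. -/
def betheOperator (K m₀ : ℕ) (lam : ℝ) (w : betheSites K m₀ → ℝ) :
    Ell2 (BetheVertex K) →L[ℂ] Ell2 (BetheVertex K) :=
  andersonOperator (betheGraph K) (betheSites K m₀) (betheBlock K m₀) lam w

/-- The cut-off operator `H_{lam, L} = χ_{Λ_L} H_lam χ_{Λ_L}` on `ℓ²(Λ_L)`. -/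
def betheCutoff (K m₀ : ℕ) (lam : ℝ) (w : betheSites K m₀ → ℝ) (L : ℕ) :
    Ell2 (betheBall K L) →L[ℂ] Ell2 (betheBall K L) :=
  compress (betheBall K L) (betheOperator K m₀ lam w)

/-- Vertices of the canopy tree: `(n, i)` is the `i`-th vertex of the layer `n`. -/
abbrev CanopyVertex : Type := ℕ × ℕ

/-- The canopy tree: each layer `n` is partitioned into the sets of `K` vertices
`(n, K * j), …, (n, K * j + K - 1)`, which are joined to the vertex `(n + 1, j)`. -/
def canopyGraph (K : ℕ) : SimpleGraph CanopyVertex :=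
  SimpleGraph.fromRel fun x y => y = (x.1 + 1, x.2 / K)

/-- The boundary of the canopy tree, that is, its layer `0`. -/
def canopyBoundary : Set CanopyVertex := {x | x.1 = 0}

/-- The distance of `x` to the boundary of the canopy tree. -/
def canopyBoundaryDist (K : ℕ) (x : CanopyVertex) : ℕ :=
  sInf ((fun b => (canopyGraph K).dist b x) '' canopyBoundary)

/-- The index set `J` of the canopy tree. -/
def canopySites (K m₀ : ℕ) : Set CanopyVertex :=
  {y | ∃ k : ℕ, canopyBoundaryDist K y = m₀ + (m₀ + 1) * k}

/-- The support of `P_y` in the canopy tree. -/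
def canopyBlock (K m₀ : ℕ) (y : CanopyVertex) : Set CanopyVertex :=
  {x | (canopyGraph K).dist y x ≤ m₀ ∧
    canopyBoundaryDist K y = canopyBoundaryDist K x + (canopyGraph K).dist x y}

/-- The operator on the canopy tree for the values `w` of the random variables. -/
def canopyOperator (K m₀ : ℕ) (lam : ℝ) (w : canopySites K m₀ → ℝ) :
    Ell2 CanopyVertex →L[ℂ] Ell2 CanopyVertex :=
  andersonOperator (canopyGraph K) (canopySites K m₀) (canopyBlock K m₀) lam w

/-- The quantity `⟨δ_x, E_H(B) δ_x⟩` for the canopy operator `H` (a real number). -/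
def canopyWeight (K m₀ : ℕ) (lam : ℝ) (w : canopySites K m₀ → ℝ) (B : Set ℝ) (x : CanopyVertex) :
    ℝ :=
  (⟪delta x, spectralProjection (canopyOperator K m₀ lam w) B (delta x)⟫_ℂ).re

/-- `((K - 1) / K) * ∑_n K^{-n} 𝔼 ⟨δ_{x_n}, E_H(B) δ_{x_n}⟩` for the random canopy operator `H`. -/
def canopyDOS {Ω : Type*} [MeasurableSpace Ω] (P : Measure Ω) (K m₀ : ℕ) (lam : ℝ)
    (η : canopySites K m₀ → Ω → ℝ) (x : ℕ → CanopyVertex) (B : Set ℝ) : ℝ :=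
  ((K : ℝ) - 1) / K *
    ∑' n : ℕ, ((K : ℝ) ^ n)⁻¹ * ∫ s, canopyWeight K m₀ lam (fun y => η y s) B (x n) ∂P

end Models

end

end TreeAnderson

open MeasureTheory ProbabilityTheory Filter Topology
open scoped InnerProductSpace CompactlySupported ENNReal

namespace TreeAnderson

noncomputable section

/-! ### Spectral measures of bounded self-adjoint operators: support, moments, Poisson transform. -/

section SpectralMeasure

variable {E : Type*} [NormedAddCommGroup E] [InnerProductSpace ℂ E] [CompleteSpace E]

/-! The normalized trace is the mass that the normalized eigenvalue counting measure gives to `I`,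
that is, the average over `x ∈ Λ_L` of the spectral measures at `δ_x`. All measures involved are
probability measures on one compact interval. By Weierstrass, convergence of moments gives weak
convergence, and weak convergence gives convergence on an interval as soon as its end points are
null for the limit. So two things are needed: almost sure convergence of moments, and absolute
continuity of the limit (`tendsto_measureReal_of_moments`).

Moments. The `p`-th moment at `δ_x` is a sum over walks of length `p`, hence a function of the
finitely many coefficients `ω_y` whose blocks lie within distance `p` of `x`. Moments at distant
vertices are independent, so the variance of the average over `Λ_L` is `O(1/|Λ_L|)`, which is
summable because balls grow exponentially; fluctuations therefore vanish almost surely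
(`SiteModel.ae_tendsto_average_hopMoment`). For the means, note that a positive fraction of the ball
lies near its boundary. Away from the root, the cut-off tree with its blocks embeds in the canopy
tree, the sphere of radius `L` going to the boundary; for `L = m₀ + (m₀ + 1) k` blocks go to blocks.
As the coefficients are i.i.d., the mean moment at distance `n` from the sphere equals the one at
layer `n` of the canopy tree (`integral_hopMoment_bethe_eq_canopy`). The spheres of radius `L - n`
have asymptotic weight `((K - 1) / K) K^{-n}` in the ball, and dominated convergence yields the
series (`BetheVertex.tendsto_average_ball`).

Absolute continuity. As a function of the single coefficient `t` of the block containing `x`, the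
operator is `H + t lam Q` with `Q δ_x = δ_x`. Its resolvent element at `δ_x` is holomorphic for `Im
t ≤ 0` and at most `1 / (lam |Im t|)`; moving the contour off the real axis bounds its average over
`t` uniformly in the spectral parameter (`integral_weight_poisson_le`). Hence the mean spectral
measure of `[a, b]` is at most `D (b - a)`, and the limit, being a mixture of such measures, is
absolutely continuous. -/

theorem spectrum_subset_Icc (T : E →L[ℂ] E) {R : ℝ} (hR : ‖T‖ ≤ R) :
    spectrum ℝ T ⊆ Set.Icc (-R) R := fun t ht => by
  have h0 : 0 ≤ R := (norm_nonneg _).trans hR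
  have h := spectrum.norm_le_norm_mul_of_mem ht
  have h1 : ‖(1 : E →L[ℂ] E)‖ ≤ 1 := ContinuousLinearMap.norm_id_le
  have h2 : ‖t‖ ≤ R := by
    calc ‖t‖ ≤ ‖T‖ * ‖(1 : E →L[ℂ] E)‖ := h
      _ ≤ R * 1 := by gcongr
      _ = R := mul_one R
  exact abs_le.1 h2

/-- The spectral measure of a bounded operator is carried by a bounded interval. -/
theorem spectralMeasure_compl_Icc (T : E →L[ℂ] E) (ψ : E) {R : ℝ} (hR : ‖T‖ ≤ R) :
    spectralMeasure T ψ (Set.Icc (-R) R)ᶜ = 0 := by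
  have ho : IsOpen (Set.Icc (-R) R)ᶜ := isClosed_Icc.isOpen_compl
  rw [ho.measure_eq_iSup_isCompact]
  refine le_antisymm (iSup₂_le fun K hKU => iSup_le fun hK => ?_) zero_le
  obtain ⟨f, hf1, hf2, hf3⟩ := exists_continuousMap_one_of_isCompact_subset_isOpen hK ho hKU
  have h1 := RealRMK.rieszMeasure_le_of_eq_one (Λ := spectralFunctional T ψ)
    (f := ⟨f, hasCompactSupport_def.mpr hf2⟩) (fun x => (hf3.2 x).1) hK (fun x hx => hf1 hx)
  refine h1.trans ?_
  change ENNReal.ofReal (⟪ψ, cfc (fun t => f t) T ψ⟫_ℂ).re ≤ _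
  have h2 : cfc (fun t => f t) T = cfc (fun _ : ℝ => (0 : ℝ)) T := cfc_congr fun t ht =>
    image_eq_zero_of_notMem_tsupport fun h => hf3.1 h (spectrum_subset_Icc T hR ht)
  rw [h2, cfc_const_zero ℝ T]
  simp

/-- A cut-off equal to `1` on `[-‖T‖, ‖T‖]` changes neither side, since both the measure and the
spectrum live there. This gives access to powers and to the Poisson kernel. -/
theorem integral_spectralMeasure_of_continuous (T : E →L[ℂ] E) (ψ : E) {f : ℝ → ℝ}
    (hf : Continuous f) :
    ∫ t, f t ∂(spectralMeasure T ψ) = (⟪ψ, cfc f T ψ⟫_ℂ).re := by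
  obtain ⟨χ, hχ1, hχ2, hχ3⟩ := exists_continuousMap_one_of_isCompact_subset_isOpen
    (isCompact_Icc (a := -‖T‖) (b := ‖T‖)) isOpen_univ (Set.subset_univ _)
  let g : C_c(ℝ, ℝ) := ⟨⟨fun t => χ t * f t, by fun_prop⟩,
    HasCompactSupport.mul_right (hasCompactSupport_def.mpr hχ2)⟩
  have h1 := integral_spectralMeasure T ψ g
  have h2 : ∀ᵐ t ∂(spectralMeasure T ψ), f t = g t := by
    have := spectralMeasure_compl_Icc T ψ le_rfl
    filter_upwards [mem_ae_iff.2 this] with t ht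
    change f t = χ t * f t
    rw [hχ1 ht]; simp
  rw [integral_congr_ae h2, h1]
  congr 3
  refine cfc_congr fun t ht => ?_
  change χ t * f t = f t
  rw [hχ1 (spectrum_subset_Icc T le_rfl ht)]; simp

theorem spectralMeasure_real_univ {T : E →L[ℂ] E} (hT : IsSelfAdjoint T) (ψ : E) :
    (spectralMeasure T ψ).real Set.univ = ‖ψ‖ ^ 2 := by
  have h := integral_spectralMeasure_of_continuous T ψ (f := fun _ => 1) continuous_const
  rw [cfc_const_one ℝ T] at h
  simpa [← Complex.ofReal_pow] using h

theorem integral_pow_spectralMeasure {T : E →L[ℂ] E} (hT : IsSelfAdjoint T) (ψ : E) (n : ℕ) :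
    ∫ t, t ^ n ∂(spectralMeasure T ψ) = (⟪ψ, (T ^ n) ψ⟫_ℂ).re := by
  rw [integral_spectralMeasure_of_continuous T ψ (continuous_pow n), cfc_pow_id T n]

/-- The quadratic form of `T` is real; the sign of `z.im` is positive because the inner product is
conjugate linear in its first argument. This is what makes `T - z` invertible off the real axis. -/
theorem im_inner_sub_smul {T : E →L[ℂ] E} (hT : IsSelfAdjoint T) (z : ℂ) (u : E) :
    (⟪(T - z • (1 : E →L[ℂ] E)) u, u⟫_ℂ).im = z.im * ‖u‖ ^ 2 := by
  have h1 : (⟪T u, u⟫_ℂ).im = 0 := by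
    have h := (ContinuousLinearMap.isSelfAdjoint_iff_isSymmetric.1 hT) u u
    have h2 : starRingEnd ℂ ⟪T u, u⟫_ℂ = ⟪T u, u⟫_ℂ := by
      rw [inner_conj_symm]; exact h.symm
    exact Complex.conj_eq_iff_im.1 h2
  have h2 : (T - z • (1 : E →L[ℂ] E)) u = T u - z • u := rfl
  rw [h2, inner_sub_left, inner_smul_left, inner_self_eq_norm_sq_to_K, Complex.sub_im, h1]
  norm_cast
  simp [Complex.mul_im, -Complex.ofReal_pow]

/-- The Poisson kernel is `Im 1/(t - z)` and `u` is the resolvent applied to `ψ`. With `A = T - z`,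
`B = T - z̄` and `B v = u`, the kernel evaluated at `T` sends `ψ = A B v` to `z.im • v`, and both
sides equal `z.im ‖u‖²`. -/
theorem integral_poisson_spectralMeasure {T : E →L[ℂ] E} (hT : IsSelfAdjoint T) (ψ u : E)
    (z : ℂ) (hz : 0 < z.im) (hu : (T - z • (1 : E →L[ℂ] E)) u = ψ) :
    ∫ t, z.im / ((t - z.re) ^ 2 + z.im ^ 2) ∂(spectralMeasure T ψ) = (⟪ψ, u⟫_ℂ).im := by
  have hcont : Continuous fun t : ℝ => z.im / ((t - z.re) ^ 2 + z.im ^ 2) := by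
    refine Continuous.div continuous_const (by fun_prop) fun t => ?_
    positivity
  rw [integral_spectralMeasure_of_continuous T ψ hcont]
  set A : E →L[ℂ] E := T - z • (1 : E →L[ℂ] E) with hA
  set B : E →L[ℂ] E := T - (starRingEnd ℂ z) • (1 : E →L[ℂ] E) with hB
  have hBunit : IsUnit B := by
    refine ContinuousLinearMap.isUnit_of_forall_le_norm_inner_map B (c := ⟨z.im, hz.le⟩) hz
      fun x => ?_
    refine le_trans ?_ (Complex.abs_im_le_norm _)
    rw [hB, im_inner_sub_smul hT]
    simp only [Complex.conj_im, abs_mul, abs_neg, abs_of_pos hz, abs_pow, abs_norm]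
    exact (mul_comm _ _).le
  obtain ⟨v, hv⟩ := (ContinuousLinearMap.isUnit_iff_bijective.1 hBunit).2 u
  have h1 : cfc (fun t : ℝ => z.im / ((t - z.re) ^ 2 + z.im ^ 2)) T * (A * B)
      = z.im • (1 : E →L[ℂ] E) := by
    have h2 : A * B = cfc (fun t : ℝ => (t - z.re) ^ 2 + z.im ^ 2) T := by
      have h3 : cfc (fun t : ℝ => (t - z.re) ^ 2 + z.im ^ 2) T
          = (T - algebraMap ℝ _ z.re) ^ 2 + algebraMap ℝ _ (z.im ^ 2) := by
        rw [cfc_add (R := ℝ) (a := T) (fun t => (t - z.re) ^ 2) (fun _ => z.im ^ 2)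
          (by fun_prop) (by fun_prop), cfc_pow (fun t : ℝ => t - z.re) 2 T (by fun_prop) hT,
          cfc_sub (R := ℝ) (a := T) (fun t => t) (fun _ => z.re) (by fun_prop) (by fun_prop),
          cfc_id' ℝ T, cfc_const z.re T hT, cfc_const (z.im ^ 2) T hT]
      rw [h3]
      ext x
      simp only [hA, hB, Algebra.algebraMap_eq_smul_one, pow_two,
        mul_apply_eq_comp, add_apply, sub_apply,
        smul_apply, one_apply_eq_self, map_sub, map_smul,
        ← Complex.coe_smul]
      match_scalars <;> apply Complex.ext <;> simp <;> ring
    rw [h2, ← cfc_mul (R := ℝ) (a := T) _ _ hcont.continuousOn (by fun_prop)]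
    rw [cfc_congr (g := fun _ => z.im) fun t _ => ?_, cfc_const z.im T hT,
      Algebra.algebraMap_eq_smul_one]
    have : (t - z.re) ^ 2 + z.im ^ 2 ≠ 0 := by positivity
    field_simp
  have h4 : cfc (fun t : ℝ => z.im / ((t - z.re) ^ 2 + z.im ^ 2)) T ψ = z.im • v := by
    have := congrArg (fun S : E →L[ℂ] E => S v) h1
    simpa [hv, hu] using this
  have h5 : (⟪ψ, v⟫_ℂ) = (‖u‖ : ℂ) ^ 2 := by
    have h6 : (⟪A u, v⟫_ℂ) = ⟪u, B v⟫_ℂ := by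
      have h := (ContinuousLinearMap.isSelfAdjoint_iff_isSymmetric.1 hT) u v
      have h7 : A u = T u - z • u := rfl
      have h8 : B v = T v - (starRingEnd ℂ z) • v := rfl
      rw [h7, h8, inner_sub_left, inner_sub_right, inner_smul_left, inner_smul_right]
      congr 1
    rw [← hu, h6, hv, inner_self_eq_norm_sq_to_K]; rfl
  rw [h4, ← Complex.coe_smul, inner_smul_right, h5, ← hu, im_inner_sub_smul hT]
  norm_cast

end SpectralMeasure

/-! ### Spectral averaging over one coupling constant. -/

section SpectralAveraging

/-- A bound for a weighted integral over a real interval of a function holomorphic in the closed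
lower half-plane that is `O(1 / |Im t|)`; the weight vanishes at the end points. -/
theorem norm_integral_weight_mul_le {F : ℂ → ℂ} (hF : ∀ t : ℂ, t.im ≤ 0 → DifferentiableAt ℂ F t)
    {c : ℝ} (hc : ∀ t : ℂ, t.im ≤ 0 → ‖F t‖ * |t.im| ≤ c) {a : ℝ} (ha : 0 ≤ a) :
    ‖∫ x in (-a)..a, ((a : ℂ) ^ 2 - (x : ℂ) ^ 2) * F x‖
      ≤ (2 * (2 * a + 1) + 2 * a * (a ^ 2 + (a + 1) ^ 2)) * c := by
  set f : ℂ → ℂ := fun t => ((a : ℂ) ^ 2 - t ^ 2) * F t with hf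
  have hc0 : 0 ≤ c := le_trans (by positivity) (hc 0 (by simp))
  -- Cauchy's theorem moves the integral to the other three sides of a rectangle of height one below
  -- the real interval.
  have hrect := Complex.integral_boundary_rect_eq_zero_of_differentiableOn f (⟨-a, -1⟩) (⟨a, 0⟩)
    (fun t ht => by
      have : t.im ≤ 0 := by
        have := ht.2
        simp at this
        exact this.2
      exact (DifferentiableAt.mul (by fun_prop) (hF t this)).differentiableWithinAt)
  simp only [Complex.ofReal_zero, zero_mul, add_zero] at hrect
  -- On the vertical sides the weight contains a factor `y`, which absorbs the singularity `1/|y|`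
  -- of the bound on `F`.
  have hside : ∀ b : ℝ, b ^ 2 = a ^ 2 →
      ‖∫ y : ℝ in (-1)..0, f (b + y * Complex.I)‖ ≤ (2 * a + 1) * c := fun b hb => by
    refine (intervalIntegral.norm_integral_le_of_norm_le_const (C := (2 * a + 1) * c)
      fun y hy => ?_).trans (by simp)
    rw [Set.uIoc_of_le (by norm_num)] at hy
    have habs : |b| = a := by rw [← Real.sqrt_sq_eq_abs, hb, Real.sqrt_sq ha]
    have h1 : ((a : ℂ) ^ 2 - (b + y * Complex.I) ^ 2) = y * (y - 2 * b * Complex.I) := by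
      have : (a : ℂ) ^ 2 = b ^ 2 := by exact_mod_cast hb.symm
      rw [this]; ring_nf; simp
    have h2 : ‖(y : ℂ) - 2 * b * Complex.I‖ ≤ 2 * a + 1 := by
      refine (norm_sub_le _ _).trans ?_
      simp only [Complex.norm_real, norm_mul, Complex.norm_I, Complex.norm_ofNat, Real.norm_eq_abs,
        habs, mul_one]
      have : |y| ≤ 1 := abs_le.2 ⟨by linarith [hy.1], by linarith [hy.2]⟩
      linarith
    have h3 := hc (b + y * Complex.I) (by simpa using hy.2)
    simp only [Complex.add_im, Complex.ofReal_im, Complex.mul_im, Complex.ofReal_re, Complex.I_im,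
      mul_one, Complex.I_re, mul_zero, add_zero, zero_add] at h3
    calc ‖f (b + y * Complex.I)‖
        = ‖(y : ℂ) - 2 * b * Complex.I‖ * (‖F (b + y * Complex.I)‖ * |y|) := by
          simp only [hf]
          rw [h1, norm_mul, norm_mul, Complex.norm_real, Real.norm_eq_abs]; ring
      _ ≤ (2 * a + 1) * c := by gcongr
  have hbot : ‖∫ x : ℝ in (-a)..a, f (x + ((-1 : ℝ) : ℂ) * Complex.I)‖
      ≤ 2 * a * (a ^ 2 + (a + 1) ^ 2) * c := by
    refine (intervalIntegral.norm_integral_le_of_norm_le_const (C := (a ^ 2 + (a + 1) ^ 2) * c)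
      fun x hx => ?_).trans (by rw [abs_of_nonneg (by linarith)]; apply le_of_eq; ring)
    rw [Set.uIoc_of_le (by linarith)] at hx
    have h3 := hc (x + ((-1 : ℝ) : ℂ) * Complex.I) (by simp)
    simp at h3
    have h4 : ‖(x : ℂ) + ((-1 : ℝ) : ℂ) * Complex.I‖ ≤ a + 1 := by
      refine (norm_add_le _ _).trans ?_
      simp only [Complex.norm_real, norm_mul, Complex.norm_I, Real.norm_eq_abs, mul_one]
      have : |x| ≤ a := abs_le.2 ⟨by linarith [hx.1], hx.2⟩
      simpa
    simp only [hf]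
    rw [norm_mul]
    refine mul_le_mul ?_ (by simpa using h3) (norm_nonneg _) (by positivity)
    refine (norm_sub_le _ _).trans ?_
    rw [norm_pow, norm_pow, Complex.norm_real, Real.norm_eq_abs, abs_of_nonneg ha]
    gcongr
  have h1 := hside a rfl
  have h2 := hside (-a) (by ring)
  have h3 : ∫ x : ℝ in (-a)..a, f x = (∫ x : ℝ in (-a)..a, f (x + ((-1 : ℝ) : ℂ) * Complex.I))
      + Complex.I • (∫ y : ℝ in (-1)..0, f (a + y * Complex.I))
      - Complex.I • (∫ y : ℝ in (-1)..0, f ((-a : ℝ) + y * Complex.I)) := by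
    rw [← sub_eq_zero, ← neg_eq_zero, ← hrect]; ring
  change ‖∫ x : ℝ in (-a)..a, f x‖ ≤ _
  rw [h3]
  refine (norm_sub_le _ _).trans ((add_le_add_left (norm_add_le _ _) _).trans ?_)
  rw [norm_smul, norm_smul, Complex.norm_I, one_mul, one_mul]
  linarith

variable {E : Type*} [NormedAddCommGroup E] [InnerProductSpace ℂ E] [CompleteSpace E]

/-- **Spectral averaging.** For `H_t = H + t lam Q` with an orthogonal projection `Q` and `φ` in its
range, the mean over `t` of the Poisson transform of the spectral measure at `φ` is bounded
uniformly up to the real axis. -/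
theorem integral_weight_poisson_le {H Q : E →L[ℂ] E} (hH : IsSelfAdjoint H) (hQ : IsSelfAdjoint Q)
    (hQ2 : Q * Q = Q) {lam : ℝ} (hlam : 0 < lam) {φ : E} (hφ : Q φ = φ) {z : ℂ} (hz : 0 < z.im)
    {a : ℝ} (ha : 0 ≤ a) :
    (Continuous fun x : ℝ => ∫ s, z.im / ((s - z.re) ^ 2 + z.im ^ 2)
        ∂(spectralMeasure (H + ((lam * x : ℝ) : ℂ) • Q) φ)) ∧
    ∫ x in (-a)..a, (a ^ 2 - x ^ 2) * ∫ s, z.im / ((s - z.re) ^ 2 + z.im ^ 2)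
        ∂(spectralMeasure (H + ((lam * x : ℝ) : ℂ) • Q) φ)
      ≤ (2 * (2 * a + 1) + 2 * a * (a ^ 2 + (a + 1) ^ 2)) * (‖φ‖ ^ 2 / lam) := by
  set A : ℂ → E →L[ℂ] E := fun t => H + (lam * t) • Q - z • (1 : E →L[ℂ] E) with hA
  have hQs : ∀ u v, ⟪Q u, v⟫_ℂ = ⟪u, Q v⟫_ℂ :=
    ContinuousLinearMap.isSelfAdjoint_iff_isSymmetric.1 hQ
  have hQu : ∀ u, ⟪Q u, u⟫_ℂ = (‖Q u‖ ^ 2 : ℝ) := fun u => by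
    have : Q u = Q (Q u) := (congrArg (fun S : E →L[ℂ] E => S u) hQ2).symm
    rw [this, hQs, ← this, inner_self_eq_norm_sq_to_K]; norm_cast
  -- For `t.im ≤ 0` both terms are nonnegative. The second gives invertibility of `A t`; the first
  -- gives the bound `1/|t.im|`.
  have him : ∀ t u, (⟪A t u, u⟫_ℂ).im = lam * (-t.im) * ‖Q u‖ ^ 2 + z.im * ‖u‖ ^ 2 := fun t u => by
    have h1 : A t u = (H - z • (1 : E →L[ℂ] E)) u + (lam * t) • Q u := by
      simp only [hA, sub_apply, add_apply, smul_apply]; abel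
    rw [h1, inner_add_left, Complex.add_im, im_inner_sub_smul hH, inner_smul_left, hQu]
    simp [-Complex.ofReal_pow]; ring
  have hunit : ∀ t : ℂ, t.im ≤ 0 → IsUnit (A t) := fun t ht => by
    refine ContinuousLinearMap.isUnit_of_forall_le_norm_inner_map _ (c := ⟨z.im, hz.le⟩) hz
      fun x => ?_
    refine le_trans ?_ ((le_abs_self _).trans (Complex.abs_im_le_norm _))
    rw [him]
    have : 0 ≤ lam * (-t.im) * ‖Q x‖ ^ 2 := by
      have := neg_nonneg.2 ht
      positivity
    change ‖x‖ ^ 2 * z.im ≤ _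
    linarith
  set U : ℂ → E := fun t => Ring.inverse (A t) φ with hU
  have hAU : ∀ t : ℂ, t.im ≤ 0 → A t (U t) = φ := fun t ht => by
    have := Ring.mul_inverse_cancel _ (hunit t ht)
    exact congrArg (fun S : E →L[ℂ] E => S φ) this
  have hdiff : ∀ t : ℂ, t.im ≤ 0 → DifferentiableAt ℂ (fun t => ⟪φ, U t⟫_ℂ) t := fun t ht => by
    obtain ⟨V, hV⟩ := hunit t ht
    have h1 : DifferentiableAt ℂ Ring.inverse (A t) := by
      rw [← hV]; exact differentiableAt_inverse V.isUnit
    have h2 : DifferentiableAt ℂ A t := by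
      simp only [hA]; fun_prop
    have h3 : DifferentiableAt ℂ (fun t => Ring.inverse (A t)) t := h1.comp t h2
    have h4 : DifferentiableAt ℂ U t := h3.clm_apply (differentiableAt_const φ)
    exact ((innerSL ℂ φ).differentiableAt).comp t h4
  -- As `φ = Q φ`, only `Q (U t)` matters, and `lam |t.im| ‖Q (U t)‖² ≤ ‖φ‖ ‖Q (U t)‖`. The estimate
  -- does not involve `z`.
  have hbd : ∀ t : ℂ, t.im ≤ 0 → ‖⟪φ, U t⟫_ℂ‖ * |t.im| ≤ ‖φ‖ ^ 2 / lam := fun t ht => by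
    have h1 : ⟪φ, U t⟫_ℂ = ⟪φ, Q (U t)⟫_ℂ := by rw [← hQs, hφ]
    have h2 := him t (U t)
    rw [hAU t ht, h1] at h2
    have h3 : ‖⟪φ, Q (U t)⟫_ℂ‖ ≤ ‖φ‖ * ‖Q (U t)‖ := norm_inner_le_norm _ _
    have h4 : lam * |t.im| * ‖Q (U t)‖ ^ 2 ≤ ‖φ‖ * ‖Q (U t)‖ := by
      rw [abs_of_nonpos ht]
      have := (le_abs_self _).trans ((Complex.abs_im_le_norm ⟪φ, Q (U t)⟫_ℂ).trans h3)
      have : 0 ≤ z.im * ‖U t‖ ^ 2 := by positivity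
      linarith
    have h5 : lam * |t.im| * ‖Q (U t)‖ ≤ ‖φ‖ := by
      rcases (norm_nonneg (Q (U t))).eq_or_lt with h | h
      · rw [← h]; simp
      · refine le_of_mul_le_mul_right ?_ h
        linarith [h4]
    rw [h1, le_div_iff₀ hlam]
    calc ‖⟪φ, Q (U t)⟫_ℂ‖ * |t.im| * lam ≤ (‖φ‖ * ‖Q (U t)‖) * |t.im| * lam := by gcongr
      _ = ‖φ‖ * (lam * |t.im| * ‖Q (U t)‖) := by ring
      _ ≤ ‖φ‖ * ‖φ‖ := by gcongr
      _ = ‖φ‖ ^ 2 := by ring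
  have hmain := norm_integral_weight_mul_le hdiff hbd ha
  have hcont : Continuous fun x : ℝ => ⟪φ, U x⟫_ℂ := continuous_iff_continuousAt.2 fun x =>
    (hdiff x (by simp)).continuousAt.comp Complex.continuous_ofReal.continuousAt
  have hpoisson : ∀ x : ℝ, ∫ s, z.im / ((s - z.re) ^ 2 + z.im ^ 2)
        ∂(spectralMeasure (H + ((lam * x : ℝ) : ℂ) • Q) φ) = (⟪φ, U x⟫_ℂ).im := fun x => by
    have hsa : IsSelfAdjoint (H + ((lam * x : ℝ) : ℂ) • Q) :=
      hH.add (IsSelfAdjoint.smul (by simp [isSelfAdjoint_iff]) hQ)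
    refine integral_poisson_spectralMeasure hsa φ (U x) z hz ?_
    have := hAU x (by simp)
    simpa [hA] using this
  have hweight : ∀ x : ℝ, (a ^ 2 - x ^ 2) * (⟪φ, U x⟫_ℂ).im
      = RCLike.im (((a : ℂ) ^ 2 - (x : ℂ) ^ 2) * ⟪φ, U x⟫_ℂ) := fun x => by
    change _ = Complex.im _
    rw [← Complex.ofReal_pow, ← Complex.ofReal_pow, ← Complex.ofReal_sub, Complex.im_ofReal_mul]
  simp_rw [hpoisson]
  refine ⟨Complex.continuous_im.comp hcont, ?_⟩
  simp_rw [hweight]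
  rw [intervalIntegral.intervalIntegral_im
    (Continuous.intervalIntegrable (by fun_prop) _ _)]
  exact (le_abs_self _).trans ((Complex.abs_im_le_norm _).trans hmain)

/-- Spectral averaging with respect to a compactly supported law with a bounded density. -/
theorem lintegral_poisson_le {H Q : E →L[ℂ] E} (hH : IsSelfAdjoint H) (hQ : IsSelfAdjoint Q)
    (hQ2 : Q * Q = Q) {lam : ℝ} (hlam : 0 < lam) {φ : E} (hφ : Q φ = φ) {z : ℂ} (hz : 0 < z.im)
    {R : ℝ} (hR : 0 ≤ R) {μ : Measure ℝ} {C : ℝ≥0∞} (hμ : μ ≤ C • volume)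
    (hμR : μ (Set.Icc (-R) R)ᶜ = 0) :
    ∫⁻ x, ENNReal.ofReal (∫ s, z.im / ((s - z.re) ^ 2 + z.im ^ 2)
        ∂(spectralMeasure (H + ((lam * x : ℝ) : ℂ) • Q) φ)) ∂μ
      ≤ C * ENNReal.ofReal ((2 * (2 * (R + 1) + 1) + 2 * (R + 1) * ((R + 1) ^ 2 + (R + 1 + 1) ^ 2))
        * (‖φ‖ ^ 2 / lam)) := by
  -- With `a = R + 1` the weight is at least `2 R + 1 ≥ 1` on `[-R, R]`, so it can be inserted for
  -- free.
  obtain ⟨hc, hle⟩ := integral_weight_poisson_le hH hQ hQ2 hlam hφ hz (a := R + 1) (by linarith)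
  set g : ℝ → ℝ := fun x => ∫ s, z.im / ((s - z.re) ^ 2 + z.im ^ 2)
        ∂(spectralMeasure (H + ((lam * x : ℝ) : ℂ) • Q) φ) with hg
  have hg0 : ∀ x, 0 ≤ g x := fun x => integral_nonneg fun s => by
    simp only [Pi.zero_apply]; positivity
  have hrestrict : μ.restrict (Set.Icc (-R) R) = μ :=
    Measure.restrict_eq_self_of_ae_mem (mem_ae_iff.2 hμR)
  calc ∫⁻ x, ENNReal.ofReal (g x) ∂μ
      = ∫⁻ x in Set.Icc (-R) R, ENNReal.ofReal (g x) ∂μ := by rw [hrestrict]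
    _ ≤ ∫⁻ x in Set.Icc (-R) R, ENNReal.ofReal (g x) ∂(C • volume) :=
        lintegral_mono' (Measure.restrict_mono le_rfl hμ) le_rfl
    _ = C * ∫⁻ x in Set.Icc (-R) R, ENNReal.ofReal (g x) := by
        rw [Measure.restrict_smul, lintegral_smul_measure, smul_eq_mul]
    _ ≤ C * ∫⁻ x in Set.Icc (-R) R, ENNReal.ofReal (((R + 1) ^ 2 - x ^ 2) * g x) := by
        gcongr C * ?_
        refine setLIntegral_mono' measurableSet_Icc fun x hx => ENNReal.ofReal_le_ofReal ?_
        have h1 : x ^ 2 ≤ R ^ 2 := sq_le_sq' hx.1 hx.2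
        nlinarith [hg0 x]
    _ ≤ C * ∫⁻ x in Set.Ioc (-(R + 1)) (R + 1), ENNReal.ofReal (((R + 1) ^ 2 - x ^ 2) * g x) := by
        gcongr C * ?_
        exact lintegral_mono_set fun x hx => ⟨by linarith [hx.1], by linarith [hx.2]⟩
    _ ≤ _ := by
        gcongr C * ?_
        rw [← ofReal_integral_eq_lintegral_ofReal]
        · refine ENNReal.ofReal_le_ofReal ?_
          rw [← intervalIntegral.integral_of_le (by linarith)]
          exact hle
        · exact (Continuous.integrableOn_Icc (by fun_prop)).mono_set Set.Ioc_subset_Icc_self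
        · refine (ae_restrict_mem measurableSet_Ioc).mono fun x hx => ?_
          have h1 : x ^ 2 ≤ (R + 1) ^ 2 := sq_le_sq' hx.1.le hx.2
          have := hg0 x
          simp only [Pi.zero_apply]
          exact mul_nonneg (by linarith) this

end SpectralAveraging

/-! ### From moments to masses of intervals; a criterion for absolute continuity. -/

section Moments

/-- A sequence of polynomials converging uniformly on a compact interval to a continuous function. -/
theorem exists_polynomial_seq {f : ℝ → ℝ} (hf : Continuous f) (R : ℝ) :
    ∃ q : ℕ → Polynomial ℝ, ∀ n, ∀ t ∈ Set.Icc (-R) R, |(q n).eval t - f t| ≤ 1 / (n + 1 : ℝ) := by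
  have h : ∀ n : ℕ, ∃ q : Polynomial ℝ, ∀ t ∈ Set.Icc (-R) R, |q.eval t - f t| < 1 / (n + 1 : ℝ) :=
    fun n => exists_polynomial_near_of_continuousOn _ _ f hf.continuousOn _ (by positivity)
  choose q hq using h
  exact ⟨q, fun n t ht => (hq n t ht).le⟩

theorem integrable_of_compl_Icc {μ : Measure ℝ} [IsFiniteMeasure μ] {R : ℝ}
    (hμ : μ (Set.Icc (-R) R)ᶜ = 0) {f : ℝ → ℝ} (hf : Continuous f) : Integrable f μ := by
  have h : μ.restrict (Set.Icc (-R) R) = μ :=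
    Measure.restrict_eq_self_of_ae_mem (mem_ae_iff.2 hμ)
  rw [← h]
  exact hf.integrableOn_Icc

theorem integral_polynomial_eval {μ : Measure ℝ} [IsFiniteMeasure μ] {R : ℝ}
    (hμ : μ (Set.Icc (-R) R)ᶜ = 0) (q : Polynomial ℝ) :
    ∫ t, q.eval t ∂μ = ∑ k ∈ Finset.range (q.natDegree + 1), q.coeff k * ∫ t, t ^ k ∂μ := by
  simp_rw [Polynomial.eval_eq_sum_range]
  rw [integral_finsetSum _ fun k _ => integrable_of_compl_Icc hμ (by fun_prop)]
  simp_rw [integral_const_mul]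

theorem abs_integral_sub_integral_le {μ : Measure ℝ} [IsFiniteMeasure μ] (hμ1 : μ.real Set.univ ≤ 1)
    {R : ℝ} (hμ : μ (Set.Icc (-R) R)ᶜ = 0) {f g : ℝ → ℝ} (hf : Continuous f) (hg : Continuous g)
    {ε : ℝ} (hε : 0 ≤ ε) (h : ∀ t ∈ Set.Icc (-R) R, |g t - f t| ≤ ε) :
    |∫ t, g t ∂μ - ∫ t, f t ∂μ| ≤ ε := by
  rw [← integral_sub (integrable_of_compl_Icc hμ hg) (integrable_of_compl_Icc hμ hf)]
  have h1 : ‖∫ t, (g t - f t) ∂μ‖ ≤ ε * μ.real Set.univ := norm_integral_le_of_norm_le_const (by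
    filter_upwards [mem_ae_iff.2 hμ] with t ht using h t ht)
  exact h1.trans (by nlinarith)

/-- Weierstrass approximation on the common interval has an error uniform in `i`, so an `ε/3`
argument reduces to polynomials. -/
theorem tendsto_integral_of_moments {ι : Type*} {F : Filter ι} {μ : ι → Measure ℝ}
    [∀ i, IsProbabilityMeasure (μ i)] {ν : Measure ℝ} [IsProbabilityMeasure ν] {R : ℝ}
    (hμ : ∀ i, μ i (Set.Icc (-R) R)ᶜ = 0) (hν : ν (Set.Icc (-R) R)ᶜ = 0)
    (hm : ∀ p : ℕ, Tendsto (fun i => ∫ t, t ^ p ∂(μ i)) F (𝓝 (∫ t, t ^ p ∂ν)))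
    {f : ℝ → ℝ} (hf : Continuous f) :
    Tendsto (fun i => ∫ t, f t ∂(μ i)) F (𝓝 (∫ t, f t ∂ν)) := by
  obtain ⟨q, hq⟩ := exists_polynomial_seq hf R
  refine Metric.tendsto_nhds.2 fun ε hε => ?_
  obtain ⟨n, hn⟩ := exists_nat_one_div_lt (show 0 < ε / 3 by positivity)
  have h1 : Tendsto (fun i => ∫ t, (q n).eval t ∂(μ i)) F (𝓝 (∫ t, (q n).eval t ∂ν)) := by
    simp_rw [integral_polynomial_eval hν]
    simp_rw [fun i => integral_polynomial_eval (hμ i)]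
    exact tendsto_finsetSum _ fun k _ => (hm k).const_mul _
  filter_upwards [Metric.tendsto_nhds.1 h1 (ε / 3) (by positivity)] with i hi
  have h2 := abs_integral_sub_integral_le (by simp) (hμ i) hf (q n).continuous (by positivity) (hq n)
  have h3 := abs_integral_sub_integral_le (by simp) hν hf (q n).continuous (by positivity) (hq n)
  rw [Real.dist_eq] at hi ⊢
  rw [abs_le] at h2 h3
  rw [abs_lt] at hi ⊢
  constructor <;> linarith

/-- Convergence of moments of probability measures on a fixed compact interval to those of an
absolutely continuous measure implies convergence of the masses of all intervals. -/
theorem tendsto_measureReal_of_moments {ι : Type*} {F : Filter ι} {μ : ι → Measure ℝ}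
    [∀ i, IsProbabilityMeasure (μ i)] {ν : Measure ℝ} [IsProbabilityMeasure ν] {R : ℝ}
    (hμ : ∀ i, μ i (Set.Icc (-R) R)ᶜ = 0) (hν : ν (Set.Icc (-R) R)ᶜ = 0)
    (hm : ∀ p : ℕ, Tendsto (fun i => ∫ t, t ^ p ∂(μ i)) F (𝓝 (∫ t, t ^ p ∂ν)))
    (hac : ν ≪ volume) {I : Set ℝ} (hI : I.OrdConnected) :
    Tendsto (fun i => (μ i).real I) F (𝓝 (ν.real I)) := by
  let μ' : ι → ProbabilityMeasure ℝ := fun i => ⟨μ i, inferInstance⟩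
  let ν' : ProbabilityMeasure ℝ := ⟨ν, inferInstance⟩
  have h : Tendsto μ' F (𝓝 ν') :=
    ProbabilityMeasure.tendsto_iff_forall_integral_tendsto.2 fun f =>
      tendsto_integral_of_moments hμ hν hm f.continuous
  -- The boundary of a convex set is Lebesgue null; this is the one use of absolute continuity in
  -- the convergence.
  have hfr : ν (frontier I) = 0 := hac (hI.convex.addHaar_frontier volume)
  exact (ENNReal.tendsto_toReal (measure_ne_top _ _)).comp
    (ProbabilityMeasure.tendsto_measure_of_null_frontier_of_tendsto' h hfr)

/-- A measure with `μ [a, b] ≤ C (b - a)` is absolutely continuous. -/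
theorem absolutelyContinuous_of_Icc {μ : Measure ℝ} {C : ℝ≥0∞} (hC : C ≠ ∞)
    (h : ∀ a b : ℝ, a < b → μ (Set.Icc a b) ≤ C * ENNReal.ofReal (b - a)) : μ ≪ volume := by
  have hD : C + 1 ≠ ∞ := by finiteness
  have hD0 : C + 1 ≠ 0 := by simp
  -- Lebesgue outer measure is the largest outer measure dominated by interval length. Taking `C +
  -- 1` in place of `C` keeps the factor invertible.
  have h1 : (C + 1)⁻¹ • μ.toOuterMeasure ≤ StieltjesFunction.id.outer := by
    refine OuterMeasure.le_ofFunction.2 fun s => ?_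
    rw [StieltjesFunction.length_eq]
    refine le_iInf fun a => le_iInf fun b => le_iInf fun hs => ?_
    have hs' : s ⊆ Set.Ioc a b := fun x hx => hs ⟨hx, not_isBot x⟩
    change (C + 1)⁻¹ * μ s ≤ ENNReal.ofReal (b - a)
    rw [mul_comm, ← div_eq_mul_inv]
    refine ENNReal.div_le_of_le_mul ?_
    rcases lt_or_ge a b with hab | hab
    · calc μ s ≤ μ (Set.Icc a b) := measure_mono (hs'.trans Set.Ioc_subset_Icc_self)
        _ ≤ C * ENNReal.ofReal (b - a) := h a b hab
        _ ≤ ENNReal.ofReal (b - a) * (C + 1) := by rw [mul_comm]; gcongr; simp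
    · rw [Set.Ioc_eq_empty (not_lt.2 hab), Set.subset_empty_iff] at hs'
      simp [hs']
  refine Measure.AbsolutelyContinuous.mk fun s hs hs0 => ?_
  have h2 : (C + 1)⁻¹ * μ s ≤ volume s := by
    rw [Real.volume_val, StieltjesFunction.measure_def]
    exact h1 s
  rw [hs0] at h2
  simpa [hD] using h2

end Moments

/-! ### Moments as local functions of the potential. -/

section Hopping

variable {V W : Type*}

/-- The expression `∑_{y ∈ N x} f(y) + v(x) f(x)`. -/
def hop (N : V → Finset V) (v : V → ℝ) (f : V → ℝ) (x : V) : ℝ := ∑ y ∈ N x, f y + v x * f x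

theorem hop_iterate_succ (N : V → Finset V) (v : V → ℝ) (f : V → ℝ) (p : ℕ) (x : V) :
    (hop N v)^[p + 1] f x = ∑ y ∈ N x, (hop N v)^[p] f y + v x * (hop N v)^[p] f x := by
  rw [Function.iterate_succ_apply']; rfl

open Classical in
/-- The diagonal matrix element at `x` of the `p`-th power of `hop N v`. -/
def hopMoment (N : V → Finset V) (v : V → ℝ) (p : ℕ) (x : V) : ℝ :=
  (hop N v)^[p] (Pi.single x 1) x

open Classical in
/-- The vertices which can be reached from `x` in at most `p` steps. -/
def reach (N : V → Finset V) : ℕ → V → Finset V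
  | 0, x => {x}
  | p + 1, x => reach N p x ∪ (N x).biUnion (reach N p)

theorem self_mem_reach (N : V → Finset V) (p : ℕ) (x : V) : x ∈ reach N p x := by
  induction p with
  | zero => simp [reach]
  | succ p ih => simp [reach, ih]

theorem reach_subset_succ (N : V → Finset V) (p : ℕ) (x : V) : reach N p x ⊆ reach N (p + 1) x := by
  classical
  exact fun y hy => by simp [reach, hy]

theorem reach_subset_of_le (N : V → Finset V) {p q : ℕ} (h : p ≤ q) (x : V) :
    reach N p x ⊆ reach N q x := by
  induction q, h using Nat.le_induction with
  | base => exact Finset.Subset.refl _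
  | succ q _ ih => exact ih.trans (reach_subset_succ N q x)

theorem reach_subset_of_mem (N : V → Finset V) (p : ℕ) {x y : V} (h : y ∈ N x) :
    reach N p y ⊆ reach N (p + 1) x := by
  classical
  exact fun z hz => by
    simp only [reach, Finset.mem_union, Finset.mem_biUnion]
    exact Or.inr ⟨y, h, hz⟩

theorem mem_reach_trans {N : V → Finset V} {p q : ℕ} {x y z : V} (hy : y ∈ reach N p x)
    (hz : z ∈ reach N q y) : z ∈ reach N (p + q) x := by
  induction p generalizing x with
  | zero =>
    simp only [reach, Finset.mem_singleton] at hy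
    subst hy; simpa using hz
  | succ p ih =>
    simp only [reach, Finset.mem_union, Finset.mem_biUnion] at hy
    rw [Nat.add_right_comm]
    rcases hy with hy | ⟨u, hu, hy⟩
    · exact reach_subset_succ N _ x (ih hy)
    · exact reach_subset_of_mem N _ hu (ih hy)

theorem mem_reach_one {N : V → Finset V} {x y : V} (h : y ∈ N x) : y ∈ reach N 1 x :=
  reach_subset_of_mem N 0 h (self_mem_reach N 0 y)

theorem mem_reach_symm {N : V → Finset V} (hN : ∀ x y, y ∈ N x → x ∈ N y) {p : ℕ} {x y : V}
    (hy : y ∈ reach N p x) : x ∈ reach N p y := by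
  induction p generalizing x with
  | zero =>
    simp only [reach, Finset.mem_singleton] at hy ⊢
    exact hy.symm
  | succ p ih =>
    simp only [reach, Finset.mem_union, Finset.mem_biUnion] at hy
    rcases hy with hy | ⟨u, hu, hy⟩
    · exact reach_subset_succ N _ y (ih hy)
    · exact mem_reach_trans (ih hy) (mem_reach_one (hN x u hu))

theorem reach_mono {N N' : V → Finset V} (h : ∀ x, N x ⊆ N' x) (p : ℕ) (x : V) :
    reach N p x ⊆ reach N' p x := by
  induction p generalizing x with
  | zero => simp [reach]
  | succ p ih =>
    intro y hy
    simp only [reach, Finset.mem_union, Finset.mem_biUnion] at hy ⊢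
    rcases hy with hy | ⟨u, hu, hy⟩
    · exact Or.inl (ih x hy)
    · exact Or.inr ⟨u, h x hu, ih u hy⟩

theorem card_reach_le {N : V → Finset V} {d : ℕ} (hd : ∀ x, (N x).card ≤ d) (p : ℕ) (x : V) :
    (reach N p x).card ≤ (d + 1) ^ p := by
  classical
  induction p generalizing x with
  | zero => simp [reach]
  | succ p ih =>
    calc (reach N (p + 1) x).card ≤ (reach N p x).card + ((N x).biUnion (reach N p)).card :=
          Finset.card_union_le _ _
      _ ≤ (d + 1) ^ p + (N x).card * (d + 1) ^ p :=
          add_le_add (ih x) (Finset.card_biUnion_le_card_mul _ _ _ fun y _ => ih y)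
      _ ≤ (d + 1) ^ p + d * (d + 1) ^ p := by gcongr; exact hd x
      _ = (d + 1) ^ (p + 1) := by ring

/-- Iterates of `hop` depend on the potential only through its values at reachable vertices. -/
theorem hop_iterate_congr {N : V → Finset V} {v v' : V → ℝ} (f : V → ℝ) (p : ℕ) (x : V)
    (h : ∀ z ∈ reach N p x, v z = v' z) : (hop N v)^[p] f x = (hop N v')^[p] f x := by
  induction p generalizing x with
  | zero => rfl
  | succ p ih =>
    rw [hop_iterate_succ, hop_iterate_succ, h x (self_mem_reach N _ x),
      ih x fun z hz => h z (reach_subset_succ N p x hz)]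
    congr 1
    exact Finset.sum_congr rfl fun y hy => ih y fun z hz => h z (reach_subset_of_mem N p hy hz)

theorem abs_hop_iterate_le {N : V → Finset V} {v : V → ℝ} {d : ℕ} {C : ℝ}
    (hd : ∀ x, (N x).card ≤ d) (hC : ∀ x, |v x| ≤ C) {f : V → ℝ} (hf : ∀ x, |f x| ≤ 1) (p : ℕ)
    (x : V) : |(hop N v)^[p] f x| ≤ (d + C) ^ p := by
  induction p generalizing x with
  | zero => simpa using hf x
  | succ p ih =>
    have hC0 : 0 ≤ C := (abs_nonneg _).trans (hC x)
    rw [hop_iterate_succ]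
    calc |∑ y ∈ N x, (hop N v)^[p] f y + v x * (hop N v)^[p] f x|
        ≤ ∑ y ∈ N x, |(hop N v)^[p] f y| + |v x| * |(hop N v)^[p] f x| := by
          refine (abs_add_le _ _).trans (add_le_add (Finset.abs_sum_le_sum_abs _ _) ?_)
          rw [abs_mul]
      _ ≤ ∑ y ∈ N x, (d + C) ^ p + C * (d + C) ^ p := by
          gcongr with y hy
          · exact ih y
          · exact hC x
          · exact ih x
      _ ≤ d * (d + C) ^ p + C * (d + C) ^ p := by
          rw [Finset.sum_const, nsmul_eq_mul]
          gcongr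
          exact hd x
      _ = (d + C) ^ (p + 1) := by ring

theorem abs_hopMoment_le {N : V → Finset V} {v : V → ℝ} {d : ℕ} {C : ℝ}
    (hd : ∀ x, (N x).card ≤ d) (hC : ∀ x, |v x| ≤ C) (p : ℕ) (x : V) :
    |hopMoment N v p x| ≤ (d + C) ^ p := by
  classical
  refine abs_hop_iterate_le hd hC (fun y => ?_) p x
  by_cases h : y = x
  · subst h; simp
  · simp [h]

theorem measurable_hop_iterate {S : Type*} [MeasurableSpace S] {N : V → Finset V} {v : S → V → ℝ}
    (hv : ∀ x, Measurable fun s => v s x) (f : V → ℝ) (p : ℕ) (x : V) :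
    Measurable fun s => (hop N (v s))^[p] f x := by
  induction p generalizing x with
  | zero => exact measurable_const
  | succ p ih =>
    simp_rw [hop_iterate_succ]
    have := ih x
    have := hv x
    have := Finset.measurable_fun_sum (N x) fun y _ => ih y
    fun_prop

theorem measurable_hopMoment {S : Type*} [MeasurableSpace S] {N : V → Finset V} {v : S → V → ℝ}
    (hv : ∀ x, Measurable fun s => v s x) (p : ℕ) (x : V) :
    Measurable fun s => hopMoment N (v s) p x :=
  measurable_hop_iterate hv _ p x

/-- Transport of iterates of `hop` along a map which is a local isomorphism at the vertices `x` with
`m < ℓ x`, where `ℓ` decreases by at most one in each step. -/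
theorem hop_iterate_transport {N : V → Finset V} {N' : W → Finset W} {v : V → ℝ} {v' : W → ℝ}
    {φ : V → W} (U : V → Prop) (ℓ : V → ℕ) (m : ℕ)
    (hU : ∀ x, U x → ∀ y ∈ N x, U y ∧ ℓ x ≤ ℓ y + 1)
    (hinj : ∀ x, U x → m + 1 < ℓ x → Set.InjOn φ (N x))
    (hN : ∀ x, U x → m + 1 < ℓ x → ∀ z, z ∈ N' (φ x) ↔ ∃ y ∈ N x, φ y = z)
    (hv : ∀ x, U x → m < ℓ x → v x = v' (φ x)) {g : V → ℝ} {f : W → ℝ}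
    (hgf : ∀ y, U y → m < ℓ y → g y = f (φ y)) (p : ℕ) (x : V) (hx : U x) (hxp : m + p < ℓ x) :
    (hop N v)^[p] g x = (hop N' v')^[p] f (φ x) := by
  classical
  induction p generalizing x with
  | zero => exact hgf x hx (by simpa using hxp)
  | succ p ih =>
    rw [hop_iterate_succ, hop_iterate_succ, hv x hx (by omega), ih x hx (by omega)]
    congr 1
    -- Local bijectivity at `x` transports the neighbour sum; each step uses one unit of the margin
    -- `m + p < ℓ x`.
    have h1 : N' (φ x) = (N x).image φ := by
      ext z
      rw [hN x hx (by omega)]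
      simp
    rw [h1, Finset.sum_image (hinj x hx (by omega))]
    refine Finset.sum_congr rfl fun y hy => ?_
    obtain ⟨h2, h3⟩ := hU x hx y hy
    exact ih y h2 (by omega)

open Classical in
theorem delta_apply (x y : V) : delta x y = if y = x then 1 else 0 := by
  rw [delta, lp.single_apply, Pi.single_apply]

theorem inner_delta_left (x : V) (ψ : Ell2 V) : ⟪delta x, ψ⟫_ℂ = ψ x := by
  classical
  rw [delta, lp.inner_single_left]
  simp

theorem norm_delta (x : V) : ‖delta x‖ = 1 := by
  classical
  rw [delta, lp.norm_single (by norm_num)]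
  simp

/-- The powers of an operator acting by `hop` on the image of `ι`. -/
theorem pow_delta_apply {N : V → Finset V} {v : V → ℝ} {ι : W → V} (hι : Function.Injective ι)
    {S : Ell2 W →L[ℂ] Ell2 W}
    (hS : ∀ (ψ : Ell2 W) (f : V → ℝ), (∀ u, ψ u = (f (ι u) : ℂ)) →
      ∀ u, S ψ u = (hop N v f (ι u) : ℂ)) [DecidableEq V] (w : W) (p : ℕ) (u : W) :
    (S ^ p) (delta w) u = ((hop N v)^[p] (Pi.single (ι w) 1) (ι u) : ℂ) := by
  induction p generalizing u with
  | zero =>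
    classical
    simp only [pow_zero, one_apply_eq_self, Function.iterate_zero, id_eq]
    rw [delta_apply, Pi.single_apply]
    simp only [hι.eq_iff]
    split_ifs <;> simp
  | succ p ih =>
    rw [pow_succ', mul_apply_eq_comp, Function.iterate_succ_apply']
    exact hS _ _ ih u

theorem inner_delta_pow {N : V → Finset V} {v : V → ℝ} {ι : W → V} (hι : Function.Injective ι)
    {S : Ell2 W →L[ℂ] Ell2 W}
    (hS : ∀ (ψ : Ell2 W) (f : V → ℝ), (∀ u, ψ u = (f (ι u) : ℂ)) →
      ∀ u, S ψ u = (hop N v f (ι u) : ℂ)) (w : W) (p : ℕ) :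
    ⟪delta w, (S ^ p) (delta w)⟫_ℂ = (hopMoment N v p (ι w) : ℂ) := by
  classical
  rw [inner_delta_left, pow_delta_apply hι hS, hopMoment]

theorem ext_delta {S T : Ell2 V →L[ℂ] Ell2 V} (h : ∀ x, S (delta x) = T (delta x)) : S = T := by
  classical
  refine lp.ext_continuousLinearMap (by norm_num) fun x => ?_
  refine ContinuousLinearMap.ext_ring ?_
  exact h x

theorem isSelfAdjoint_of_delta {S : Ell2 V →L[ℂ] Ell2 V}
    (h : ∀ x y, S (delta x) y = starRingEnd ℂ (S (delta y) x)) : IsSelfAdjoint S := by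
  rw [ContinuousLinearMap.isSelfAdjoint_iff']
  refine ext_delta fun x => lp.ext (funext fun y => ?_)
  rw [← inner_delta_left, ContinuousLinearMap.adjoint_inner_right, h, ← inner_conj_symm,
    inner_delta_left]

end Hopping

/-! ### Operators whose random potential is constant on the blocks of a partition. -/

section SiteModel

variable {V : Type*}

/-- Finiteness data for a graph whose vertex set is partitioned into the sets `block y`, `y ∈ J`:
finite neighbourhoods of bounded size, and the map sending a vertex to the index of its block. -/
structure SiteModel (G : SimpleGraph V) (J : Set V) (block : V → Set V) where
  nbhd : V → Finset V
  mem_nbhd : ∀ x y, y ∈ nbhd x ↔ G.Adj x y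
  deg : ℕ
  card_nbhd_le : ∀ x, (nbhd x).card ≤ deg
  site : V → J
  mem_block : ∀ x (y : J), x ∈ block y ↔ y = site x

namespace SiteModel

variable {G : SimpleGraph V} {J : Set V} {block : V → Set V} (M : SiteModel G J block)

/-- The potential `lam * ∑_y w_y P_y` as a function of the vertex. -/
def pot (lam : ℝ) (w : J → ℝ) (x : V) : ℝ := lam * w (M.site x)

include M in
-- The blocks partition the vertices, so exactly one term of the potential survives at `x`.
theorem andersonAction_eq (lam : ℝ) (w : J → ℝ) (ψ : V → ℂ) (x : V) :
    andersonAction G J block lam w ψ x = ∑ y ∈ M.nbhd x, ψ y + M.pot lam w x * ψ x := by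
  have h1 : ∑' y : G.neighborSet x, ψ y = ∑ y ∈ M.nbhd x, ψ y := by
    rw [← Finset.tsum_subtype]
    refine (Equiv.setCongr (Set.ext fun y => ?_)).tsum_eq (fun y : (M.nbhd x : Set V) => ψ y)
    simp [M.mem_nbhd]
  have h2 : ∑' y : J, (w y : ℂ) * (block y).indicator ψ x = w (M.site x) * ψ x := by
    rw [tsum_eq_single (M.site x) fun y hy => ?_]
    · rw [Set.indicator_of_mem ((M.mem_block x _).2 rfl)]
    · rw [Set.indicator_of_notMem fun h => hy ((M.mem_block x y).1 h), mul_zero]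
  rw [andersonAction, h1, h2, pot]
  push_cast
  ring

theorem abs_pot_le {lam R : ℝ} {w : J → ℝ} (hw : ∀ y, |w y| ≤ R) (x : V) :
    |M.pot lam w x| ≤ |lam| * R := by
  rw [pot, abs_mul]
  gcongr
  exact hw _

theorem mem_nbhd_symm (x y : V) (h : y ∈ M.nbhd x) : x ∈ M.nbhd y :=
  (M.mem_nbhd y x).2 ((M.mem_nbhd x y).1 h).symm

include M in
theorem andersonOperator_apply_eq {lam R : ℝ} {w : J → ℝ} (hw : ∀ y, |w y| ≤ R) (ψ : Ell2 V)
    (x : V) : andersonOperator G J block lam w ψ x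
      = ∑ y ∈ M.nbhd x, ψ y + M.pot lam w x * ψ x := by
  have hset : ∀ x, G.neighborSet x = M.nbhd x := fun x => by
    ext y; simp [M.mem_nbhd]
  rw [andersonOperator_apply, M.andersonAction_eq]
  refine exists_andersonOperator G J block lam w M.deg
    (fun x => by rw [hset]; exact Finset.finite_toSet _)
    (fun x => by rw [hset, Set.ncard_coe_finset]; exact M.card_nbhd_le x) R fun x => ?_
  rw [tsum_eq_single (M.site x) fun y hy => ?_]
  · rw [Set.indicator_of_mem ((M.mem_block x _).2 rfl)]
    simpa using hw _
  · rw [Set.indicator_of_notMem fun h => hy ((M.mem_block x y).1 h), mul_zero]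

/-- Double counting: each `y` occurs at most once for each of its neighbours. -/
theorem sum_sum_nbhd_le (s : Finset V) (ψ : Ell2 V) :
    ∑ x ∈ s, ∑ y ∈ M.nbhd x, ‖ψ y‖ ^ 2 ≤ M.deg * ‖ψ‖ ^ 2 := by
  classical
  calc ∑ x ∈ s, ∑ y ∈ M.nbhd x, ‖ψ y‖ ^ 2
      = ∑ y ∈ s.biUnion M.nbhd, ∑ x ∈ s.filter (fun x => y ∈ M.nbhd x), ‖ψ y‖ ^ 2 := by
        refine Finset.sum_comm' fun x y => ?_
        simp only [Finset.mem_filter, Finset.mem_biUnion]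
        exact ⟨fun h => ⟨h, x, h⟩, fun h => h.1⟩
    _ ≤ ∑ y ∈ s.biUnion M.nbhd, M.deg * ‖ψ y‖ ^ 2 := by
        refine Finset.sum_le_sum fun y _ => ?_
        rw [Finset.sum_const, nsmul_eq_mul]
        gcongr
        refine (Finset.card_le_card fun x hx => ?_).trans (M.card_nbhd_le y)
        exact M.mem_nbhd_symm x y (Finset.mem_filter.1 hx).2
    _ ≤ M.deg * ‖ψ‖ ^ 2 := by
        rw [← Finset.mul_sum, ell2_norm_sq]
        gcongr
        exact (ell2_summable ψ).sum_le_tsum _ fun _ _ => by positivity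

/-- A bound for the norms of the operators with potentials bounded by `D`. -/
def normBound (D : ℝ) : ℝ := Real.sqrt (2 * M.deg * M.deg + 2 * D ^ 2)

theorem norm_le_normBound {D : ℝ} {v : V → ℝ} (hv : ∀ x, |v x| ≤ D) {T : Ell2 V →L[ℂ] Ell2 V}
    (hT : ∀ ψ x, T ψ x = ∑ y ∈ M.nbhd x, ψ y + v x * ψ x) : ‖T‖ ≤ M.normBound D := by
  refine T.opNorm_le_bound (Real.sqrt_nonneg _) fun ψ => ?_
  refine abs_le_of_sq_le_sq' ?_ (mul_nonneg (Real.sqrt_nonneg _) (norm_nonneg _)) |>.2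
  rw [mul_pow, Real.sq_sqrt (by positivity), ell2_norm_sq]
  refine Real.tsum_le_of_sum_le (fun x => by positivity) fun s => ?_
  have hpt : ∀ x, ‖T ψ x‖ ^ 2 ≤
      2 * M.deg * ∑ y ∈ M.nbhd x, ‖ψ y‖ ^ 2 + 2 * D ^ 2 * ‖ψ x‖ ^ 2 := fun x => by
    have hD0 : 0 ≤ D := (abs_nonneg _).trans (hv x)
    have h1 : ‖∑ y ∈ M.nbhd x, ψ y‖ ^ 2 ≤ M.deg * ∑ y ∈ M.nbhd x, ‖ψ y‖ ^ 2 := by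
      calc ‖∑ y ∈ M.nbhd x, ψ y‖ ^ 2 ≤ (∑ y ∈ M.nbhd x, ‖ψ y‖) ^ 2 := by
            gcongr; exact norm_sum_le _ _
        _ ≤ (M.nbhd x).card * ∑ y ∈ M.nbhd x, ‖ψ y‖ ^ 2 := sq_sum_le_card_mul_sum_sq
        _ ≤ _ := by gcongr; exact M.card_nbhd_le x
    have h2 : ‖v x * ψ x‖ ≤ D * ‖ψ x‖ := by
      rw [norm_mul, Complex.norm_real, Real.norm_eq_abs]
      gcongr
      exact hv x
    rw [hT]
    set a := ∑ y ∈ M.nbhd x, ψ y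
    set b := (v x : ℂ) * ψ x
    have h3 : ‖a + b‖ ≤ ‖a‖ + ‖b‖ := norm_add_le _ _
    have h4 : ‖b‖ ^ 2 ≤ (D * ‖ψ x‖) ^ 2 := by gcongr
    have h5 : ‖a + b‖ ^ 2 ≤ (‖a‖ + ‖b‖) ^ 2 := by gcongr
    nlinarith [sq_nonneg (‖a‖ - ‖b‖)]
  calc ∑ x ∈ s, ‖T ψ x‖ ^ 2
      ≤ ∑ x ∈ s, (2 * M.deg * ∑ y ∈ M.nbhd x, ‖ψ y‖ ^ 2 + 2 * D ^ 2 * ‖ψ x‖ ^ 2) :=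
        Finset.sum_le_sum fun x _ => hpt x
    _ = 2 * M.deg * ∑ x ∈ s, ∑ y ∈ M.nbhd x, ‖ψ y‖ ^ 2 + 2 * D ^ 2 * ∑ x ∈ s, ‖ψ x‖ ^ 2 := by
        rw [Finset.sum_add_distrib, Finset.mul_sum, Finset.mul_sum]
    _ ≤ 2 * M.deg * (M.deg * ‖ψ‖ ^ 2) + 2 * D ^ 2 * ‖ψ‖ ^ 2 := by
        gcongr
        · exact M.sum_sum_nbhd_le s ψ
        · rw [ell2_norm_sq]
          exact (ell2_summable ψ).sum_le_tsum _ fun _ _ => by positivity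
    _ = (2 * M.deg * M.deg + 2 * D ^ 2) * ‖ψ‖ ^ 2 := by ring

theorem isSelfAdjoint_of_apply {v : V → ℝ} {T : Ell2 V →L[ℂ] Ell2 V}
    (hT : ∀ ψ x, T ψ x = ∑ y ∈ M.nbhd x, ψ y + v x * ψ x) : IsSelfAdjoint T := by
  classical
  refine isSelfAdjoint_of_delta fun x y => ?_
  simp only [hT, delta_apply, Finset.sum_ite_eq', map_add, map_mul, Complex.conj_ofReal]
  have h1 : x ∈ M.nbhd y ↔ y ∈ M.nbhd x := ⟨M.mem_nbhd_symm y x, M.mem_nbhd_symm x y⟩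
  by_cases hxy : y = x
  · subst hxy; simp [apply_ite (starRingEnd ℂ)]
  · simp [h1, hxy, Ne.symm hxy, apply_ite (starRingEnd ℂ)]

include M in
theorem norm_andersonOperator_le {lam R : ℝ} {w : J → ℝ} (hw : ∀ y, |w y| ≤ R) :
    ‖andersonOperator G J block lam w‖ ≤ M.normBound (|lam| * R) :=
  M.norm_le_normBound (M.abs_pot_le hw) (M.andersonOperator_apply_eq hw)

include M in
theorem isSelfAdjoint_andersonOperator {lam R : ℝ} {w : J → ℝ} (hw : ∀ y, |w y| ≤ R) :
    IsSelfAdjoint (andersonOperator G J block lam w) :=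
  M.isSelfAdjoint_of_apply (M.andersonOperator_apply_eq hw)

include M in
theorem andersonOperator_apply_hop {lam R : ℝ} {w : J → ℝ} (hw : ∀ y, |w y| ≤ R) (ψ : Ell2 V)
    (f : V → ℝ) (hψ : ∀ u, ψ u = (f u : ℂ)) (u : V) :
    andersonOperator G J block lam w ψ u = (hop M.nbhd (M.pot lam w) f u : ℂ) := by
  rw [M.andersonOperator_apply_eq hw, hop]
  push_cast
  simp_rw [hψ]

theorem integral_pow_andersonOperator {lam R : ℝ} {w : J → ℝ} (hw : ∀ y, |w y| ≤ R) (x : V)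
    (p : ℕ) : ∫ t, t ^ p ∂(spectralMeasure (andersonOperator G J block lam w) (delta x))
      = hopMoment M.nbhd (M.pot lam w) p x := by
  rw [integral_pow_spectralMeasure (M.isSelfAdjoint_andersonOperator hw),
    inner_delta_pow (ι := id) Function.injective_id (M.andersonOperator_apply_hop hw)]
  rfl

/-- `Q` is multiplication by the indicator of the block of `y`. The operator is affine in the
coefficient `w y` with slope `lam * Q`, the form that spectral averaging requires. -/
theorem exists_blockProjection (y : J) : ∃ Q : Ell2 V →L[ℂ] Ell2 V, IsSelfAdjoint Q ∧ Q * Q = Q ∧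
    (∀ x, M.site x = y → Q (delta x) = delta x) ∧
    ∀ [DecidableEq J] (lam R : ℝ) (w : J → ℝ) (_ : ∀ z, |w z| ≤ R) (t : ℝ),
      andersonOperator G J block lam (Function.update w y t)
        = andersonOperator G J block lam (Function.update w y 0) + ((lam * t : ℝ) : ℂ) • Q := by
  classical
  have hb : ∀ t : ℝ, ∀ z, |Function.update (0 : J → ℝ) y t z| ≤ |t| := fun t z => by
    by_cases h : z = y
    · subst h; simp
    · simp [h]
  have hQ : ∃ Q : Ell2 V →L[ℂ] Ell2 V, ∀ ψ x, Q ψ x = if M.site x = y then ψ x else 0 := by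
    -- The adjacency parts cancel in the difference, leaving the multiplication operator.
    refine ⟨andersonOperator G J block 1 (Function.update (0 : J → ℝ) y 1) -
      andersonOperator G J block 1 (Function.update (0 : J → ℝ) y 0), fun ψ x => ?_⟩
    rw [sub_apply, lp.coeFn_sub, Pi.sub_apply, M.andersonOperator_apply_eq (hb 1),
      M.andersonOperator_apply_eq (hb 0)]
    by_cases h : M.site x = y <;> simp [pot, h]
  obtain ⟨Q, hQ⟩ := hQ
  refine ⟨Q, ?_, ?_, fun x hx => ?_, ?_⟩
  · refine isSelfAdjoint_of_delta fun x z => ?_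
    rw [hQ, hQ, delta_apply, delta_apply]
    by_cases hxz : z = x
    · subst hxz; split_ifs <;> simp
    · simp [hxz, Ne.symm hxz]
  · ext ψ x
    rw [mul_apply_eq_comp, hQ, hQ]
    split_ifs <;> rfl
  · refine lp.ext (funext fun z => ?_)
    rw [hQ, delta_apply]
    by_cases hzx : z = x
    · subst hzx; simp [hx]
    · simp [hzx]
  · intro inst lam R w hw t
    have hb' : ∀ s : ℝ, ∀ z, |Function.update w y s z| ≤ R + |s| := fun s z => by
      have h0 : 0 ≤ R := (abs_nonneg _).trans (hw z)
      by_cases h : z = y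
      · subst h; simp [h0]
      · simpa [h] using (hw z).trans (le_add_of_nonneg_right (abs_nonneg s))
    ext ψ x
    rw [add_apply, lp.coeFn_add, Pi.add_apply, M.andersonOperator_apply_eq (hb' t),
      M.andersonOperator_apply_eq (hb' 0), smul_apply, lp.coeFn_smul, Pi.smul_apply, hQ]
    by_cases h : M.site x = y
    · simp [pot, h]
    · simp [pot, h]

end SiteModel

end SiteModel

/-! ### Cut-offs of operators and traces. -/

section Compress

variable {V : Type*}

theorem extendZero_delta (U : Set V) (u : U) : extendZero U (delta u) = delta (u : V) := by
  classical
  refine lp.ext (funext fun x => ?_)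
  change zeroExtension U (delta u) x = _
  rw [delta_apply]
  by_cases hx : x ∈ U
  · rw [show x = ((⟨x, hx⟩ : U) : V) from rfl, zeroExtension_coe, delta_apply]
    simp [Subtype.ext_iff]
  · rw [zeroExtension_of_notMem U _ hx, if_neg]
    rintro rfl
    exact hx u.2

theorem compress_apply (U : Set V) (T : Ell2 V →L[ℂ] Ell2 V) (ψ : Ell2 U) (u : U) :
    compress U T ψ u = T (extendZero U ψ) u := by
  rw [← inner_delta_left, compress]
  simp only [ContinuousLinearMap.comp_apply, ContinuousLinearMap.adjoint_inner_right]
  change ⟪extendZero U (delta u), T (extendZero U ψ)⟫_ℂ = _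
  rw [extendZero_delta, inner_delta_left]

theorem norm_compress_le (U : Set V) (T : Ell2 V →L[ℂ] Ell2 V) : ‖compress U T‖ ≤ ‖T‖ := by
  have h1 : ‖(extendZero U).toContinuousLinearMap‖ ≤ 1 := (extendZero U).norm_toContinuousLinearMap_le
  calc ‖compress U T‖ ≤ ‖ContinuousLinearMap.adjoint (extendZero U).toContinuousLinearMap‖ *
        (‖T‖ * ‖(extendZero U).toContinuousLinearMap‖) :=
        (ContinuousLinearMap.opNorm_comp_le _ _).trans
          (by gcongr; exact ContinuousLinearMap.opNorm_comp_le _ _)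
    _ ≤ 1 * (‖T‖ * 1) := by
        rw [LinearIsometryEquiv.norm_map]
        gcongr
    _ = ‖T‖ := by ring

theorem isSelfAdjoint_compress (U : Set V) {T : Ell2 V →L[ℂ] Ell2 V} (hT : IsSelfAdjoint T) :
    IsSelfAdjoint (compress U T) := by
  rw [compress]
  exact hT.adjoint_conj _

/-- The trace is evaluated in the orthonormal basis of unit vectors `δ_x`. -/
theorem trace_spectralProjection [Fintype V] (T : Ell2 V →L[ℂ] Ell2 V) (B : Set ℝ) :
    LinearMap.trace ℂ (Ell2 V) (spectralProjection T B).toLinearMap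
      = ((∑ x, (spectralMeasure T (delta x)).real B : ℝ) : ℂ) := by
  classical
  let b : HilbertBasis V ℂ (Ell2 V) := HilbertBasis.ofRepr (LinearIsometryEquiv.refl ℂ _)
  have hb : ∀ x, b x = delta x := fun x => by
    change (LinearIsometryEquiv.refl ℂ (Ell2 V)).symm (lp.single 2 x 1) = _
    rw [delta]
    congr!
  rw [LinearMap.trace_eq_sum_inner _ b.toOrthonormalBasis]
  push_cast
  refine Finset.sum_congr rfl fun x _ => ?_
  simp only [HilbertBasis.coe_toOrthonormalBasis, hb]
  exact inner_spectralProjection T B (delta x)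

end Compress

/-! ### Moments of cut-offs; measurable dependence of spectral measures on the potential. -/

section SiteModel

variable {V : Type*} {G : SimpleGraph V} {J : Set V} {block : V → Set V}

namespace SiteModel

variable (M : SiteModel G J block)

open Classical in
/-- The neighbours of a vertex inside `U`. -/
def cutNbhd (U : Set V) (x : V) : Finset V := (M.nbhd x).filter (· ∈ U)

theorem cutNbhd_subset (U : Set V) (x : V) : M.cutNbhd U x ⊆ M.nbhd x := by
  classical
  exact Finset.filter_subset _ _

theorem mem_cutNbhd {U : Set V} {x y : V} : y ∈ M.cutNbhd U x ↔ y ∈ M.nbhd x ∧ y ∈ U := by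
  classical
  simp [cutNbhd]

theorem card_cutNbhd_le (U : Set V) (x : V) : (M.cutNbhd U x).card ≤ M.deg :=
  (Finset.card_le_card (M.cutNbhd_subset U x)).trans (M.card_nbhd_le x)

include M in
-- Cutting off merely deletes neighbours outside `U`, so the results on `hop` apply to cut-off
-- operators as well.
theorem compress_apply_hop (U : Set V) {lam R : ℝ} {w : J → ℝ} (hw : ∀ y, |w y| ≤ R)
    (ψ : Ell2 U) (f : V → ℝ) (hψ : ∀ u : U, ψ u = (f u : ℂ)) (u : U) :
    compress U (andersonOperator G J block lam w) ψ u
      = (hop (M.cutNbhd U) (M.pot lam w) f u : ℂ) := by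
  classical
  rw [compress_apply, M.andersonOperator_apply_eq hw, hop]
  have hext : ∀ x, extendZero U ψ x = if x ∈ U then (f x : ℂ) else 0 := fun x => by
    change zeroExtension U ψ x = _
    by_cases hx : x ∈ U
    · rw [if_pos hx, show x = ((⟨x, hx⟩ : U) : V) from rfl, zeroExtension_coe, hψ]
    · rw [if_neg hx, zeroExtension_of_notMem U _ hx]
  simp only [hext, cutNbhd]
  rw [← Finset.sum_filter, if_pos u.2]
  push_cast
  congr!

include M in
theorem integral_pow_compress (U : Set V) {lam R : ℝ} {w : J → ℝ} (hw : ∀ y, |w y| ≤ R) (u : U)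
    (p : ℕ) :
    ∫ t, t ^ p ∂(spectralMeasure (compress U (andersonOperator G J block lam w)) (delta u))
      = hopMoment (M.cutNbhd U) (M.pot lam w) p u := by
  rw [integral_pow_spectralMeasure (isSelfAdjoint_compress U (M.isSelfAdjoint_andersonOperator hw)),
    inner_delta_pow Subtype.val_injective (M.compress_apply_hop U hw)]
  rfl

theorem measurable_pot {S : Type*} [MeasurableSpace S] (lam : ℝ) {w : S → J → ℝ}
    (hw : ∀ y, Measurable fun s => w s y) (x : V) : Measurable fun s => M.pot lam (w s) x :=
  (hw _).const_mul lam

include M in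
theorem isProbabilityMeasure_spectralMeasure {lam R : ℝ} {w : J → ℝ} (hw : ∀ y, |w y| ≤ R) (x : V) :
    IsProbabilityMeasure (spectralMeasure (andersonOperator G J block lam w) (delta x)) := by
  have h := spectralMeasure_real_univ (M.isSelfAdjoint_andersonOperator (lam := lam) hw) (delta x)
  rw [norm_delta, one_pow, measureReal_def, ENNReal.toReal_eq_one_iff] at h
  exact ⟨h⟩

include M in
theorem spectralMeasure_compl {lam R : ℝ} {w : J → ℝ} (hw : ∀ y, |w y| ≤ R) (x : V) :
    spectralMeasure (andersonOperator G J block lam w) (delta x)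
      (Set.Icc (-M.normBound (|lam| * R)) (M.normBound (|lam| * R)))ᶜ = 0 :=
  spectralMeasure_compl_Icc _ _ (M.norm_andersonOperator_le hw)

include M in
-- Moments are polynomials in finitely many values of the potential, hence measurable; integrals of
-- continuous functions are limits of linear combinations of moments.
theorem measurable_integral_spectralMeasure {S : Type*} [MeasurableSpace S] {lam R : ℝ}
    {w : S → J → ℝ} (hw : ∀ s y, |w s y| ≤ R) (hm : ∀ y, Measurable fun s => w s y) (x : V)
    {f : ℝ → ℝ} (hf : Continuous f) :
    Measurable fun s => ∫ t, f t ∂(spectralMeasure (andersonOperator G J block lam (w s)) (delta x)) := by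
  have hprob := fun s => M.isProbabilityMeasure_spectralMeasure (lam := lam) (hw s) x
  have hsupp := fun s => M.spectralMeasure_compl (lam := lam) (hw s) x
  obtain ⟨q, hq⟩ := exists_polynomial_seq hf (M.normBound (|lam| * R))
  refine measurable_of_tendsto_metrizable (f := fun n s => ∫ t, (q n).eval t
    ∂(spectralMeasure (andersonOperator G J block lam (w s)) (delta x))) (fun n => ?_) ?_
  · simp_rw [integral_polynomial_eval (hsupp _), M.integral_pow_andersonOperator (hw _)]
    exact Finset.measurable_fun_sum _ fun k _ =>
      (measurable_hopMoment (M.measurable_pot lam hm) k x).const_mul _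
  · refine tendsto_pi_nhds.2 fun s => ?_
    rw [tendsto_iff_dist_tendsto_zero]
    refine squeeze_zero (fun _ => dist_nonneg) (fun n => ?_) tendsto_one_div_add_atTop_nhds_zero_nat
    rw [Real.dist_eq]
    exact abs_integral_sub_integral_le (by simp) (hsupp s) hf (q n).continuous (by positivity) (hq n)

include M in
-- Closed half-lines form a generating π-system, and their indicators are limits of continuous
-- functions.
theorem measurable_spectralMeasure {S : Type*} [MeasurableSpace S] {lam R : ℝ}
    {w : S → J → ℝ} (hw : ∀ s y, |w s y| ≤ R) (hm : ∀ y, Measurable fun s => w s y) (x : V) :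
    Measurable fun s => spectralMeasure (andersonOperator G J block lam (w s)) (delta x) := by
  have hprob := fun s => M.isProbabilityMeasure_spectralMeasure (lam := lam) (hw s) x
  refine Measurable.measure_of_isPiSystem_of_isProbabilityMeasure (borel_eq_generateFrom_Iic ℝ)
    isPiSystem_Iic ?_
  rintro _ ⟨a, rfl⟩
  have hδ : ∀ n : ℕ, 0 < 1 / (n + 1 : ℝ) := fun n => by positivity
  refine measurable_of_tendsto_metrizable (f := fun n s => ∫⁻ t, thickenedIndicator (hδ n)
    (Set.Iic a) t ∂(spectralMeasure (andersonOperator G J block lam (w s)) (delta x)))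
    (fun n => ?_) ?_
  · have h : ∀ s, ∫⁻ t, thickenedIndicator (hδ n) (Set.Iic a) t
        ∂(spectralMeasure (andersonOperator G J block lam (w s)) (delta x))
        = ENNReal.ofReal (∫ t, (thickenedIndicator (hδ n) (Set.Iic a) t : ℝ)
        ∂(spectralMeasure (andersonOperator G J block lam (w s)) (delta x))) := fun s => by
      rw [ofReal_integral_eq_lintegral_ofReal
        (integrable_of_compl_Icc (M.spectralMeasure_compl (lam := lam) (hw s) x) (by fun_prop))
        (Eventually.of_forall fun t => by simp)]
      simp
    simp_rw [h]
    exact (M.measurable_integral_spectralMeasure hw hm x (by fun_prop)).ennreal_ofReal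
  · exact tendsto_pi_nhds.2 fun s => tendsto_lintegral_thickenedIndicator_of_isClosed _ isClosed_Iic
      hδ tendsto_one_div_add_atTop_nhds_zero_nat

end SiteModel

end SiteModel

/-! ### Resampling one coordinate of a product measure. -/

section Resampling

/-- A product measure is unchanged when one coordinate is sampled anew. -/
theorem map_update_prod_infinitePi {ι : Type*} [DecidableEq ι] (μ : ι → Measure ℝ)
    [∀ i, IsProbabilityMeasure (μ i)] (i : ι) :
    ((μ i).prod (Measure.infinitePi μ)).map (fun z => Function.update z.2 i z.1)
      = Measure.infinitePi μ := by
  have hmeas : Measurable fun z : ℝ × (ι → ℝ) => Function.update z.2 i z.1 := by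
    refine measurable_pi_iff.2 fun j => ?_
    by_cases h : j = i
    · subst h; simpa using measurable_fst
    · simp only [ne_eq, h, not_false_eq_true, Function.update_of_ne]
      exact (measurable_pi_apply j).comp measurable_snd
  refine Measure.eq_infinitePi μ fun s t ht => ?_
  rw [Measure.map_apply hmeas (MeasurableSet.pi s.countable_toSet fun j _ => ht j)]
  by_cases hi : i ∈ s
  · have h : (fun z : ℝ × (ι → ℝ) => Function.update z.2 i z.1) ⁻¹' (Set.pi s t)
        = t i ×ˢ Set.pi (s.erase i) t := by
      ext z
      simp only [Set.mem_preimage, Set.mem_pi, Set.mem_prod, Finset.mem_coe, Finset.mem_erase]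
      constructor
      · intro h
        refine ⟨by simpa using h i hi, fun j hj => by simpa [hj.1] using h j hj.2⟩
      · rintro ⟨h1, h2⟩ j hj
        by_cases hji : j = i
        · subst hji; simpa using h1
        · simpa [hji] using h2 j ⟨hji, hj⟩
    rw [h, Measure.prod_prod, Measure.infinitePi_pi μ fun j _ => ht j,
      Finset.mul_prod_erase s (fun j => μ j (t j)) hi]
  · have h : (fun z : ℝ × (ι → ℝ) => Function.update z.2 i z.1) ⁻¹' (Set.pi s t)
        = Set.univ ×ˢ Set.pi s t := by
      ext z
      simp only [Set.mem_preimage, Set.mem_pi, Set.mem_prod, Finset.mem_coe, Set.mem_univ, true_and]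
      refine forall₂_congr fun j hj => ?_
      have : j ≠ i := fun h => hi (h ▸ hj)
      simp [this]
    rw [h, Measure.prod_prod, Measure.infinitePi_pi μ fun j _ => ht j, measure_univ, one_mul]

end Resampling

/-- Truncation of a real number to the interval `[-R, R]`. -/
def clip (R t : ℝ) : ℝ := max (-R) (min R t)

theorem abs_clip_le {R : ℝ} (hR : 0 ≤ R) (t : ℝ) : |clip R t| ≤ R :=
  abs_le.2 ⟨le_max_left _ _, max_le (by linarith) (min_le_left _ _)⟩

theorem clip_of_abs_le {R t : ℝ} (h : |t| ≤ R) : clip R t = t := by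
  rw [abs_le] at h
  rw [clip, min_eq_right h.2, max_eq_right h.1]

theorem measurable_clip (R : ℝ) : Measurable (clip R) := by unfold clip; fun_prop

/-! ### Mean spectral measures and the Wegner estimate. -/

section MeanSpectralMeasure

variable {V : Type*} {G : SimpleGraph V} {J : Set V} {block : V → Set V}
  {Ω : Type*} [MeasurableSpace Ω]

/-- The mean of the spectral measures at `δ_x` of the random operators with potentials `η`. -/
def meanSpectralMeasure (P : Measure Ω) (G : SimpleGraph V) (J : Set V) (block : V → Set V)
    (lam : ℝ) (η : J → Ω → ℝ) (x : V) : Measure ℝ :=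
  P.bind fun s => spectralMeasure (andersonOperator G J block lam fun y => η y s) (delta x)

namespace SiteModel

variable (M : SiteModel G J block) {P : Measure Ω} {lam R : ℝ}
  {η : J → Ω → ℝ}

include M in
theorem meanSpectralMeasure_apply (hη : ∀ y s, |η y s| ≤ R) (hm : ∀ y, Measurable (η y)) (x : V)
    {B : Set ℝ} (hB : MeasurableSet B) : meanSpectralMeasure P G J block lam η x B
      = ∫⁻ s, spectralMeasure (andersonOperator G J block lam fun y => η y s) (delta x) B ∂P :=
  Measure.bind_apply hB
    (M.measurable_spectralMeasure (w := fun s y => η y s) (fun s y => hη y s) hm x).aemeasurable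

include M in
theorem isProbabilityMeasure_meanSpectralMeasure [IsProbabilityMeasure P] (hη : ∀ y s, |η y s| ≤ R)
    (hm : ∀ y, Measurable (η y)) (x : V) :
    IsProbabilityMeasure (meanSpectralMeasure P G J block lam η x) := by
  have hprob := fun s => M.isProbabilityMeasure_spectralMeasure (lam := lam) (w := fun y => η y s)
    (fun y => hη y s) x
  exact ⟨by rw [M.meanSpectralMeasure_apply hη hm x MeasurableSet.univ]; simp⟩

include M in
theorem meanSpectralMeasure_real (hη : ∀ y s, |η y s| ≤ R)
    (hm : ∀ y, Measurable (η y)) (x : V) {B : Set ℝ} (hB : MeasurableSet B) :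
    (meanSpectralMeasure P G J block lam η x).real B
      = ∫ s, (spectralMeasure (andersonOperator G J block lam fun y => η y s) (delta x)).real B ∂P := by
  have hprob := fun s => M.isProbabilityMeasure_spectralMeasure (lam := lam) (w := fun y => η y s)
    (fun y => hη y s) x
  have hmeas := M.measurable_spectralMeasure (lam := lam) (w := fun s y => η y s)
    (fun s y => hη y s) hm x
  rw [measureReal_def, M.meanSpectralMeasure_apply hη hm x hB]
  exact (integral_toReal ((Measure.measurable_coe hB).comp hmeas).aemeasurable
    (Eventually.of_forall fun s => measure_lt_top _ _)).symm

include M in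
theorem meanSpectralMeasure_compl (hη : ∀ y s, |η y s| ≤ R) (hm : ∀ y, Measurable (η y)) (x : V) :
    meanSpectralMeasure P G J block lam η x
      (Set.Icc (-M.normBound (|lam| * R)) (M.normBound (|lam| * R)))ᶜ = 0 := by
  rw [M.meanSpectralMeasure_apply hη hm x measurableSet_Icc.compl]
  simp_rw [M.spectralMeasure_compl (fun y => hη y _) x]
  simp

include M in
theorem integral_pow_meanSpectralMeasure [IsProbabilityMeasure P] (hη : ∀ y s, |η y s| ≤ R)
    (hm : ∀ y, Measurable (η y)) (x : V) (p : ℕ) : ∫ t, t ^ p ∂(meanSpectralMeasure P G J block lam η x)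
      = ∫ s, hopMoment M.nbhd (M.pot lam fun y => η y s) p x ∂P := by
  have hprob := M.isProbabilityMeasure_meanSpectralMeasure (P := P) (lam := lam) hη hm x
  -- Writing the mean as a composition of kernels allows iterated integration of signed functions.
  let κ : Kernel Ω ℝ :=
    ⟨fun s => spectralMeasure (andersonOperator G J block lam fun y => η y s) (delta x),
      M.measurable_spectralMeasure (w := fun s y => η y s) (fun s y => hη y s) hm x⟩
  have h : meanSpectralMeasure P G J block lam η x = (κ ∘ₖ Kernel.const Unit P) () := by
    rw [Kernel.comp_apply, Kernel.const_apply]; rfl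
  have hint : Integrable (fun t : ℝ => t ^ p) ((κ ∘ₖ Kernel.const Unit P) ()) := by
    rw [← h]
    exact integrable_of_compl_Icc (M.meanSpectralMeasure_compl hη hm x) (by fun_prop)
  rw [h, Kernel.integral_comp hint, Kernel.const_apply]
  exact integral_congr_ae (Eventually.of_forall fun s =>
    M.integral_pow_andersonOperator (fun y => hη y s) x p)

/-- The Poisson kernel centred at the midpoint, with height `(b - a) / 2`, is at least `1 / (b - a)`
on `[a, b]`. -/
theorem measure_Icc_le_poisson (μ : Measure ℝ) [IsFiniteMeasure μ] {S : ℝ}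
    (hμ : μ (Set.Icc (-S) S)ᶜ = 0) {a b : ℝ} (hab : a < b) :
    μ (Set.Icc a b) ≤ ENNReal.ofReal (b - a) * ENNReal.ofReal (∫ t, ((b - a) / 2) /
      ((t - (a + b) / 2) ^ 2 + ((b - a) / 2) ^ 2) ∂μ) := by
  have hba : 0 < b - a := sub_pos.2 hab
  have hcont : Continuous fun t : ℝ => ((b - a) / 2) /
      ((t - (a + b) / 2) ^ 2 + ((b - a) / 2) ^ 2) :=
    Continuous.div continuous_const (by fun_prop) fun t => by positivity
  rw [ofReal_integral_eq_lintegral_ofReal (integrable_of_compl_Icc hμ hcont)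
    (Eventually.of_forall fun t => by simp only [Pi.zero_apply]; positivity),
    ← lintegral_const_mul _ (by fun_prop), ← lintegral_indicator_one measurableSet_Icc]
  refine lintegral_mono fun t => ?_
  refine Set.indicator_apply_le' (fun ht => ?_) (fun _ => zero_le)
  rw [Pi.one_apply, ← ENNReal.ofReal_mul hba.le, ENNReal.one_le_ofReal, mul_div_assoc',
    le_div_iff₀ (by positivity)]
  have h1 : (t - (a + b) / 2) ^ 2 ≤ ((b - a) / 2) ^ 2 :=
    sq_le_sq' (by linarith [ht.1]) (by linarith [ht.2])
  nlinarith

include M in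
/-- **Wegner estimate** for the mean spectral measures of a random operator with independent
coefficients of bounded density. -/
theorem meanSpectralMeasure_absolutelyContinuous (hR : 0 ≤ R) (hη : ∀ y s, |η y s| ≤ R)
    (hm : ∀ y, Measurable (η y)) (hind : iIndepFun η P) {μ : Measure ℝ} [IsProbabilityMeasure μ]
    (hlaw : ∀ y, P.map (η y) = μ) {C : ℝ≥0∞} (hC : C ≠ ∞) (hμ : μ ≤ C • volume)
    (hμR : μ (Set.Icc (-R) R)ᶜ = 0) (hlam : 0 < lam) (x : V) :
    meanSpectralMeasure P G J block lam η x ≪ volume := by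
  classical
  -- The constant of `lintegral_poisson_le` for a unit vector; it is the same for all `a` and `b`.
  set D := C * ENNReal.ofReal ((2 * (2 * (R + 1) + 1) + 2 * (R + 1) * ((R + 1) ^ 2 + (R + 1 + 1) ^ 2))
        * (1 ^ 2 / lam)) with hD
  refine absolutelyContinuous_of_Icc (C := D) (by finiteness) fun a b hab => ?_
  set z : ℂ := ⟨(a + b) / 2, (b - a) / 2⟩ with hz
  have hz0 : 0 < z.im := by simp only [hz]; linarith
  -- Clipping keeps the potential bounded for every point of the product space, which makes `g`
  -- measurable there; it does not affect the actual samples.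
  let g : (J → ℝ) → ℝ≥0∞ := fun w => ENNReal.ofReal (∫ t, z.im / ((t - z.re) ^ 2 + z.im ^ 2)
    ∂(spectralMeasure (andersonOperator G J block lam fun y => clip R (w y)) (delta x)))
  have hcont : Continuous fun t : ℝ => z.im / ((t - z.re) ^ 2 + z.im ^ 2) :=
    Continuous.div continuous_const (by fun_prop) fun t => by positivity
  have hg : Measurable g := (M.measurable_integral_spectralMeasure (R := R)
    (w := fun (w : J → ℝ) y => clip R (w y)) (fun _ _ => abs_clip_le hR _)
    (fun y => (measurable_clip R).comp (measurable_pi_apply y)) x hcont).ennreal_ofReal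
  have hprob := fun s => M.isProbabilityMeasure_spectralMeasure (lam := lam) (w := fun y => η y s)
    (fun y => hη y s) x
  have hmap : P.map (fun s y => η y s) = Measure.infinitePi fun _ => μ := by
    rw [hind.map_fun_eq_infinitePi_map hm]
    simp_rw [hlaw]
  -- The coefficient of the block containing `x` is sampled anew and averaged first, all others
  -- being fixed.
  have hsample : ∫⁻ s, g (fun y => η y s) ∂P ≤ D := by
    rw [← lintegral_map (f := g) hg (measurable_pi_iff.2 hm), hmap,
      ← map_update_prod_infinitePi (fun _ => μ) (M.site x)]
    have hupd : Measurable fun z : ℝ × (J → ℝ) => Function.update z.2 (M.site x) z.1 := by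
      refine measurable_pi_iff.2 fun j => ?_
      by_cases h : j = M.site x
      · subst h; simpa using measurable_fst
      · simp only [ne_eq, h, not_false_eq_true, Function.update_of_ne]
        exact (measurable_pi_apply j).comp measurable_snd
    rw [lintegral_map hg hupd, lintegral_prod_symm' (fun z => g (Function.update z.2 (M.site x) z.1)) (hg.comp hupd)]
    calc ∫⁻ w, ∫⁻ t, g (Function.update w (M.site x) t) ∂μ ∂(Measure.infinitePi fun _ => μ)
        ≤ ∫⁻ _, D ∂(Measure.infinitePi fun _ : J => μ) := lintegral_mono fun w => ?_
      _ = D := by simp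
    obtain ⟨Q, hQ1, hQ2, hQ3, hQ4⟩ := M.exists_blockProjection (M.site x)
    have hw : ∀ y, |clip R (w y)| ≤ R := fun y => abs_clip_le hR _
    have hw0 : ∀ y, |Function.update (fun y => clip R (w y)) (M.site x) 0 y| ≤ R := fun y => by
      by_cases h : y = M.site x
      · subst h; simpa using hR
      · simpa [h] using hw y
    have h1 : ∀ᵐ t ∂μ, g (Function.update w (M.site x) t)
        = ENNReal.ofReal (∫ s, z.im / ((s - z.re) ^ 2 + z.im ^ 2) ∂(spectralMeasure
          (andersonOperator G J block lam (Function.update (fun y => clip R (w y)) (M.site x) 0)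
            + ((lam * t : ℝ) : ℂ) • Q) (delta x))) := by
      filter_upwards [mem_ae_iff.2 hμR] with t ht
      rw [← hQ4 lam R _ hw t]
      simp only [g]
      congr 5
      funext y
      by_cases h : y = M.site x
      · subst h; simp [clip_of_abs_le (abs_le.2 ht)]
      · simp [h]
    rw [lintegral_congr_ae h1]
    have h2 := lintegral_poisson_le (M.isSelfAdjoint_andersonOperator (lam := lam) hw0) hQ1 hQ2 hlam
      (hQ3 x rfl) hz0 hR hμ hμR
    rwa [norm_delta] at h2
  rw [M.meanSpectralMeasure_apply hη hm x measurableSet_Icc]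
  calc ∫⁻ s, spectralMeasure (andersonOperator G J block lam fun y => η y s) (delta x)
        (Set.Icc a b) ∂P
      ≤ ∫⁻ s, ENNReal.ofReal (b - a) * g (fun y => η y s) ∂P := by
        refine lintegral_mono fun s => ?_
        refine (measure_Icc_le_poisson _ (M.spectralMeasure_compl (fun y => hη y s) x) hab).trans ?_
        simp only [g, clip_of_abs_le (hη _ s)]
        exact le_rfl
    _ = ENNReal.ofReal (b - a) * ∫⁻ s, g (fun y => η y s) ∂P :=
        lintegral_const_mul _ (hg.comp (measurable_pi_iff.2 hm))
    _ ≤ D * ENNReal.ofReal (b - a) := by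
        rw [mul_comm]; gcongr

end SiteModel

end MeanSpectralMeasure

/-! ### A strong law for locally dependent variables. -/

section LawOfLargeNumbers

variable {Ω : Type*} [MeasurableSpace Ω] {P : Measure Ω} [IsProbabilityMeasure P]

/-- The variance of a sum of bounded random variables each of which is independent of all but `D` of
the others is at most proportional to the number of terms. -/
theorem variance_sum_le_of_local {ι : Type*} {X : ι → Ω → ℝ} {B : ℝ}
    (hX : ∀ i, Measurable (X i)) (hB : ∀ i s, |X i s| ≤ B) (U : Finset ι) {D : ℕ}
    (N : ι → Finset ι) (hN : ∀ i, (N i).card ≤ D)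
    (hind : ∀ i j, j ∉ N i → IndepFun (X i) (X j) P) :
    Var[fun s => ∑ i ∈ U, X i s; P] ≤ U.card * (D * (2 * B) ^ 2) := by
  classical
  have hL : ∀ i, MemLp (X i) 2 P := fun i =>
    MemLp.of_bound (hX i).aestronglyMeasurable B (Eventually.of_forall fun s => hB i s)
  have hE : ∀ i, |∫ s, X i s ∂P| ≤ B := fun i => by
    have := norm_integral_le_of_norm_le_const (μ := P) (f := X i) (C := B)
      (Eventually.of_forall fun s => hB i s)
    simpa using this
  have hcov : ∀ i j, cov[X i, X j; P] ≤ (2 * B) ^ 2 := fun i j => by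
    rw [covariance]
    have h1 : ∀ i s, |X i s - ∫ s, X i s ∂P| ≤ 2 * B := fun i s => by
      have h2 := hB i s
      have h3 := hE i
      rw [abs_le] at *
      constructor <;> linarith
    have h4 : ‖∫ s, (X i s - ∫ s, X i s ∂P) * (X j s - ∫ s, X j s ∂P) ∂P‖
        ≤ (2 * B) ^ 2 * P.real Set.univ :=
      norm_integral_le_of_norm_le_const (Eventually.of_forall fun s => by
        rw [norm_mul, pow_two]
        have hB0 : 0 ≤ 2 * B := (abs_nonneg _).trans (h1 i s)
        exact mul_le_mul (h1 i s) (h1 j s) (norm_nonneg _) hB0)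
    simpa using (le_abs_self _).trans h4
  rw [variance_fun_sum' fun i _ => hL i]
  calc ∑ i ∈ U, ∑ j ∈ U, cov[X i, X j; P] ≤ ∑ i ∈ U, (D * (2 * B) ^ 2 : ℝ) :=
        Finset.sum_le_sum fun i _ => ?_
    _ = U.card * (D * (2 * B) ^ 2) := by rw [Finset.sum_const, nsmul_eq_mul]
  calc ∑ j ∈ U, cov[X i, X j; P] = ∑ j ∈ U.filter (· ∈ N i), cov[X i, X j; P] := by
        rw [Finset.sum_filter]
        refine Finset.sum_congr rfl fun j _ => ?_
        split_ifs with h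
        · rfl
        · exact (hind i j h).covariance_eq_zero (hL i) (hL j)
    _ ≤ ∑ j ∈ U.filter (· ∈ N i), (2 * B) ^ 2 := Finset.sum_le_sum fun j _ => hcov i j
    _ ≤ D * (2 * B) ^ 2 := by
        rw [Finset.sum_const, nsmul_eq_mul]
        gcongr
        exact (Finset.card_le_card fun j hj => (Finset.mem_filter.1 hj).2).trans (hN i)

/-- Random variables with summable variances converge almost surely to their means. -/
theorem ae_tendsto_sub_integral {Y : ℕ → Ω → ℝ} (hY : ∀ n, MemLp (Y n) 2 P)
    {b : ℕ → ℝ} (hb : Summable b) (hvar : ∀ n, Var[Y n; P] ≤ b n) :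
    ∀ᵐ s ∂P, Tendsto (fun n => Y n s - ∫ s', Y n s' ∂P) atTop (𝓝 0) := by
  have hb0 : ∀ n, 0 ≤ b n := fun n => (variance_nonneg _ _).trans (hvar n)
  have hmeas : ∀ n, AEMeasurable (fun s => ‖Y n s - ∫ s', Y n s' ∂P‖ₑ ^ 2) P := fun n =>
    ((hY n).aestronglyMeasurable.aemeasurable.sub_const _).enorm.pow_const 2
  -- The series of squared deviations has finite mean, so it converges almost surely and its terms
  -- tend to zero.
  have h1 : ∫⁻ s, ∑' n, ‖Y n s - ∫ s', Y n s' ∂P‖ₑ ^ 2 ∂P ≠ ∞ := by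
    rw [lintegral_tsum hmeas]
    have h2 : ∑' n, ENNReal.ofReal (b n) ≠ ∞ := by
      rw [← ENNReal.ofReal_tsum_of_nonneg hb0 hb]; exact ENNReal.ofReal_ne_top
    refine ne_top_of_le_ne_top h2 (ENNReal.tsum_le_tsum fun n => ?_)
    change evariance (Y n) P ≤ _
    rw [← ofReal_variance (hY n)]
    exact ENNReal.ofReal_le_ofReal (hvar n)
  have h3 : AEMeasurable (fun s => ∑' n, ‖Y n s - ∫ s', Y n s' ∂P‖ₑ ^ 2) P :=
    AEMeasurable.tsum hmeas
  filter_upwards [ae_lt_top' h3 h1] with s hs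
  have h4 := ENNReal.tendsto_atTop_zero_of_tsum_ne_top hs.ne
  have h5 : Tendsto (fun n => (Y n s - ∫ s', Y n s' ∂P) ^ 2) atTop (𝓝 0) := by
    have := (ENNReal.tendsto_toReal (by simp : (0 : ℝ≥0∞) ≠ ∞)).comp h4
    simpa [Function.comp_def, ENNReal.toReal_pow] using this
  have h6 := (Real.continuous_sqrt.tendsto 0).comp h5
  rw [Real.sqrt_zero] at h6
  refine tendsto_zero_iff_abs_tendsto_zero _ |>.2 (h6.congr fun n => ?_)
  simp [Real.sqrt_sq_eq_abs]

namespace SiteModel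

variable {V : Type*} {G : SimpleGraph V} {J : Set V} {block : V → Set V} (M : SiteModel G J block)
  {lam R : ℝ} {ω : J → Ω → ℝ}

omit [IsProbabilityMeasure P] in
-- Each moment is a function of the coefficients of the blocks met by walks of length at most `p`,
-- and the two finite families of blocks are disjoint.
theorem indepFun_hopMoment (hm : ∀ y, Measurable (ω y)) (hind : iIndepFun ω P) {N : V → Finset V}
    (p : ℕ) {x x' : V}
    (h : ∀ z ∈ reach N p x, ∀ z' ∈ reach N p x', M.site z ≠ M.site z') :
    IndepFun (fun s => hopMoment N (M.pot lam fun y => ω y s) p x)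
      (fun s => hopMoment N (M.pot lam fun y => ω y s) p x') P := by
  classical
  let S : V → Finset J := fun x => (reach N p x).image M.site
  let F : ∀ x : V, (S x → ℝ) → ℝ := fun x w =>
    -- The default `0` is assigned only at vertices that no relevant walk reaches.
    hopMoment N (fun z => lam * if hz : M.site z ∈ S x then w ⟨M.site z, hz⟩ else 0) p x
  have hF : ∀ x, Measurable (F x) := fun x => by
    refine measurable_hopMoment (fun z => ?_) p x
    by_cases hz : M.site z ∈ S x
    · simp only [hz, dite_true]
      exact Measurable.const_mul (f := fun w : S x → ℝ => w ⟨M.site z, hz⟩) (measurable_pi_apply _) lam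
    · simp only [hz, dite_false]
      exact measurable_const
  have hX : ∀ x, (fun s => hopMoment N (M.pot lam fun y => ω y s) p x)
      = F x ∘ fun s (i : S x) => ω i s := fun x => by
    funext s
    refine hop_iterate_congr _ p x fun z hz => ?_
    have : M.site z ∈ S x := Finset.mem_image_of_mem _ hz
    simp [this, pot]
  rw [hX, hX]
  refine IndepFun.comp (hind.indepFun_finset (S x) (S x') ?_ hm) (hF x) (hF x')
  refine Finset.disjoint_left.2 fun y hy hy' => ?_
  obtain ⟨z, hz, rfl⟩ := Finset.mem_image.1 hy
  obtain ⟨z', hz', he⟩ := Finset.mem_image.1 hy'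
  exact h z hz z' hz' he.symm

/-- The law of large numbers for the diagonal matrix elements of powers of the cut-off operators. -/
theorem ae_tendsto_average_hopMoment (hω : ∀ y s, |ω y s| ≤ R)
    (hm : ∀ y, Measurable (ω y)) (hind : iIndepFun ω P) {q : ℕ}
    (hq : ∀ x x', M.site x = M.site x' → x' ∈ reach M.nbhd q x) (A : ℕ → Set V)
    (U : ℕ → Finset V) (hU : ∀ L, 2 ^ L ≤ (U L).card) (p : ℕ) :
    ∀ᵐ s ∂P, Tendsto (fun L => ((U L).card : ℝ)⁻¹ *
        ∑ x ∈ U L, hopMoment (M.cutNbhd (A L)) (M.pot lam fun y => ω y s) p x -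
        ((U L).card : ℝ)⁻¹ *
        ∑ x ∈ U L, ∫ s', hopMoment (M.cutNbhd (A L)) (M.pot lam fun y => ω y s') p x ∂P)
      atTop (𝓝 0) := by
  obtain ⟨B, hB⟩ : ∃ B : ℝ, ∀ L x s,
      |hopMoment (M.cutNbhd (A L)) (M.pot lam fun y => ω y s) p x| ≤ B :=
    ⟨_, fun L x s => abs_hopMoment_le (M.card_cutNbhd_le (A L)) (M.abs_pot_le fun y => hω y s) p x⟩
  have hX : ∀ L x, Measurable fun s =>
      hopMoment (M.cutNbhd (A L)) (M.pot lam fun y => ω y s) p x := fun L x =>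
    measurable_hopMoment (M.measurable_pot lam (w := fun s y => ω y s) hm) p x
  have hXL : ∀ L x, MemLp (fun s =>
      hopMoment (M.cutNbhd (A L)) (M.pot lam fun y => ω y s) p x) 2 P := fun L x =>
    MemLp.of_bound (hX L x).aestronglyMeasurable B (Eventually.of_forall fun s => hB L x s)
  have hint : ∀ L x, Integrable (fun s =>
      hopMoment (M.cutNbhd (A L)) (M.pot lam fun y => ω y s) p x) P := fun L x =>
    Integrable.of_bound (hX L x).aestronglyMeasurable B (Eventually.of_forall fun s => hB L x s)
  -- Dependent vertices are joined by `p` steps to a common block, `q` steps across it and `p` steps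
  -- back. Using the neighbours in the full graph makes `D` independent of `L`.
  obtain ⟨D, hD⟩ : ∃ D : ℕ, ∀ x, (reach M.nbhd (p + q + p) x).card ≤ D :=
    ⟨_, card_reach_le M.card_nbhd_le _⟩
  have hindep : ∀ L x x', x' ∉ reach M.nbhd (p + q + p) x →
      IndepFun (fun s => hopMoment (M.cutNbhd (A L)) (M.pot lam fun y => ω y s) p x)
      (fun s => hopMoment (M.cutNbhd (A L)) (M.pot lam fun y => ω y s) p x') P := by
    intro L x x' hx'
    refine M.indepFun_hopMoment hm hind p fun z hz z' hz' he => hx' ?_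
    have h1 := reach_mono (M.cutNbhd_subset (A L)) p x hz
    have h2 := mem_reach_symm M.mem_nbhd_symm (reach_mono (M.cutNbhd_subset (A L)) p x' hz')
    exact mem_reach_trans (mem_reach_trans h1 (hq z z' he)) h2
  have hcard : ∀ L, 0 < ((U L).card : ℝ) := fun L => by
    have : 0 < 2 ^ L := by positivity
    exact_mod_cast this.trans_le (hU L)
  obtain ⟨Y, hYdef⟩ : ∃ Y : ℕ → Ω → ℝ, ∀ L, Y L = fun s => ((U L).card : ℝ)⁻¹ *
      ∑ x ∈ U L, hopMoment (M.cutNbhd (A L)) (M.pot lam fun y => ω y s) p x :=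
    ⟨_, fun L => rfl⟩
  have hYm : ∀ L, MemLp (Y L) 2 P := fun L => by
    rw [hYdef]
    have h : MemLp (fun s => ∑ x ∈ U L,
        hopMoment (M.cutNbhd (A L)) (M.pot lam fun y => ω y s) p x) 2 P :=
      memLp_finsetSum (U L) fun x _ => hXL L x
    exact h.const_mul _
  have hYint : ∀ L, ∫ s, Y L s ∂P = ((U L).card : ℝ)⁻¹ *
      ∑ x ∈ U L, ∫ s', hopMoment (M.cutNbhd (A L)) (M.pot lam fun y => ω y s') p x ∂P := fun L => by
    simp_rw [hYdef]
    rw [integral_const_mul, integral_finsetSum _ fun x _ => hint L x]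
  have hsum : Summable fun L : ℕ => (1 / 2 : ℝ) ^ L * (D * (2 * B) ^ 2) :=
    (summable_geometric_of_lt_one (by norm_num) (by norm_num)).mul_right _
  have hvar : ∀ L, Var[Y L; P] ≤ (1 / 2 : ℝ) ^ L * (D * (2 * B) ^ 2) := fun L => by
    have h1 := variance_sum_le_of_local (P := P) (hX L) (hB L) (U L) (reach M.nbhd (p + q + p)) hD (hindep L)
    -- The variance of the average is `O(1 / |U L|)`, and `|U L| ≥ 2 ^ L`.
    rw [hYdef, variance_const_mul]
    have h2 : ((2 : ℝ) ^ L) ≤ (U L).card := by exact_mod_cast hU L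
    calc (((U L).card : ℝ)⁻¹) ^ 2 * Var[fun s => ∑ x ∈ U L,
          hopMoment (M.cutNbhd (A L)) (M.pot lam fun y => ω y s) p x; P]
        ≤ (((U L).card : ℝ)⁻¹) ^ 2 * ((U L).card * (D * (2 * B) ^ 2)) := by
          gcongr
      _ = ((U L).card : ℝ)⁻¹ * (D * (2 * B) ^ 2) := by
          have := (hcard L).ne'
          field_simp
      _ ≤ (1 / 2 : ℝ) ^ L * (D * (2 * B) ^ 2) := by
          rw [one_div, inv_pow]
          gcongr
  filter_upwards [ae_tendsto_sub_integral hYm hsum hvar] with s hs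
  simp_rw [hYint] at hs
  simpa only [hYdef] using hs

end SiteModel

end LawOfLargeNumbers

/-! ### Distances in trees from a parent map and a height function. -/

section ParentMap

variable {V : Type*} {G : SimpleGraph V} {π : V → V} {h : V → ℤ}

/-- Along a walk the height drops by at most the length, with equality only if each step goes to the
parent. -/
theorem height_le_of_walk
    (hadj : ∀ x y, G.Adj x y → (y = π x ∧ h x = h y + 1) ∨ (x = π y ∧ h y = h x + 1)) {x y : V}
    (w : G.Walk x y) :
    h x ≤ h y + w.length ∧ (h x = h y + w.length → π^[w.length] x = y) := by
  induction w with
  | nil => simp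
  | cons hxu p ih =>
    rw [SimpleGraph.Walk.length_cons]
    push_cast
    rcases hadj _ _ hxu with ⟨h1, h2⟩ | ⟨h1, h2⟩
    · refine ⟨by linarith [ih.1], fun h3 => ?_⟩
      rw [Function.iterate_succ_apply, ← h1]
      exact ih.2 (by linarith)
    · exact ⟨by linarith [ih.1], fun h3 => by linarith [ih.1]⟩

theorem height_le_add_dist (hG : G.Connected)
    (hadj : ∀ x y, G.Adj x y → (y = π x ∧ h x = h y + 1) ∨ (x = π y ∧ h y = h x + 1)) (x y : V) :
    h x ≤ h y + G.dist y x := by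
  obtain ⟨w, hw⟩ := hG.exists_walk_length_eq_dist x y
  rw [SimpleGraph.dist_comm, ← hw]
  exact (height_le_of_walk hadj w).1

/-- The equality case for a shortest walk: a height drop equal to the distance forces every step to
go to the parent. It identifies the `y` whose block contains `x` as an ancestor of `x`. -/
theorem iterate_dist_eq (hG : G.Connected)
    (hadj : ∀ x y, G.Adj x y → (y = π x ∧ h x = h y + 1) ∨ (x = π y ∧ h y = h x + 1)) {x y : V}
    (hxy : h x = h y + G.dist y x) : π^[G.dist y x] x = y := by
  obtain ⟨w, hw⟩ := hG.exists_walk_length_eq_dist x y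
  rw [SimpleGraph.dist_comm, ← hw] at hxy ⊢
  exact (height_le_of_walk hadj w).2 hxy

theorem reachable_iterate {x : V} (k : ℕ) (hk : ∀ i < k, G.Adj (π^[i] x) (π^[i + 1] x)) :
    ∃ w : G.Walk x (π^[k] x), w.length = k := by
  induction k with
  | zero => exact ⟨SimpleGraph.Walk.nil, rfl⟩
  | succ k ih =>
    obtain ⟨w, hw⟩ := ih fun i hi => hk i (by omega)
    exact ⟨w.concat (hk k (by omega)), by rw [SimpleGraph.Walk.length_concat, hw]⟩

/-- The ascending path bounds the distance from above, the height difference from below. -/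
theorem dist_iterate_eq (hG : G.Connected)
    (hadj : ∀ x y, G.Adj x y → (y = π x ∧ h x = h y + 1) ∨ (x = π y ∧ h y = h x + 1)) {x : V} (k : ℕ)
    (hk : ∀ i < k, G.Adj (π^[i] x) (π^[i + 1] x)) (hh : h x = h (π^[k] x) + k) :
    G.dist (π^[k] x) x = k := by
  obtain ⟨w, hw⟩ := reachable_iterate k hk
  have h1 := SimpleGraph.dist_le w
  have h2 := height_le_add_dist hG hadj x (π^[k] x)
  rw [SimpleGraph.dist_comm] at h1
  omega

end ParentMap

/-! ### The Bethe lattice and its blocks. -/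

namespace BetheVertex

variable {K : ℕ}

/-- The distance to the root. -/
def depth : BetheVertex K → ℕ
  | root => 0
  | node _ w => w.length + 1

/-- The neighbour closer to the root (the root itself for the root). -/
def parent : BetheVertex K → BetheVertex K
  | root => root
  | node _ [] => root
  | node i (_ :: w) => node i w

theorem depth_parent (x : BetheVertex K) : x.parent.depth = x.depth - 1 := by
  rcases x with _ | ⟨i, _ | ⟨j, w⟩⟩ <;> simp [parent, depth]

theorem depth_iterate_parent (k : ℕ) (x : BetheVertex K) :
    (parent^[k] x).depth = x.depth - k := by
  induction k generalizing x with
  | zero => simp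
  | succ k ih => rw [Function.iterate_succ_apply, ih, depth_parent]; omega

theorem eq_root_of_depth {x : BetheVertex K} (h : x.depth = 0) : x = root := by
  cases x <;> simp_all [depth]

theorem betheChild_iff {x y : BetheVertex K} : BetheChild x y ↔ x = y.parent ∧ 0 < y.depth := by
  constructor
  · rintro (_ | _) <;> simp [parent, depth]
  · rintro ⟨h1, h2⟩
    rcases y with _ | ⟨i, _ | ⟨j, w⟩⟩
    · simp [depth] at h2
    · subst h1; exact BetheChild.first i
    · subst h1; exact BetheChild.next i w j

theorem betheGraph_adj {x y : BetheVertex K} :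
    (betheGraph K).Adj x y ↔ (y = x.parent ∧ 0 < x.depth) ∨ (x = y.parent ∧ 0 < y.depth) := by
  rw [betheGraph, SimpleGraph.fromRel_adj, betheChild_iff, betheChild_iff]
  constructor
  · rintro ⟨_, h | h⟩
    · exact Or.inr h
    · exact Or.inl h
  · rintro (h | h)
    · refine ⟨?_, Or.inr h⟩
      rintro rfl
      have := depth_parent x
      rw [← h.1] at this
      omega
    · refine ⟨?_, Or.inl h⟩
      rintro rfl
      have := depth_parent x
      rw [← h.1] at this
      omega

theorem betheGraph_adj_height (x y : BetheVertex K) (h : (betheGraph K).Adj x y) :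
    (y = x.parent ∧ (x.depth : ℤ) = y.depth + 1) ∨ (x = y.parent ∧ (y.depth : ℤ) = x.depth + 1) := by
  rcases betheGraph_adj.1 h with ⟨rfl, h⟩ | ⟨rfl, h⟩
  · left
    have := depth_parent x
    exact ⟨rfl, by omega⟩
  · right
    have := depth_parent y
    exact ⟨rfl, by omega⟩

theorem betheGraph_adj_iterate {x : BetheVertex K} {k : ℕ} (hk : k ≤ x.depth) (i : ℕ) (hi : i < k) :
    (betheGraph K).Adj (parent^[i] x) (parent^[i + 1] x) := by
  rw [Function.iterate_succ_apply']
  refine betheGraph_adj.2 (Or.inl ⟨rfl, ?_⟩)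
  rw [depth_iterate_parent]
  omega

theorem iterate_parent_depth (x : BetheVertex K) : parent^[x.depth] x = root :=
  eq_root_of_depth (by rw [depth_iterate_parent]; omega)

theorem betheGraph_connected : (betheGraph K).Connected := by
  have : Nonempty (BetheVertex K) := ⟨root⟩
  refine SimpleGraph.Connected.mk fun x y => ?_
  have h : ∀ x, (betheGraph K).Reachable x root := fun x => by
    obtain ⟨w, -⟩ := reachable_iterate x.depth (betheGraph_adj_iterate (le_refl x.depth))
    rw [iterate_parent_depth] at w
    exact ⟨w⟩
  exact (h x).trans (h y).symm

theorem dist_iterate_parent {x : BetheVertex K} {k : ℕ} (hk : k ≤ x.depth) :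
    (betheGraph K).dist (parent^[k] x) x = k :=
  dist_iterate_eq (h := fun x => (x.depth : ℤ)) betheGraph_connected betheGraph_adj_height k
    (betheGraph_adj_iterate hk) (by rw [depth_iterate_parent]; omega)

theorem dist_root (x : BetheVertex K) : (betheGraph K).dist root x = x.depth := by
  have := dist_iterate_parent (le_refl x.depth)
  rwa [iterate_parent_depth] at this

theorem mem_betheBall {L : ℕ} {x : BetheVertex K} : x ∈ betheBall K L ↔ x.depth ≤ L := by
  rw [betheBall, Set.mem_ofPred_eq, dist_root]

theorem mem_betheSites {m₀ : ℕ} {x : BetheVertex K} :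
    x ∈ betheSites K m₀ ↔ ∃ k, x.depth = (m₀ + 1) * k := by
  rw [betheSites, Set.mem_ofPred_eq, dist_root]

theorem site_mem (m₀ : ℕ) (x : BetheVertex K) :
    parent^[x.depth % (m₀ + 1)] x ∈ betheSites K m₀ := by
  refine mem_betheSites.2 ⟨x.depth / (m₀ + 1), ?_⟩
  rw [depth_iterate_parent]
  have := Nat.div_add_mod x.depth (m₀ + 1)
  omega

/-- A site has depth divisible by `m₀ + 1`, and a block has height at most `m₀`, so the distance
from `x` up to its site must be the remainder of its depth. In particular the blocks form a
partition. -/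
theorem mem_betheBlock {m₀ : ℕ} (x : BetheVertex K) (y : betheSites K m₀) :
    x ∈ betheBlock K m₀ y ↔ y = ⟨parent^[x.depth % (m₀ + 1)] x, site_mem m₀ x⟩ := by
  obtain ⟨y, hy⟩ := y
  rw [betheBlock, Set.mem_ofPred_eq, dist_root, dist_root, Subtype.mk.injEq]
  constructor
  · rintro ⟨h1, h2⟩
    have h3 := iterate_dist_eq (h := fun x : BetheVertex K => (x.depth : ℤ)) betheGraph_connected
      betheGraph_adj_height (x := x) (y := y) (by exact_mod_cast h2)
    obtain ⟨k, hk⟩ := mem_betheSites.1 hy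
    have h4 : x.depth % (m₀ + 1) = (betheGraph K).dist y x := by
      rw [h2, hk, Nat.mul_add_mod, Nat.mod_eq_of_lt (by omega)]
    rw [h4]
    exact h3.symm
  · rintro rfl
    have h1 := Nat.mod_le x.depth (m₀ + 1)
    have h2 := Nat.mod_lt x.depth (show 0 < m₀ + 1 by omega)
    rw [dist_iterate_parent h1, depth_iterate_parent]
    omega

open Classical in
/-- The neighbours of a vertex. -/
def nbhd : BetheVertex K → Finset (BetheVertex K)
  | root => Finset.univ.image fun i => node i []
  | node i w => insert (node i w).parent (Finset.univ.image fun j => node i (j :: w))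

theorem mem_nbhd (x y : BetheVertex K) : y ∈ x.nbhd ↔ (betheGraph K).Adj x y := by
  classical
  rw [betheGraph_adj]
  rcases x with _ | ⟨i, w⟩
  · simp only [nbhd, Finset.mem_image, Finset.mem_univ, true_and]
    rcases y with _ | ⟨i', _ | ⟨j', w'⟩⟩ <;> simp [parent, depth]
  · simp only [nbhd, Finset.mem_insert, Finset.mem_image, Finset.mem_univ, true_and]
    rcases y with _ | ⟨i', _ | ⟨j', w'⟩⟩ <;> simp [parent, depth]

theorem card_nbhd_le (x : BetheVertex K) : x.nbhd.card ≤ K + 1 := by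
  classical
  rcases x with _ | ⟨i, w⟩
  · exact Finset.card_image_le.trans (by simp)
  · refine (Finset.card_insert_le _ _).trans ?_
    have : (Finset.univ.image fun j : Fin K => node i (j :: w)).card ≤ K :=
      Finset.card_image_le.trans (by simp)
    omega

end BetheVertex

/-- The Bethe lattice with its partition into blocks. -/
def betheModel (K m₀ : ℕ) : SiteModel (betheGraph K) (betheSites K m₀) (betheBlock K m₀) where
  nbhd := BetheVertex.nbhd
  mem_nbhd := BetheVertex.mem_nbhd
  deg := K + 1
  card_nbhd_le := BetheVertex.card_nbhd_le
  site x := ⟨BetheVertex.parent^[x.depth % (m₀ + 1)] x, BetheVertex.site_mem m₀ x⟩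
  mem_block := BetheVertex.mem_betheBlock

/-! ### The canopy tree and its blocks. -/

section Canopy

variable {K : ℕ}

/-- The neighbour in the next layer. -/
def canopyParent (K : ℕ) (x : CanopyVertex) : CanopyVertex := (x.1 + 1, x.2 / K)

theorem canopyParent_iterate (k : ℕ) (x : CanopyVertex) :
    (canopyParent K)^[k] x = (x.1 + k, x.2 / K ^ k) := by
  induction k generalizing x with
  | zero => simp
  | succ k ih =>
    rw [Function.iterate_succ_apply, ih, canopyParent, Nat.div_div_eq_div_mul, pow_succ']
    simp only [Prod.mk.injEq, and_true]
    omega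

theorem canopyGraph_adj {x y : CanopyVertex} :
    (canopyGraph K).Adj x y ↔ y = canopyParent K x ∨ x = canopyParent K y := by
  rw [canopyGraph, SimpleGraph.fromRel_adj]
  refine ⟨fun h => h.2, fun h => ⟨?_, h⟩⟩
  rintro rfl
  have h1 : x.1 = x.1 + 1 := by
    rcases h with h | h <;> exact congrArg Prod.fst h
  omega

theorem canopyGraph_adj_height (x y : CanopyVertex) (h : (canopyGraph K).Adj x y) :
    (y = canopyParent K x ∧ (-x.1 : ℤ) = -y.1 + 1) ∨
      (x = canopyParent K y ∧ (-y.1 : ℤ) = -x.1 + 1) := by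
  rcases canopyGraph_adj.1 h with rfl | rfl
  · exact Or.inl ⟨rfl, by simp [canopyParent]⟩
  · exact Or.inr ⟨rfl, by simp [canopyParent]⟩

theorem canopyGraph_adj_iterate (x : CanopyVertex) (i : ℕ) :
    (canopyGraph K).Adj ((canopyParent K)^[i] x) ((canopyParent K)^[i + 1] x) := by
  rw [Function.iterate_succ_apply']
  exact canopyGraph_adj.2 (Or.inl rfl)

theorem canopyGraph_connected (hK : 2 ≤ K) : (canopyGraph K).Connected := by
  refine SimpleGraph.Connected.mk fun x y => ?_
  -- Each passage to the parent divides the index by `K`, so every line of ancestors ends up at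
  -- index `0`.
  have h : ∀ (x : CanopyVertex) (N : ℕ), x.1 + x.2 ≤ N → (canopyGraph K).Reachable x (N, 0) := by
    intro x N hN
    obtain ⟨w, -⟩ := reachable_iterate (G := canopyGraph K) (x := x) (N - x.1)
      fun i _ => canopyGraph_adj_iterate x i
    have h1 : x.2 < K ^ (N - x.1) :=
      calc x.2 ≤ N - x.1 := by omega
        _ < K ^ (N - x.1) := Nat.lt_pow_self (by omega)
    rw [canopyParent_iterate, Nat.div_eq_of_lt h1, Nat.add_sub_cancel' (by omega)] at w
    exact ⟨w⟩
  exact (h x (x.1 + x.2 + (y.1 + y.2)) (by omega)).trans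
    (h y (x.1 + x.2 + (y.1 + y.2)) (by omega)).symm

theorem canopy_dist_iterate (hK : 2 ≤ K) (x : CanopyVertex) (k : ℕ) :
    (canopyGraph K).dist ((canopyParent K)^[k] x) x = k :=
  dist_iterate_eq (h := fun x : CanopyVertex => (-x.1 : ℤ)) (canopyGraph_connected hK)
    canopyGraph_adj_height k (fun i _ => canopyGraph_adj_iterate x i)
    (by simp only [canopyParent_iterate]; push_cast; ring)

theorem canopyBoundaryDist_eq (hK : 2 ≤ K) (x : CanopyVertex) : canopyBoundaryDist K x = x.1 := by
  rw [canopyBoundaryDist]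
  -- The witness is the leftmost descendant of `x` in layer `0`.
  refine le_antisymm (Nat.sInf_le ⟨(0, x.2 * K ^ x.1), rfl, ?_⟩) ?_
  · have h := canopy_dist_iterate hK (0, x.2 * K ^ x.1) x.1
    rw [canopyParent_iterate, Nat.mul_div_cancel _ (by positivity), zero_add] at h
    exact SimpleGraph.dist_comm.trans h
  · refine le_csInf ⟨_, (0, 0), rfl, rfl⟩ ?_
    rintro _ ⟨b, hb, rfl⟩
    have h1 := height_le_add_dist (h := fun x : CanopyVertex => (-x.1 : ℤ))
      (canopyGraph_connected hK) canopyGraph_adj_height b x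
    have h2 : b.1 = 0 := hb
    simp only [h2] at h1
    have h3 : (canopyGraph K).dist b x = (canopyGraph K).dist x b := SimpleGraph.dist_comm
    change x.1 ≤ (canopyGraph K).dist b x
    omega

theorem mem_canopySites (hK : 2 ≤ K) {m₀ : ℕ} {x : CanopyVertex} :
    x ∈ canopySites K m₀ ↔ ∃ k, x.1 = m₀ + (m₀ + 1) * k := by
  rw [canopySites, Set.mem_ofPred_eq, canopyBoundaryDist_eq hK]

theorem canopy_site_mem (hK : 2 ≤ K) (m₀ : ℕ) (x : CanopyVertex) :
    (canopyParent K)^[m₀ - x.1 % (m₀ + 1)] x ∈ canopySites K m₀ := by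
  refine (mem_canopySites hK).2 ⟨x.1 / (m₀ + 1), ?_⟩
  rw [canopyParent_iterate]
  have h1 := Nat.div_add_mod x.1 (m₀ + 1)
  have h2 := Nat.mod_lt x.1 (show 0 < m₀ + 1 by omega)
  dsimp only
  omega

/-- Sites lie in the layers congruent to `m₀` modulo `m₀ + 1`, which fixes the number of generations
from `x` up to its site. -/
theorem mem_canopyBlock (hK : 2 ≤ K) {m₀ : ℕ} (x : CanopyVertex) (y : canopySites K m₀) :
    x ∈ canopyBlock K m₀ y ↔
      y = ⟨(canopyParent K)^[m₀ - x.1 % (m₀ + 1)] x, canopy_site_mem hK m₀ x⟩ := by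
  obtain ⟨y, hy⟩ := y
  rw [canopyBlock, Set.mem_ofPred_eq, canopyBoundaryDist_eq hK, canopyBoundaryDist_eq hK,
    Subtype.mk.injEq, SimpleGraph.dist_comm (u := x)]
  have h5 := Nat.mod_lt x.1 (show 0 < m₀ + 1 by omega)
  constructor
  · rintro ⟨h1, h2⟩
    dsimp only at h1 h2
    have h3 := iterate_dist_eq (h := fun x : CanopyVertex => (-x.1 : ℤ)) (canopyGraph_connected hK)
      canopyGraph_adj_height (x := x) (y := y) (by rw [h2]; push_cast; ring)
    obtain ⟨k, hk⟩ := (mem_canopySites hK).1 hy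
    have h4 : m₀ - x.1 % (m₀ + 1) = (canopyGraph K).dist y x := by
      set d := (canopyGraph K).dist y x
      have h6 : x.1 = (m₀ - d) + (m₀ + 1) * k := by omega
      rw [h6, Nat.add_mul_mod_self_left, Nat.mod_eq_of_lt (by omega)]
      omega
    rw [h4]
    exact h3.symm
  · rintro rfl
    rw [canopy_dist_iterate hK]
    refine ⟨by omega, ?_⟩
    change ((canopyParent K)^[m₀ - x.1 % (m₀ + 1)] x).1 = _
    rw [canopyParent_iterate]

/-- The neighbours of a vertex. -/
def canopyNbhd (K : ℕ) (x : CanopyVertex) : Finset CanopyVertex :=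
  insert (canopyParent K x)
    (if x.1 = 0 then ∅ else (Finset.range K).image fun j => (x.1 - 1, K * x.2 + j))

theorem mem_canopyNbhd (hK : 2 ≤ K) (x y : CanopyVertex) :
    y ∈ canopyNbhd K x ↔ (canopyGraph K).Adj x y := by
  rw [canopyGraph_adj, canopyNbhd, Finset.mem_insert]
  refine or_congr Iff.rfl ?_
  obtain ⟨n, a⟩ := x
  obtain ⟨m, b⟩ := y
  simp only [canopyParent, Prod.mk.injEq]
  split_ifs with h0
  · simp [h0]
  · simp only [Finset.mem_image, Finset.mem_range, Prod.mk.injEq]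
    constructor
    · rintro ⟨j, hj, h1, rfl⟩
      refine ⟨by omega, ?_⟩
      rw [Nat.mul_add_div (by omega), Nat.div_eq_of_lt hj, add_zero]
    · rintro ⟨h1, h2⟩
      refine ⟨b % K, Nat.mod_lt _ (by omega), by omega, ?_⟩
      rw [h2]
      exact Nat.div_add_mod b K

theorem card_canopyNbhd_le (x : CanopyVertex) : (canopyNbhd K x).card ≤ K + 1 := by
  refine (Finset.card_insert_le _ _).trans ?_
  have : (if x.1 = 0 then ∅ else (Finset.range K).image fun j => (x.1 - 1, K * x.2 + j)).card
      ≤ K := by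
    split_ifs
    · simp
    · exact Finset.card_image_le.trans (by simp)
  omega

/-- The canopy tree with its partition into blocks. -/
def canopyModel (hK : 2 ≤ K) (m₀ : ℕ) :
    SiteModel (canopyGraph K) (canopySites K m₀) (canopyBlock K m₀) where
  nbhd := canopyNbhd K
  mem_nbhd := mem_canopyNbhd hK
  deg := K + 1
  card_nbhd_le := card_canopyNbhd_le
  site x := ⟨(canopyParent K)^[m₀ - x.1 % (m₀ + 1)] x, canopy_site_mem hK m₀ x⟩
  mem_block := mem_canopyBlock hK

end Canopy

/-! ### Embedding the cut-off Bethe lattice, away from its root, in the canopy tree. -/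

section Embedding

variable {K : ℕ}

/-- The position in its layer of the image of `node i w` under `canopyEmb`. -/
def canopyCode (f : Fin (K + 1) → ℕ) (σ : ℕ → Equiv.Perm (Fin K)) (i : Fin (K + 1)) :
    List (Fin K) → ℕ
  | [] => f i
  | j :: w => K * canopyCode f σ i w + σ w.length j

/-- A map from the ball of radius `L` in the Bethe lattice to the canopy tree which takes the sphere
of radius `L` to the boundary and is a local isomorphism away from the root. -/
def canopyEmb (L : ℕ) (f : Fin (K + 1) → ℕ) (σ : ℕ → Equiv.Perm (Fin K)) :
    BetheVertex K → CanopyVertex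
  | BetheVertex.root => (L, 0)
  | BetheVertex.node i w => (L - 1 - w.length, canopyCode f σ i w)

/-- The code of `w` uses `σ` only at levels below `w.length`, so the permutations can be chosen
level by level. -/
theorem canopyCode_update (f : Fin (K + 1) → ℕ) (σ : ℕ → Equiv.Perm (Fin K)) (i : Fin (K + 1))
    (w : List (Fin K)) {n : ℕ} (hn : w.length ≤ n) (τ : Equiv.Perm (Fin K)) :
    canopyCode f (Function.update σ n τ) i w = canopyCode f σ i w := by
  induction w with
  | nil => rfl
  | cons j w ih =>
    rw [List.length_cons] at hn
    rw [canopyCode, canopyCode, ih (by omega), Function.update_of_ne (by omega)]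

/-- A vertex can be sent to any index in its layer: at each level a transposition of the children
produces the required base-`K` digit, and a transposition of `ℕ` places the first step. -/
theorem exists_canopyCode_eq (hK : 2 ≤ K) (i : Fin (K + 1)) (w : List (Fin K)) (a : ℕ) :
    ∃ (f : Fin (K + 1) → ℕ) (σ : ℕ → Equiv.Perm (Fin K)), Function.Injective f ∧
      canopyCode f σ i w = a := by
  induction w generalizing a with
  | nil =>
    refine ⟨fun i' => Equiv.swap (i : ℕ) a i', fun _ => 1, fun i₁ i₂ h => ?_, ?_⟩
    · exact Fin.ext ((Equiv.swap (i : ℕ) a).injective h)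
    · exact Equiv.swap_apply_left _ _
  | cons j w ih =>
    obtain ⟨f, σ, hf, h⟩ := ih (a / K)
    have ha : a % K < K := Nat.mod_lt _ (by omega)
    refine ⟨f, Function.update σ w.length (Equiv.swap j ⟨a % K, ha⟩), hf, ?_⟩
    rw [canopyCode, canopyCode_update _ _ _ _ le_rfl, h, Function.update_self,
      Equiv.swap_apply_left]
    exact Nat.div_add_mod a K

variable {f : Fin (K + 1) → ℕ} {σ : ℕ → Equiv.Perm (Fin K)} {L : ℕ}

theorem mul_add_fin_inj {a b : ℕ} {i j : Fin K} (h : K * a + i = K * b + j) : a = b ∧ i = j := by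
  have hK : 0 < K := i.pos
  have h1 := congrArg (· / K) h
  have h2 := congrArg (· % K) h
  simp only [Nat.mul_add_div hK, Nat.div_eq_of_lt i.2, Nat.div_eq_of_lt j.2, add_zero] at h1
  simp only [Nat.mul_add_mod, Nat.mod_eq_of_lt i.2, Nat.mod_eq_of_lt j.2] at h2
  exact ⟨h1, Fin.ext h2⟩

theorem canopyCode_injective (hf : Function.Injective f) {i i' : Fin (K + 1)} {w w' : List (Fin K)}
    (hl : w.length = w'.length) (h : canopyCode f σ i w = canopyCode f σ i' w') :
    i = i' ∧ w = w' := by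
  induction w generalizing w' with
  | nil =>
    obtain rfl := List.length_eq_zero_iff.1 hl.symm
    exact ⟨hf h, rfl⟩
  | cons j w ih =>
    rcases w' with _ | ⟨j', w'⟩
    · simp at hl
    · simp only [List.length_cons, Nat.add_right_cancel_iff] at hl
      rw [canopyCode, canopyCode, hl] at h
      obtain ⟨h1, h2⟩ := mul_add_fin_inj h
      obtain ⟨rfl, rfl⟩ := ih hl h1
      exact ⟨rfl, by rw [(σ _).injective h2]⟩

theorem canopyEmb_injOn (hf : Function.Injective f) {x y : BetheVertex K} (hx0 : 0 < x.depth)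
    (hxL : x.depth ≤ L) (hy0 : 0 < y.depth) (hyL : y.depth ≤ L)
    (h : canopyEmb L f σ x = canopyEmb L f σ y) : x = y := by
  rcases x with _ | ⟨i, w⟩
  · simp [BetheVertex.depth] at hx0
  rcases y with _ | ⟨i', w'⟩
  · simp [BetheVertex.depth] at hy0
  simp only [BetheVertex.depth] at hxL hyL
  simp only [canopyEmb, Prod.mk.injEq] at h
  obtain ⟨rfl, rfl⟩ := canopyCode_injective hf (by omega) h.2
  rfl

theorem canopyEmb_fst (x : BetheVertex K) : (canopyEmb L f σ x).1 = L - x.depth := by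
  rcases x with _ | ⟨i, w⟩
  · simp [canopyEmb, BetheVertex.depth]
  · simp only [canopyEmb, BetheVertex.depth]; omega

theorem canopyEmb_parent {x : BetheVertex K} (hx1 : 1 < x.depth) (hxL : x.depth ≤ L) :
    canopyEmb L f σ x.parent = canopyParent K (canopyEmb L f σ x) := by
  rcases x with _ | ⟨i, _ | ⟨j, w⟩⟩
  · simp [BetheVertex.depth] at hx1
  · simp [BetheVertex.depth] at hx1
  · have hK : 0 < K := j.pos
    simp only [BetheVertex.depth, List.length_cons] at hxL
    simp only [BetheVertex.parent, canopyEmb, canopyParent, canopyCode, List.length_cons,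
      Prod.mk.injEq]
    rw [Nat.mul_add_div hK, Nat.div_eq_of_lt (Fin.is_lt _)]
    omega

theorem canopyEmb_iterate_parent {x : BetheVertex K} (k : ℕ) (hk : k < x.depth)
    (hxL : x.depth ≤ L) :
    canopyEmb L f σ (BetheVertex.parent^[k] x) = (canopyParent K)^[k] (canopyEmb L f σ x) := by
  induction k with
  | zero => rfl
  | succ k ih =>
    rw [Function.iterate_succ_apply', Function.iterate_succ_apply', ← ih (by omega)]
    refine canopyEmb_parent ?_ ?_ <;> rw [BetheVertex.depth_iterate_parent] <;> omega

/-- Vertices at depth `L` have lost their children to the cut-off, just as layer `0` has none. Depth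
one is excluded because the `K + 1` children of the root have no common parent in the canopy tree.
-/
theorem canopyEmb_mem_nbhd {m₀ : ℕ} {x : BetheVertex K} (hx1 : 1 < x.depth) (hxL : x.depth ≤ L)
    (z : CanopyVertex) : z ∈ canopyNbhd K (canopyEmb L f σ x) ↔
      ∃ y ∈ (betheModel K m₀).cutNbhd (betheBall K L) x, canopyEmb L f σ y = z := by
  classical
  simp only [SiteModel.mem_cutNbhd, BetheVertex.mem_betheBall, canopyNbhd, Finset.mem_insert]
  rw [← canopyEmb_parent hx1 hxL]
  rcases x with _ | ⟨i, w⟩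
  · simp [BetheVertex.depth] at hx1
  have hnb : ∀ y, y ∈ (betheModel K m₀).nbhd (BetheVertex.node i w) ↔
      y = (BetheVertex.node i w).parent ∨ ∃ j, BetheVertex.node i (j :: w) = y := fun y => by
    change y ∈ BetheVertex.nbhd (BetheVertex.node i w) ↔ _
    simp [BetheVertex.nbhd]
  simp only [hnb]
  have hp := BetheVertex.depth_parent (BetheVertex.node i w)
  simp only [BetheVertex.depth] at hxL hx1
  constructor
  · rintro (rfl | h)
    · exact ⟨_, ⟨Or.inl rfl, by rw [hp]; simp only [BetheVertex.depth]; omega⟩, rfl⟩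
    · split_ifs at h with h0
      · simp at h
      · simp only [canopyEmb] at h0 h
        obtain ⟨j, hj, rfl⟩ := Finset.mem_image.1 h
        rw [Finset.mem_range] at hj
        refine ⟨BetheVertex.node i ((σ w.length).symm ⟨j, hj⟩ :: w), ⟨Or.inr ⟨_, rfl⟩, ?_⟩, ?_⟩
        · simp only [BetheVertex.depth, List.length_cons]; omega
        · simp only [canopyEmb, canopyCode, List.length_cons, Equiv.apply_symm_apply,
            Prod.mk.injEq, and_true]
          omega
  · rintro ⟨y, ⟨rfl | ⟨j, rfl⟩, hy⟩, rfl⟩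
    · exact Or.inl rfl
    · right
      simp only [BetheVertex.depth, List.length_cons] at hy
      rw [if_neg (by rw [canopyEmb_fst]; simp only [BetheVertex.depth]; omega)]
      simp only [canopyEmb]
      refine Finset.mem_image.2 ⟨σ w.length j, Finset.mem_range.2 (Fin.is_lt _), ?_⟩
      simp only [canopyCode, List.length_cons, Prod.mk.injEq, and_true]
      omega

theorem depth_le_of_mem_cutNbhd {m₀ : ℕ} {x y : BetheVertex K}
    (h : y ∈ (betheModel K m₀).cutNbhd (betheBall K L) x) :
    y.depth ≤ L ∧ x.depth ≤ y.depth + 1 := by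
  obtain ⟨h1, h2⟩ := (betheModel K m₀).mem_cutNbhd.1 h
  refine ⟨BetheVertex.mem_betheBall.1 h2, ?_⟩
  rcases BetheVertex.betheGraph_adj_height x y ((BetheVertex.mem_nbhd x y).1 h1) with h | h <;> omega

/-- The form of `L` turns the remainder `r` of the depth into the remainder `m₀ - r` of the layer,
so both sites lie `r` generations up. The block of the root is avoided by `m₀ < x.depth`. -/
theorem canopyEmb_site (hK : 2 ≤ K) {m₀ k : ℕ} (hL : L = m₀ + (m₀ + 1) * k) {x : BetheVertex K}
    (hx0 : m₀ < x.depth) (hxL : x.depth ≤ L) :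
    canopyEmb L f σ ((betheModel K m₀).site x)
      = ((canopyModel hK m₀).site (canopyEmb L f σ x) : CanopyVertex) := by
  change canopyEmb L f σ (BetheVertex.parent^[x.depth % (m₀ + 1)] x)
    = (canopyParent K)^[m₀ - (canopyEmb L f σ x).1 % (m₀ + 1)] (canopyEmb L f σ x)
  have h1 := Nat.mod_lt x.depth (show 0 < m₀ + 1 by omega)
  rw [canopyEmb_iterate_parent _ (by omega) hxL, canopyEmb_fst]
  congr 1
  have h4 := Nat.div_add_mod x.depth (m₀ + 1)
  have h5 : x.depth / (m₀ + 1) ≤ k := by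
    rw [Nat.div_le_iff_le_mul_add_pred (by omega)]
    simpa [add_comm] using hL ▸ hxL
  generalize x.depth % (m₀ + 1) = r at *
  generalize x.depth / (m₀ + 1) = q at *
  obtain ⟨j, rfl⟩ := Nat.exists_eq_add_of_le h5
  have h3 : L - x.depth = (m₀ - r) + (m₀ + 1) * j := by
    rw [Nat.mul_add] at hL
    omega
  rw [h3, Nat.add_mul_mod_self_left, Nat.mod_eq_of_lt (by omega)]
  omega

end Embedding

/-! ### Equality of mean moments on the two trees. -/

section MomentIdentity

variable {Ω Ω' : Type*} [MeasurableSpace Ω] [MeasurableSpace Ω'] {P : Measure Ω}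
  {P' : Measure Ω'} {K m₀ : ℕ}

/-- Away from the root, the mean diagonal matrix elements of powers of the cut-off operators agree
with those of the operator on the canopy tree. -/
theorem integral_hopMoment_bethe_eq_canopy (hK : 2 ≤ K) {lam : ℝ} {μ : Measure ℝ}
    {ω : betheSites K m₀ → Ω → ℝ} (hω_meas : ∀ y, Measurable (ω y)) (hω_indep : iIndepFun ω P)
    (hω_law : ∀ y, P.map (ω y) = μ)
    {η : canopySites K m₀ → Ω' → ℝ} (hη_meas : ∀ y, Measurable (η y)) (hη_indep : iIndepFun η P')
    (hη_law : ∀ y, P'.map (η y) = μ) {L k : ℕ} (hL : L = m₀ + (m₀ + 1) * k) {p : ℕ}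
    {x : BetheVertex K} (hxp : m₀ + p < x.depth) (hxL : x.depth ≤ L) {z : CanopyVertex}
    (hz : z.1 = L - x.depth) :
    ∫ s, hopMoment ((betheModel K m₀).cutNbhd (betheBall K L))
        ((betheModel K m₀).pot lam fun y => ω y s) p x ∂P
      = ∫ s, hopMoment (canopyModel hK m₀).nbhd
        ((canopyModel hK m₀).pot lam fun y => η y s) p z ∂P' := by
  classical
  obtain ⟨f, σ, hf, hfσ⟩ : ∃ (f : Fin (K + 1) → ℕ) (σ : ℕ → Equiv.Perm (Fin K)),
      Function.Injective f ∧ canopyEmb L f σ x = z := by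
    rcases x with _ | ⟨i, w⟩
    · simp [BetheVertex.depth] at hxp
    · obtain ⟨f, σ, hf, h⟩ := exists_canopyCode_eq hK i w z.2
      refine ⟨f, σ, hf, Prod.ext ?_ h⟩
      rw [canopyEmb_fst, hz]
  subst hfσ
  set M := betheModel K m₀ with hM
  set M' := canopyModel hK m₀ with hM'
  -- The sites carried to canopy sites by the embedding; the root is left out.
  let Q : betheSites K m₀ → Prop := fun y => 0 < (y : BetheVertex K).depth ∧
    (y : BetheVertex K).depth ≤ L
  have hθmem : ∀ y : betheSites K m₀, Q y → canopyEmb L f σ y ∈ canopySites K m₀ := by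
    rintro ⟨y, hy⟩ hQ
    obtain ⟨j, hj⟩ := BetheVertex.mem_betheSites.1 hy
    refine (mem_canopySites hK).2 ⟨k - j, ?_⟩
    have h1 : y.depth ≤ L := hQ.2
    rw [canopyEmb_fst]
    change L - y.depth = _
    have h5 : j ≤ k := by
      by_contra h
      have h6 := Nat.mul_le_mul_left (m₀ + 1) (show k + 1 ≤ j by omega)
      rw [Nat.mul_add] at h6
      omega
    have h6 := Nat.mul_le_mul_left (m₀ + 1) h5
    rw [Nat.mul_sub]
    omega
  let θ : {y // Q y} → canopySites K m₀ := fun y => ⟨canopyEmb L f σ y.1, hθmem y.1 y.2⟩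
  have hθ : Function.Injective θ := fun y y' h => by
    have h1 : canopyEmb L f σ y.1 = canopyEmb L f σ y'.1 := congrArg Subtype.val h
    exact Subtype.ext (Subtype.ext (canopyEmb_injOn hf y.2.1 y.2.2 y'.2.1 y'.2.2 h1))
  -- The default `0` is never seen: starting at depth above `m₀ + p`, the recursion evaluates the
  -- potential only at depths above `m₀`.
  let v : ({y // Q y} → ℝ) → BetheVertex K → ℝ := fun w u =>
    lam * if h : Q (M.site u) then w ⟨M.site u, h⟩ else 0
  let F : ({y // Q y} → ℝ) → ℝ := fun w => hopMoment (M.cutNbhd (betheBall K L)) (v w) p x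
  have hF : Measurable F := by
    refine measurable_hopMoment (fun u => ?_) p x
    by_cases h : Q (M.site u)
    · simp only [v, h, dite_true]
      exact Measurable.const_mul (f := fun w : {y // Q y} → ℝ => w ⟨M.site u, h⟩)
        (measurable_pi_apply _) lam
    · simp only [v, h, dite_false]
      exact measurable_const
  have hQ : ∀ u : BetheVertex K, m₀ < u.depth → u.depth ≤ L → Q (M.site u) := fun u h1 h2 => by
    have h3 : ((M.site u : betheSites K m₀) : BetheVertex K).depth
        = u.depth - u.depth % (m₀ + 1) := BetheVertex.depth_iterate_parent _ _
    have h4 := Nat.mod_lt u.depth (show 0 < m₀ + 1 by omega)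
    exact ⟨by omega, by omega⟩
  have hU : ∀ u : BetheVertex K, u.depth ≤ L → ∀ y ∈ M.cutNbhd (betheBall K L) u,
      y.depth ≤ L ∧ u.depth ≤ y.depth + 1 := fun u _ y hy => depth_le_of_mem_cutNbhd hy
  have hl : ∀ s, hopMoment (M.cutNbhd (betheBall K L)) (M.pot lam fun y => ω y s) p x
      = F fun y => ω y.1 s := fun s => by
    refine hop_iterate_transport (φ := id) (fun u => u.depth ≤ L) BetheVertex.depth m₀ hU
      (fun u _ _ => Set.injOn_id _) (fun u _ _ z => by simp) (fun u h1 h2 => ?_) (fun _ _ _ => rfl)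
      p x hxL hxp
    have := hQ u h2 h1
    simp [v, this, SiteModel.pot]
  have hr : ∀ s, hopMoment M'.nbhd (M'.pot lam fun y => η y s) p (canopyEmb L f σ x)
      = F fun y => η (θ y) s := fun s => by
    refine (hop_iterate_transport (φ := canopyEmb L f σ) (fun u => u.depth ≤ L) BetheVertex.depth m₀
      hU (fun u h1 h2 y hy y' hy' h => ?_) (fun u h1 h2 z => ?_) (fun u h1 h2 => ?_)
      (fun y h1 h2 => ?_) p x hxL hxp).symm
    · have h3 := hU u h1 y hy
      have h4 := hU u h1 y' hy'
      exact canopyEmb_injOn hf (by omega) h3.1 (by omega) h4.1 h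
    · exact canopyEmb_mem_nbhd (by omega) h1 z
    · have h3 := hQ u h2 h1
      simp only [v, h3, dite_true, SiteModel.pot]
      congr 3
      exact Subtype.ext (canopyEmb_site hK hL h2 h1)
    · have h : canopyEmb L f σ y = canopyEmb L f σ x ↔ y = x :=
        ⟨fun h3 => canopyEmb_injOn hf (by omega) h1 (by omega) hxL h3, fun h3 => h3 ▸ rfl⟩
      simp only [Pi.single_apply, h]
  -- Both moments are the same function `F` of i.i.d. families indexed by the same set, injectivity
  -- of `θ` preserving independence.
  have hlaw1 : P.map (fun s (y : {y // Q y}) => ω y.1 s) = Measure.infinitePi fun _ => μ := by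
    have h := (hω_indep.precomp (g := fun y : {y // Q y} => y.1)
      Subtype.val_injective).map_fun_eq_infinitePi_map
      fun y : {y // Q y} => hω_meas y.1
    rw [h]
    simp_rw [hω_law]
  have hlaw2 : P'.map (fun s (y : {y // Q y}) => η (θ y) s) = Measure.infinitePi fun _ => μ := by
    have h := (hη_indep.precomp hθ).map_fun_eq_infinitePi_map fun y => hη_meas (θ y)
    rw [h]
    simp_rw [hη_law]
  simp_rw [hl, hr]
  rw [← integral_map (f := F) (measurable_pi_iff.2 fun y : {y // Q y} => hω_meas y.1).aemeasurable
      hF.aestronglyMeasurable, hlaw1, ← hlaw2, integral_map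
      (measurable_pi_iff.2 fun y : {y // Q y} => hη_meas (θ y)).aemeasurable
      hF.aestronglyMeasurable]

end MomentIdentity

/-! ### Sizes of spheres and balls, and averages over balls. -/

namespace BetheVertex

variable {K : ℕ}

instance : Countable (BetheVertex K) := by
  let e : BetheVertex K → Option (Fin (K + 1) × List (Fin K)) := fun x => match x with
    | root => none
    | node i w => some (i, w)
  refine Function.Injective.countable (f := e) fun x y h => ?_
  cases x <;> cases y <;> simp_all [e]

open Classical in
/-- The vertices at distance `d` from the root. -/
def sphere (K : ℕ) : ℕ → Finset (BetheVertex K)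
  | 0 => {root}
  | d + 1 => (Finset.univ : Finset (Fin (K + 1) × List.Vector (Fin K) d)).image
      fun a => node a.1 a.2.1

theorem mem_sphere {d : ℕ} {x : BetheVertex K} : x ∈ sphere K d ↔ x.depth = d := by
  classical
  rcases d with _ | d
  · rw [sphere, Finset.mem_singleton]
    exact ⟨fun h => h ▸ rfl, eq_root_of_depth⟩
  · rw [sphere, Finset.mem_image]
    constructor
    · rintro ⟨⟨i, w, hw⟩, -, rfl⟩
      simp [depth, hw]
    · intro h
      rcases x with _ | ⟨i, w⟩
      · simp [depth] at h
      · exact ⟨(i, ⟨w, by simpa [depth] using h⟩), Finset.mem_univ _, rfl⟩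

theorem card_sphere_succ (d : ℕ) : (sphere K (d + 1)).card = (K + 1) * K ^ d := by
  classical
  rw [sphere, Finset.card_image_of_injective]
  · simp
  · rintro ⟨i, w⟩ ⟨i', w'⟩ h
    simp only [node.injEq] at h
    exact Prod.ext h.1 (Subtype.ext h.2)

/-- Every vertex has at least `K` children, with one more at the root. This supplies the geometric
domination in averages over balls. -/
theorem card_sphere_mul_le (d n : ℕ) : (sphere K d).card * K ^ n ≤ (sphere K (d + n)).card := by
  rcases n with _ | n
  · simp
  rcases d with _ | d
  · rw [zero_add, card_sphere_succ, pow_succ']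
    simp only [sphere, Finset.card_singleton, one_mul]
    gcongr
    omega
  · rw [add_right_comm, card_sphere_succ, card_sphere_succ, mul_assoc, ← pow_add]

open Classical in
/-- The vertices at distance at most `L` from the root. -/
def ball (K L : ℕ) : Finset (BetheVertex K) := (Finset.range (L + 1)).biUnion (sphere K)

theorem mem_ball {L : ℕ} {x : BetheVertex K} : x ∈ ball K L ↔ x.depth ≤ L := by
  classical
  simp [ball, mem_sphere]

theorem coe_ball (L : ℕ) : (ball K L : Set (BetheVertex K)) = betheBall K L := by
  ext x
  rw [Finset.mem_coe, mem_ball, mem_betheBall]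

theorem sum_ball {M : Type*} [AddCommMonoid M] (L : ℕ) (E : BetheVertex K → M) :
    ∑ x ∈ ball K L, E x = ∑ d ∈ Finset.range (L + 1), ∑ x ∈ sphere K d, E x := by
  classical
  refine Finset.sum_biUnion fun d _ d' _ h => Finset.disjoint_left.2 fun x hx hx' => h ?_
  rw [← mem_sphere.1 hx, ← mem_sphere.1 hx']

theorem card_ball (L : ℕ) :
    (ball K L).card = ∑ d ∈ Finset.range (L + 1), (sphere K d).card := by
  simp only [Finset.card_eq_sum_ones]
  exact sum_ball L fun _ => 1

theorem card_ball_mul (L : ℕ) :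
    ((ball K (L + 1)).card : ℝ) * (K - 1) = K * (sphere K (L + 1)).card - 2 := by
  induction L with
  | zero =>
    rw [card_ball, Finset.sum_range_succ, Finset.sum_range_one, card_sphere_succ]
    simp [sphere]
    ring
  | succ L ih =>
    rw [card_ball, Finset.sum_range_succ, ← card_ball]
    push_cast
    rw [add_mul, ih, card_sphere_succ, card_sphere_succ]
    push_cast
    ring

theorem card_sphere_le_card_ball (L : ℕ) : (sphere K L).card ≤ (ball K L).card :=
  Finset.card_le_card fun _ hx => mem_ball.2 (mem_sphere.1 hx).le

theorem pow_le_card_sphere (hK : 2 ≤ K) (L : ℕ) : 2 ^ L ≤ (sphere K L).card := by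
  have h := card_sphere_mul_le (K := K) 0 L
  simp only [sphere, Finset.card_singleton, one_mul, zero_add] at h
  exact (Nat.pow_le_pow_left hK L).trans h

theorem pow_le_card_ball (hK : 2 ≤ K) (L : ℕ) : 2 ^ L ≤ (ball K L).card :=
  (pow_le_card_sphere hK L).trans (card_sphere_le_card_ball L)

theorem tendsto_card_ball_div_card_sphere (hK : 2 ≤ K) :
    Tendsto (fun L => ((ball K L).card : ℝ)⁻¹ * (sphere K L).card) atTop (𝓝 (((K : ℝ) - 1) / K)) := by
  have hK' : (0 : ℝ) < (K : ℝ) - 1 := by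
    have : (2 : ℝ) ≤ K := by exact_mod_cast hK
    linarith
  have h1 : Tendsto (fun L => ((sphere K L).card : ℝ)) atTop atTop := by
    refine tendsto_atTop_mono (fun L => ?_) (tendsto_pow_atTop_atTop_of_one_lt one_lt_two)
    exact_mod_cast pow_le_card_sphere hK L
  have h2 : Tendsto (fun L => ((K : ℝ) - 2 * ((sphere K L).card : ℝ)⁻¹) / (K - 1)) atTop
      (𝓝 (((K : ℝ) - 2 * 0) / (K - 1))) :=
    ((tendsto_inv_atTop_zero.comp h1).const_mul 2).const_sub _ |>.div_const _
  rw [mul_zero, sub_zero] at h2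
  have h3 := h2.inv₀ (by have : (0 : ℝ) < K := by linarith
                         positivity)
  rw [inv_div] at h3
  refine h3.congr' ?_
  filter_upwards [eventually_ge_atTop 1] with L hL
  obtain ⟨L, rfl⟩ := Nat.exists_eq_add_of_le' hL
  have h4 := card_ball_mul (K := K) L
  have h5 : (0 : ℝ) < (sphere K (L + 1)).card := by
    exact_mod_cast (pow_pos two_pos _).trans_le (pow_le_card_sphere hK (L + 1))
  rw [← inv_inv (((sphere K (L + 1)).card : ℝ)), ← mul_inv, inv_inv]
  congr 1
  field_simp
  linarith

theorem tendsto_card_sphere (hK : 2 ≤ K) (n : ℕ) :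
    Tendsto (fun L => ((ball K L).card : ℝ)⁻¹ * (sphere K (L - n)).card) atTop
      (𝓝 (((K : ℝ) - 1) / K * ((K : ℝ) ^ n)⁻¹)) := by
  refine ((tendsto_card_ball_div_card_sphere hK).mul_const _).congr' ?_
  filter_upwards [eventually_ge_atTop (n + 1)] with L hL
  obtain ⟨L, rfl⟩ := Nat.exists_eq_add_of_le' hL
  have hK0 : (K : ℝ) ≠ 0 := by
    have : K ≠ 0 := by omega
    exact_mod_cast this
  rw [show L + (n + 1) - n = L + 1 by omega, show L + (n + 1) = L + n + 1 by omega,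
    card_sphere_succ, card_sphere_succ]
  push_cast
  rw [pow_add]
  field_simp

/-- Averages over balls of functions which, away from the root, depend only on the distance to the
boundary of the ball. -/
theorem tendsto_average_ball (hK : 2 ≤ K) {F : Filter ℕ} (hF : F ≤ atTop)
    {E : ℕ → BetheVertex K → ℝ} {C : ℝ} (hE : ∀ L x, |E L x| ≤ C) {g : ℕ → ℝ}
    (hg : ∀ n, ∀ᶠ L in F, ∀ x : BetheVertex K, x.depth + n = L → E L x = g n) :
    Tendsto (fun L => ((ball K L).card : ℝ)⁻¹ * ∑ x ∈ ball K L, E L x) F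
      (𝓝 (((K : ℝ) - 1) / K * ∑' n, ((K : ℝ) ^ n)⁻¹ * g n)) := by
  have hK2 : (2 : ℝ) ≤ K := by exact_mod_cast hK
  have hC : 0 ≤ C := (abs_nonneg _).trans (hE 0 root)
  -- The sum is indexed by the distance `n` to the boundary sphere; the terms are dominated by `C
  -- K^{-n}` uniformly in `L`.
  let f : ℕ → ℕ → ℝ := fun L n =>
    if n < L + 1 then ((ball K L).card : ℝ)⁻¹ * ∑ x ∈ sphere K (L - n), E L x else 0
  have hf : ∀ L, ((ball K L).card : ℝ)⁻¹ * ∑ x ∈ ball K L, E L x = ∑' n, f L n := fun L => by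
    rw [tsum_eq_sum (s := Finset.range (L + 1))
      fun n hn => if_neg fun h => hn (Finset.mem_range.2 h), sum_ball,
      ← Finset.sum_range_reflect, Finset.mul_sum]
    refine Finset.sum_congr rfl fun n hn => ?_
    simp only [if_pos (Finset.mem_range.1 hn)]
    congr 3
  simp_rw [hf, ← tsum_mul_left, ← mul_assoc]
  refine tendsto_tsum_of_dominated_convergence (bound := fun n => C * ((K : ℝ)⁻¹) ^ n)
    ?_ (fun n => ?_) (Eventually.of_forall fun L n => ?_)
  · exact (summable_geometric_of_lt_one (by positivity)
      (inv_lt_one_of_one_lt₀ (by linarith))).mul_left C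
  · refine (((tendsto_card_sphere hK n).mono_left hF).mul_const (g n)).congr' ?_
    filter_upwards [hg n, hF (eventually_ge_atTop n)] with L hL hn
    simp only [f, if_pos (Nat.lt_succ_of_le hn)]
    rw [Finset.sum_congr rfl fun x hx => hL x (by rw [mem_sphere.1 hx]; omega), Finset.sum_const,
      nsmul_eq_mul, mul_assoc]
  · simp only [f]
    split_ifs with h
    · have h1 : ‖∑ x ∈ sphere K (L - n), E L x‖ ≤ (sphere K (L - n)).card * C := by
        refine (norm_sum_le _ _).trans ?_
        rw [← nsmul_eq_mul]
        exact Finset.sum_le_card_nsmul _ _ _ fun x _ => hE L x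
      have h2 : ((sphere K (L - n)).card : ℝ) * K ^ n ≤ (ball K L).card := by
        have := card_sphere_mul_le (K := K) (L - n) n
        rw [Nat.sub_add_cancel (by omega)] at this
        exact_mod_cast this.trans (card_sphere_le_card_ball L)
      have h3 : (0 : ℝ) < (ball K L).card := by
        exact_mod_cast (pow_pos two_pos _).trans_le (pow_le_card_ball hK L)
      rw [norm_mul, norm_inv, Real.norm_natCast, inv_pow, inv_mul_le_iff₀ h3]
      refine h1.trans ?_
      rw [mul_comm _ C, mul_left_comm]
      gcongr
      rw [← div_eq_mul_inv, le_div_iff₀ (by positivity)]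
      exact h2
    · rw [norm_zero]; positivity

theorem iterate_parent_mem_reach (m₀ : ℕ) (x : BetheVertex K) {k : ℕ} (hk : k ≤ x.depth) :
    parent^[k] x ∈ reach (betheModel K m₀).nbhd k x := by
  induction k with
  | zero => exact self_mem_reach _ _ _
  | succ k ih =>
    refine mem_reach_trans (ih (by omega)) (mem_reach_one ?_)
    exact (mem_nbhd _ _).2 (betheGraph_adj_iterate hk k (by omega))

/-- Vertices in the same block are at distance at most `2 m₀`. -/
theorem mem_reach_of_site_eq {m₀ : ℕ} {x x' : BetheVertex K}
    (h : (betheModel K m₀).site x = (betheModel K m₀).site x') :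
    x' ∈ reach (betheModel K m₀).nbhd (m₀ + m₀) x := by
  have h1 : ∀ x : BetheVertex K,
      ((betheModel K m₀).site x : BetheVertex K) ∈ reach (betheModel K m₀).nbhd m₀ x := fun x =>
    reach_subset_of_le _ (Nat.lt_succ_iff.1 (Nat.mod_lt _ (Nat.succ_pos m₀))) x
      (iterate_parent_mem_reach m₀ x (Nat.mod_le _ _))
  refine mem_reach_trans (h1 x) ?_
  rw [h]
  exact mem_reach_symm (betheModel K m₀).mem_nbhd_symm (h1 x')

end BetheVertex

/-! ### Countable mixtures of measures. -/

section Mixture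

variable {ι : Type*} {c : ι → ℝ} {m : ι → Measure ℝ}

/-- The mixture of the measures `m i` with weights `c i`. -/
def mixture (c : ι → ℝ) (m : ι → Measure ℝ) : Measure ℝ :=
  Measure.sum fun i => ENNReal.ofReal (c i) • m i

theorem isProbabilityMeasure_mixture [∀ i, IsProbabilityMeasure (m i)] (hc : ∀ i, 0 ≤ c i)
    (hc1 : HasSum c 1) : IsProbabilityMeasure (mixture c m) := by
  refine ⟨?_⟩
  rw [mixture, Measure.sum_apply _ MeasurableSet.univ]
  simp only [Measure.smul_apply, measure_univ, smul_eq_mul, mul_one]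
  rw [← ENNReal.ofReal_tsum_of_nonneg hc hc1.summable, hc1.tsum_eq, ENNReal.ofReal_one]

theorem mixture_real [∀ i, IsProbabilityMeasure (m i)] (hc : ∀ i, 0 ≤ c i) {B : Set ℝ}
    (hB : MeasurableSet B) : (mixture c m).real B = ∑' i, c i * (m i).real B := by
  rw [measureReal_def, mixture, Measure.sum_apply _ hB, ENNReal.tsum_toReal_eq fun i => by
    rw [Measure.smul_apply, smul_eq_mul]; finiteness]
  simp [measureReal_def, ENNReal.toReal_ofReal (hc _)]

theorem mixture_eq_zero {B : Set ℝ} (hB : MeasurableSet B) (h : ∀ i, m i B = 0) :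
    mixture c m B = 0 := by
  simp [mixture, Measure.sum_apply _ hB, h]

theorem mixture_absolutelyContinuous (h : ∀ i, m i ≪ volume) : mixture c m ≪ volume :=
  Measure.absolutelyContinuous_sum_left fun i => (h i).smul_left _

theorem integral_mixture (hc : ∀ i, 0 ≤ c i) {f : ℝ → ℝ} (hf : Integrable f (mixture c m)) :
    ∫ t, f t ∂(mixture c m) = ∑' i, c i * ∫ t, f t ∂(m i) := by
  rw [mixture, integral_sum_measure hf]
  simp [integral_smul_measure, ENNReal.toReal_ofReal (hc _)]

end Mixture

/-! ### The density of states measure and convergence of counting measures. -/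

section DensityOfStates

variable {Ω Ω' : Type*} [MeasurableSpace Ω] [MeasurableSpace Ω'] {P : Measure Ω}
  [IsProbabilityMeasure P] {P' : Measure Ω'} [IsProbabilityMeasure P'] {K m₀ : ℕ} {lam R : ℝ}

theorem canopyWeight_eq (K m₀ : ℕ) (lam : ℝ) (w : canopySites K m₀ → ℝ) (B : Set ℝ)
    (x : CanopyVertex) : canopyWeight K m₀ lam w B x
      = (spectralMeasure (canopyOperator K m₀ lam w) (delta x)).real B := by
  rw [canopyWeight, inner_spectralProjection, Complex.ofReal_re]

omit [IsProbabilityMeasure P'] in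
theorem canopyDOS_congr {η η' : canopySites K m₀ → Ω' → ℝ}
    (h : ∀ᵐ s ∂P', (fun y => η y s) = fun y => η' y s) {x : ℕ → CanopyVertex} {B : Set ℝ} :
    canopyDOS P' K m₀ lam η' x B = canopyDOS P' K m₀ lam η x B := by
  have h1 : ∀ n, ∫ s, canopyWeight K m₀ lam (fun y => η' y s) B (x n) ∂P'
      = ∫ s, canopyWeight K m₀ lam (fun y => η y s) B (x n) ∂P' := fun n =>
    integral_congr_ae (h.mono fun s hs => by
      simpa only using (congrArg (fun w => canopyWeight K m₀ lam w B (x n)) hs).symm)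
  simp only [canopyDOS, h1]

theorem hasSum_geometric_weights (hK : 2 ≤ K) :
    HasSum (fun n : ℕ => ((K : ℝ) - 1) / K * ((K : ℝ) ^ n)⁻¹) 1 := by
  have hK2 : (2 : ℝ) ≤ K := by exact_mod_cast hK
  have h := (hasSum_geometric_of_lt_one (r := (K : ℝ)⁻¹) (by positivity)
    (inv_lt_one_of_one_lt₀ (by linarith))).mul_left (((K : ℝ) - 1) / K)
  simp only [inv_pow] at h
  have h1 : (K : ℝ) - 1 ≠ 0 := by linarith
  have h2 : (K : ℝ) ≠ 0 := by linarith
  have h3 : 1 - (K : ℝ)⁻¹ = ((K : ℝ) - 1) / K := by field_simp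
  rwa [h3, mul_inv_cancel₀ (div_ne_zero h1 h2)] at h

theorem geometric_weights_nonneg (hK : 2 ≤ K) (n : ℕ) :
    0 ≤ ((K : ℝ) - 1) / K * ((K : ℝ) ^ n)⁻¹ := by
  have hK2 : (2 : ℝ) ≤ K := by exact_mod_cast hK
  have : 0 ≤ (K : ℝ) - 1 := by linarith
  positivity

/-- The density of states measure of the random operator on the canopy tree. -/
def canopyMeasure (P' : Measure Ω') (K m₀ : ℕ) (lam : ℝ) (η : canopySites K m₀ → Ω' → ℝ)
    (x : ℕ → CanopyVertex) : Measure ℝ :=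
  mixture (fun n => ((K : ℝ) - 1) / K * ((K : ℝ) ^ n)⁻¹) fun n =>
    meanSpectralMeasure P' (canopyGraph K) (canopySites K m₀) (canopyBlock K m₀) lam η (x n)

/-- Identifies the series of expectations with the mass of a genuine measure. -/
theorem canopyMeasure_real (hK : 2 ≤ K) {η : canopySites K m₀ → Ω' → ℝ}
    (hη : ∀ y s, |η y s| ≤ R) (hm : ∀ y, Measurable (η y)) (x : ℕ → CanopyVertex) {B : Set ℝ}
    (hB : MeasurableSet B) :
    (canopyMeasure P' K m₀ lam η x).real B = canopyDOS P' K m₀ lam η x B := by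
  have := (canopyModel hK m₀).isProbabilityMeasure_meanSpectralMeasure (P := P') (lam := lam) hη hm
  rw [canopyMeasure, mixture_real (geometric_weights_nonneg hK) hB, canopyDOS, ← tsum_mul_left]
  simp_rw [(canopyModel hK m₀).meanSpectralMeasure_real hη hm _ hB, canopyWeight_eq, mul_assoc]
  rfl

theorem isProbabilityMeasure_canopyMeasure (hK : 2 ≤ K) {η : canopySites K m₀ → Ω' → ℝ}
    (hη : ∀ y s, |η y s| ≤ R) (hm : ∀ y, Measurable (η y)) (x : ℕ → CanopyVertex) :
    IsProbabilityMeasure (canopyMeasure P' K m₀ lam η x) := by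
  have := (canopyModel hK m₀).isProbabilityMeasure_meanSpectralMeasure (P := P') (lam := lam) hη hm
  exact isProbabilityMeasure_mixture (geometric_weights_nonneg hK) (hasSum_geometric_weights hK)

omit [IsProbabilityMeasure P'] in
theorem canopyMeasure_compl (hK : 2 ≤ K) {η : canopySites K m₀ → Ω' → ℝ}
    (hη : ∀ y s, |η y s| ≤ R) (hm : ∀ y, Measurable (η y)) (x : ℕ → CanopyVertex) :
    canopyMeasure P' K m₀ lam η x (Set.Icc (-(canopyModel hK m₀).normBound (|lam| * R))
      ((canopyModel hK m₀).normBound (|lam| * R)))ᶜ = 0 :=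
  mixture_eq_zero measurableSet_Icc.compl fun _ =>
    (canopyModel hK m₀).meanSpectralMeasure_compl hη hm _

theorem integral_pow_canopyMeasure (hK : 2 ≤ K) {η : canopySites K m₀ → Ω' → ℝ}
    (hη : ∀ y s, |η y s| ≤ R) (hm : ∀ y, Measurable (η y)) (x : ℕ → CanopyVertex) (p : ℕ) :
    ∫ t, t ^ p ∂(canopyMeasure P' K m₀ lam η x) = ((K : ℝ) - 1) / K * ∑' n, ((K : ℝ) ^ n)⁻¹ *
      ∫ s, hopMoment (canopyModel hK m₀).nbhd ((canopyModel hK m₀).pot lam fun y => η y s) p (x n)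
        ∂P' := by
  have := isProbabilityMeasure_canopyMeasure (P' := P') (lam := lam) hK hη hm x
  rw [canopyMeasure, integral_mixture (geometric_weights_nonneg hK)
    (integrable_of_compl_Icc (canopyMeasure_compl hK hη hm x) (by fun_prop)), ← tsum_mul_left]
  simp_rw [(canopyModel hK m₀).integral_pow_meanSpectralMeasure hη hm, mul_assoc]

/-- The normalized eigenvalue counting measure of the cut-off operator. -/
def countingMeasure (K m₀ : ℕ) (lam : ℝ) (w : betheSites K m₀ → ℝ) (L : ℕ) : Measure ℝ :=
  mixture (fun _ : betheBall K L => ((BetheVertex.ball K L).card : ℝ)⁻¹) fun u =>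
    spectralMeasure (betheCutoff K m₀ lam w L) (delta u)

theorem finite_betheBall (K L : ℕ) : Finite (betheBall K L) := by
  rw [← BetheVertex.coe_ball]
  infer_instance

theorem sum_betheBall [Fintype (betheBall K L)] (E : BetheVertex K → ℝ) :
    ∑ u : betheBall K L, E u = ∑ x ∈ BetheVertex.ball K L, E x :=
  (Finset.sum_subtype _ (fun x => by rw [BetheVertex.mem_ball, BetheVertex.mem_betheBall]) _).symm

theorem hasSum_counting_weights (hK : 2 ≤ K) (L : ℕ) :
    HasSum (fun _ : betheBall K L => ((BetheVertex.ball K L).card : ℝ)⁻¹) 1 := by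
  have := finite_betheBall K L
  have := Fintype.ofFinite (betheBall K L)
  have h : ((BetheVertex.ball K L).card : ℝ) ≠ 0 := by
    have := (pow_pos two_pos L).trans_le (BetheVertex.pow_le_card_ball hK L)
    exact_mod_cast this.ne'
  convert hasSum_fintype _
  rw [sum_betheBall fun _ => ((BetheVertex.ball K L).card : ℝ)⁻¹, Finset.sum_const, nsmul_eq_mul,
    mul_inv_cancel₀ h]

theorem isProbabilityMeasure_spectralMeasure_betheCutoff {w : betheSites K m₀ → ℝ}
    (hw : ∀ y, |w y| ≤ R) (L : ℕ) (u : betheBall K L) :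
    IsProbabilityMeasure (spectralMeasure (betheCutoff K m₀ lam w L) (delta u)) := by
  have h := spectralMeasure_real_univ (isSelfAdjoint_compress (betheBall K L)
    ((betheModel K m₀).isSelfAdjoint_andersonOperator (lam := lam) hw)) (delta u)
  rw [norm_delta, one_pow, measureReal_def, ENNReal.toReal_eq_one_iff] at h
  exact ⟨h⟩

theorem isProbabilityMeasure_countingMeasure (hK : 2 ≤ K) {w : betheSites K m₀ → ℝ}
    (hw : ∀ y, |w y| ≤ R) (L : ℕ) : IsProbabilityMeasure (countingMeasure K m₀ lam w L) := by
  have := isProbabilityMeasure_spectralMeasure_betheCutoff (lam := lam) hw L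
  exact isProbabilityMeasure_mixture (fun _ => by positivity) (hasSum_counting_weights hK L)

theorem countingMeasure_compl {w : betheSites K m₀ → ℝ} (hw : ∀ y, |w y| ≤ R) (L : ℕ) :
    countingMeasure K m₀ lam w L (Set.Icc (-(betheModel K m₀).normBound (|lam| * R))
      ((betheModel K m₀).normBound (|lam| * R)))ᶜ = 0 :=
  mixture_eq_zero measurableSet_Icc.compl fun _ => spectralMeasure_compl_Icc _ _
    ((norm_compress_le _ _).trans ((betheModel K m₀).norm_andersonOperator_le hw))

theorem integral_pow_countingMeasure (hK : 2 ≤ K) {w : betheSites K m₀ → ℝ}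
    (hw : ∀ y, |w y| ≤ R) (L p : ℕ) : ∫ t, t ^ p ∂(countingMeasure K m₀ lam w L)
      = ((BetheVertex.ball K L).card : ℝ)⁻¹ * ∑ x ∈ BetheVertex.ball K L,
        hopMoment ((betheModel K m₀).cutNbhd (betheBall K L)) ((betheModel K m₀).pot lam w) p x := by
  have := isProbabilityMeasure_countingMeasure (lam := lam) hK hw L
  have := finite_betheBall K L
  have := Fintype.ofFinite (betheBall K L)
  rw [countingMeasure, integral_mixture (fun _ => by positivity)
    (integrable_of_compl_Icc (countingMeasure_compl hw L) (by fun_prop)), tsum_fintype,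
    ← Finset.mul_sum, ← sum_betheBall]
  congr 1
  exact Finset.sum_congr rfl fun u _ => (betheModel K m₀).integral_pow_compress _ hw u p

theorem trace_betheCutoff {w : betheSites K m₀ → ℝ} (hw : ∀ y, |w y| ≤ R) (L : ℕ)
    {B : Set ℝ} (hB : MeasurableSet B) :
    ((betheBall K L).ncard : ℂ)⁻¹ * LinearMap.trace ℂ (Ell2 (betheBall K L))
        (spectralProjection (betheCutoff K m₀ lam w L) B).toLinearMap
      = ((countingMeasure K m₀ lam w L).real B : ℂ) := by
  have := isProbabilityMeasure_spectralMeasure_betheCutoff (lam := lam) hw L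
  have := finite_betheBall K L
  have := Fintype.ofFinite (betheBall K L)
  have hcard : (betheBall K L).ncard = (BetheVertex.ball K L).card := by
    rw [← BetheVertex.coe_ball, Set.ncard_coe_finset]
  rw [trace_spectralProjection, countingMeasure, mixture_real (fun _ => by positivity) hB,
    tsum_fintype, ← Finset.mul_sum, hcard]
  push_cast
  rfl

variable {ω : betheSites K m₀ → Ω → ℝ} {η : canopySites K m₀ → Ω' → ℝ} {μ : Measure ℝ}

/-- For fixed `n`, once `L > m₀ + p + n`, vertices at distance `n` from the sphere are deep enough
for the comparison with the canopy tree. -/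
theorem tendsto_average_integral_hopMoment (hK : 2 ≤ K) (hω : ∀ y s, |ω y s| ≤ R)
    (hω_meas : ∀ y, Measurable (ω y)) (hω_indep : iIndepFun ω P) (hω_law : ∀ y, P.map (ω y) = μ)
    (hη_meas : ∀ y, Measurable (η y)) (hη_indep : iIndepFun η P') (hη_law : ∀ y, P'.map (η y) = μ)
    {x : ℕ → CanopyVertex} (hx : ∀ n, (x n).1 = n) (p : ℕ) :
    Tendsto (fun L => ((BetheVertex.ball K L).card : ℝ)⁻¹ * ∑ u ∈ BetheVertex.ball K L,
        ∫ s, hopMoment ((betheModel K m₀).cutNbhd (betheBall K L))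
          ((betheModel K m₀).pot lam fun y => ω y s) p u ∂P)
      (atTop ⊓ 𝓟 {L : ℕ | ∃ k : ℕ, L = m₀ + (m₀ + 1) * k})
      (𝓝 (((K : ℝ) - 1) / K * ∑' n, ((K : ℝ) ^ n)⁻¹ * ∫ s, hopMoment (canopyModel hK m₀).nbhd
        ((canopyModel hK m₀).pot lam fun y => η y s) p (x n) ∂P')) := by
  refine BetheVertex.tendsto_average_ball hK inf_le_left
    (E := fun L u => ∫ s, hopMoment ((betheModel K m₀).cutNbhd (betheBall K L))
          ((betheModel K m₀).pot lam fun y => ω y s) p u ∂P)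
    (C := (((betheModel K m₀).deg : ℝ) + |lam| * R) ^ p) (fun L u => ?_) fun n => ?_
  · rw [← Real.norm_eq_abs]
    refine (norm_integral_le_of_norm_le_const (Eventually.of_forall fun s => ?_)).trans_eq
      (by rw [probReal_univ, mul_one])
    exact abs_hopMoment_le ((betheModel K m₀).card_cutNbhd_le (betheBall K L))
      ((betheModel K m₀).abs_pot_le (lam := lam) fun y => hω y s) p u
  · filter_upwards [mem_inf_of_left (eventually_gt_atTop (m₀ + p + n)),
      mem_inf_of_right (mem_principal_self _)] with L hL hLk u hu
    obtain ⟨k, hk⟩ := hLk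
    refine integral_hopMoment_bethe_eq_canopy hK hω_meas hω_indep hω_law hη_meas hη_indep hη_law hk
      ?_ ?_ ?_
    · change m₀ + p + n < L at hL
      omega
    · omega
    · rw [hx]; omega

/-- Only countably many moments have to converge, so one null set serves all intervals. -/
theorem ae_tendsto_countingMeasure (hK : 2 ≤ K)
    (hω : ∀ y s, |ω y s| ≤ R)
    (hω_meas : ∀ y, Measurable (ω y)) (hω_indep : iIndepFun ω P) (hω_law : ∀ y, P.map (ω y) = μ)
    (hη : ∀ y s, |η y s| ≤ R) (hη_meas : ∀ y, Measurable (η y)) (hη_indep : iIndepFun η P')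
    (hη_law : ∀ y, P'.map (η y) = μ)
    {x : ℕ → CanopyVertex} (hx : ∀ n, (x n).1 = n)
    (hac : canopyMeasure P' K m₀ lam η x ≪ volume) :
    ∀ᵐ s ∂P, ∀ I : Set ℝ, I.OrdConnected → Tendsto
      (fun L => (countingMeasure K m₀ lam (fun y => ω y s) L).real I)
      (atTop ⊓ 𝓟 {L : ℕ | ∃ k : ℕ, L = m₀ + (m₀ + 1) * k})
      (𝓝 ((canopyMeasure P' K m₀ lam η x).real I)) := by
  filter_upwards [ae_all_iff.2 fun p => (betheModel K m₀).ae_tendsto_average_hopMoment (lam := lam)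
    hω hω_meas hω_indep (fun _ _ => BetheVertex.mem_reach_of_site_eq) (betheBall K)
    (BetheVertex.ball K) (BetheVertex.pow_le_card_ball hK) p] with s hs I hI
  have h1 := isProbabilityMeasure_countingMeasure (lam := lam) hK fun y => hω y s
  have h2 := isProbabilityMeasure_canopyMeasure (P' := P') (lam := lam) hK hη hη_meas x
  refine tendsto_measureReal_of_moments (countingMeasure_compl fun y => hω y s)
    (canopyMeasure_compl hK hη hη_meas x) (fun p => ?_) hac hI
  rw [integral_pow_canopyMeasure hK hη hη_meas]
  simp_rw [integral_pow_countingMeasure hK fun y => hω y s]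
  -- Vanishing fluctuation plus convergent mean.
  have h3 := ((hs p).mono_left inf_le_left).add (tendsto_average_integral_hopMoment (lam := lam) hK
    hω hω_meas hω_indep hω_law hη_meas hη_indep hη_law hx p)
  simpa using h3

end DensityOfStates

/-! ### Almost sure harmlessness of clipping. -/

section Clipping

variable {Ω ι : Type*} [MeasurableSpace Ω] {P : Measure Ω} {X : ι → Ω → ℝ} {μ : Measure ℝ} {R : ℝ}

theorem ae_clip_eq (hm : ∀ i, Measurable (X i)) (hlaw : ∀ i, P.map (X i) = μ)
    (hμ : μ (Set.Icc (-R) R)ᶜ = 0) (i : ι) : (fun s => clip R (X i s)) =ᵐ[P] X i := by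
  rw [← hlaw i, Measure.map_apply (hm i) measurableSet_Icc.compl] at hμ
  filter_upwards [compl_mem_ae_iff.2 hμ] with s hs
  exact clip_of_abs_le (abs_le.2 (by simpa using hs))

theorem map_clip_eq (hm : ∀ i, Measurable (X i)) (hlaw : ∀ i, P.map (X i) = μ)
    (hμ : μ (Set.Icc (-R) R)ᶜ = 0) (i : ι) : P.map (fun s => clip R (X i s)) = μ := by
  rw [Measure.map_congr (ae_clip_eq hm hlaw hμ i), hlaw i]

theorem ae_clip_eq_all [Countable ι] (hm : ∀ i, Measurable (X i)) (hlaw : ∀ i, P.map (X i) = μ)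
    (hμ : μ (Set.Icc (-R) R)ᶜ = 0) : ∀ᵐ s ∂P, (fun i => X i s) = fun i => clip R (X i s) := by
  filter_upwards [ae_all_iff.2 (ae_clip_eq hm hlaw hμ)] with s hs
  exact funext fun i => (hs i).symm

end Clipping

/-! ### Support and domination of the single-site law. -/

section Density

variable {ρ : ℝ → ℝ}

theorem exists_withDensity_compl_Icc (hρ : HasCompactSupport ρ) :
    ∃ R : ℝ, 0 ≤ R ∧ (volume.withDensity fun t => ENNReal.ofReal (ρ t)) (Set.Icc (-R) R)ᶜ = 0 := by
  obtain ⟨R, hR⟩ := hρ.isCompact.isBounded.subset_closedBall 0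
  refine ⟨max R 0, le_max_right _ _, ?_⟩
  rw [withDensity_apply _ measurableSet_Icc.compl,
    setLIntegral_congr_fun (g := fun _ => 0) measurableSet_Icc.compl fun t ht => ?_, lintegral_zero]
  have h : ρ t = 0 := by
    by_contra h0
    have h1 := hR (subset_tsupport ρ (Function.mem_support.2 h0))
    rw [mem_closedBall_zero_iff, Real.norm_eq_abs] at h1
    exact ht (abs_le.1 (h1.trans (le_max_left R 0)))
  simp [h]

theorem withDensity_le_smul_volume (hρ : ∀ t, 0 ≤ ρ t) : (volume.withDensity fun t =>
    ENNReal.ofReal (ρ t)) ≤ eLpNorm ρ ∞ volume • volume := by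
  rw [← withDensity_const]
  refine withDensity_mono ?_
  rw [eLpNorm_exponent_top]
  filter_upwards [enorm_ae_le_eLpNormEssSup ρ volume] with t ht
  rwa [← Real.enorm_of_nonneg (hρ t)]

end Density

end

end TreeAnderson

theorem theorem2 {Ω Ω' : Type*} [MeasurableSpace Ω] [MeasurableSpace Ω']
    (P : Measure Ω) [IsProbabilityMeasure P] (P' : Measure Ω') [IsProbabilityMeasure P']
    (K m₀ : ℕ) (hK : 2 ≤ K) (lam : ℝ) (hlam : 0 < lam)
    (ρ : ℝ → ℝ) (hρ_nonneg : ∀ t, 0 ≤ ρ t) (hρ_bdd : MemLp ρ ∞ volume)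
    (hρ_supp : HasCompactSupport ρ)
    (ω : TreeAnderson.betheSites K m₀ → Ω → ℝ) (hω_meas : ∀ y, Measurable (ω y))
    (hω_indep : iIndepFun ω P)
    (hω_law : ∀ y, P.map (ω y) = volume.withDensity fun t => ENNReal.ofReal (ρ t))
    (η : TreeAnderson.canopySites K m₀ → Ω' → ℝ) (hη_meas : ∀ y, Measurable (η y))
    (hη_indep : iIndepFun η P')
    (hη_law : ∀ y, P'.map (η y) = volume.withDensity fun t => ENNReal.ofReal (ρ t))
    (x : ℕ → TreeAnderson.CanopyVertex)
    (hx : ∀ n, TreeAnderson.canopyBoundaryDist K (x n) = n) :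
    (∀ I : Set ℝ, I.OrdConnected → ∀ᵐ s ∂P,
      Tendsto
        (fun L : ℕ => ((TreeAnderson.betheBall K L).ncard : ℂ)⁻¹ *
          LinearMap.trace ℂ (TreeAnderson.Ell2 (TreeAnderson.betheBall K L))
            (TreeAnderson.spectralProjection
              (TreeAnderson.betheCutoff K m₀ lam (fun y => ω y s) L) I).toLinearMap)
        (atTop ⊓ 𝓟 {L : ℕ | ∃ k : ℕ, L = m₀ + (m₀ + 1) * k})
        (𝓝 (TreeAnderson.canopyDOS P' K m₀ lam η x I : ℂ))) ∧
    (∀ B : Set ℝ, MeasurableSet B → ∀ n,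
      Integrable
        (fun s => TreeAnderson.canopyWeight K m₀ lam (fun y => η y s) B (x n)) P') ∧
    ∃ ν : Measure ℝ, IsFiniteMeasure ν ∧
      (∀ B : Set ℝ, MeasurableSet B → ν.real B = TreeAnderson.canopyDOS P' K m₀ lam η x B) ∧
      ν ≪ volume := by 
  obtain ⟨R, hR, hμR⟩ := TreeAnderson.exists_withDensity_compl_Icc hρ_supp
  have hμC := TreeAnderson.withDensity_le_smul_volume hρ_nonneg
  have hC : eLpNorm ρ ∞ volume ≠ ∞ := hρ_bdd.eLpNorm_ne_top
  generalize (volume.withDensity fun t => ENNReal.ofReal (ρ t)) = μ at hω_law hη_law hμR hμC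
  have hx' : ∀ n, (x n).1 = n := fun n => by
    rw [← TreeAnderson.canopyBoundaryDist_eq hK, hx]
  -- The total mass of the law is not assumed to be one; it follows because the root is a site and
  -- carries a random variable with this law.
  have hμ : IsProbabilityMeasure μ := by
    rw [← hω_law ⟨TreeAnderson.BetheVertex.root,
      TreeAnderson.BetheVertex.mem_betheSites.2 ⟨0, rfl⟩⟩]
    exact Measure.isProbabilityMeasure_map (hω_meas _).aemeasurable
  -- The coefficients are bounded only almost surely. Replacing them by clipped copies makes the
  -- potential bounded for every sample, and by countability of the sites nothing changes outside
  -- one null set.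
  have hω' := TreeAnderson.ae_clip_eq_all hω_meas hω_law hμR
  have hη' := TreeAnderson.ae_clip_eq_all hη_meas hη_law hμR
  have hclip := TreeAnderson.measurable_clip R
  have hω_bdd : ∀ y s, |TreeAnderson.clip R (ω y s)| ≤ R := fun y s =>
    TreeAnderson.abs_clip_le hR _
  have hη_bdd : ∀ y s, |TreeAnderson.clip R (η y s)| ≤ R := fun y s =>
    TreeAnderson.abs_clip_le hR _
  have hω_meas' : ∀ y, Measurable fun s => TreeAnderson.clip R (ω y s) := fun y =>
    hclip.comp (hω_meas y)
  have hη_meas' : ∀ y, Measurable fun s => TreeAnderson.clip R (η y s) := fun y =>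
    hclip.comp (hη_meas y)
  have hω_indep' : iIndepFun (fun y s => TreeAnderson.clip R (ω y s)) P :=
    hω_indep.comp (fun _ => TreeAnderson.clip R) fun _ => hclip
  have hη_indep' : iIndepFun (fun y s => TreeAnderson.clip R (η y s)) P' :=
    hη_indep.comp (fun _ => TreeAnderson.clip R) fun _ => hclip
  have hDOS : ∀ B : Set ℝ, MeasurableSet B →
      (TreeAnderson.canopyMeasure P' K m₀ lam (fun y s => TreeAnderson.clip R (η y s)) x).real B
        = TreeAnderson.canopyDOS P' K m₀ lam η x B := fun B hB => by
    rw [TreeAnderson.canopyMeasure_real hK hη_bdd hη_meas' x hB,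
      TreeAnderson.canopyDOS_congr hη']
  have hac : TreeAnderson.canopyMeasure P' K m₀ lam (fun y s => TreeAnderson.clip R (η y s)) x
      ≪ volume := TreeAnderson.mixture_absolutelyContinuous fun n =>
    (TreeAnderson.canopyModel hK m₀).meanSpectralMeasure_absolutelyContinuous hR hη_bdd hη_meas'
      hη_indep' (TreeAnderson.map_clip_eq hη_meas hη_law hμR) hC hμC hμR hlam (x n)
  have hfin := TreeAnderson.isProbabilityMeasure_canopyMeasure (P' := P') (lam := lam) hK hη_bdd
    hη_meas' x
  refine ⟨fun I hI => ?_, fun B hB n => ?_, _, inferInstance, hDOS, hac⟩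
  · filter_upwards [hω', TreeAnderson.ae_tendsto_countingMeasure hK hω_bdd hω_meas' hω_indep'
      (TreeAnderson.map_clip_eq hω_meas hω_law hμR) hη_bdd hη_meas' hη_indep'
      (TreeAnderson.map_clip_eq hη_meas hη_law hμR) hx' hac] with s hs h
    rw [← hDOS I hI.measurableSet]
    refine ((Complex.continuous_ofReal.tendsto _).comp (h I hI)).congr fun L => ?_
    have htr := TreeAnderson.trace_betheCutoff (K := K) (m₀ := m₀) (lam := lam)
      (fun y => hω_bdd y s) L hI.measurableSet
    rw [hs]
    exact htr.symm
  -- Integrability ensures that the Bochner integrals in `canopyDOS` are true expectations rather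
  -- than the default value `0`.
  · have hprob : ∀ s, IsProbabilityMeasure (TreeAnderson.spectralMeasure
        (TreeAnderson.canopyOperator K m₀ lam fun y => TreeAnderson.clip R (η y s))
        (TreeAnderson.delta (x n))) := fun s => (TreeAnderson.canopyModel hK m₀).isProbabilityMeasure_spectralMeasure
      (lam := lam) (fun y => hη_bdd y s) (x n)
    have hmeas := (TreeAnderson.canopyModel hK m₀).measurable_spectralMeasure (lam := lam)
      (w := fun s y => TreeAnderson.clip R (η y s)) (fun s y => hη_bdd y s) hη_meas' (x n)
    refine Integrable.congr (f := fun s => (TreeAnderson.spectralMeasure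
      (TreeAnderson.canopyOperator K m₀ lam fun y => TreeAnderson.clip R (η y s))
      (TreeAnderson.delta (x n))).real B) ?_ ?_
    · refine Integrable.of_bound ((Measure.measurable_coe hB).comp
        hmeas).ennreal_toReal.aestronglyMeasurable 1 (Eventually.of_forall fun s => ?_)
      rw [Real.norm_of_nonneg measureReal_nonneg]
      have := hprob s
      exact measureReal_le_one
    · filter_upwards [hη'] with s hs
      rw [TreeAnderson.canopyWeight_eq, hs]
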